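/- Let $R$ be a commutative ring and $(H,\mu,\iota,\Delta,\varepsilon)$ an $R$-bialgebra. Write $\otimes=\otimes_R$, $\Delta(h)=h_1\otimes h_2$, $[H,-]=\mathrm{Hom}_R(H,-)$, and $\mathbb M_R$ for the category of $R$-modules. **Monads.** Let $F$ be an endofunctor of a category with a monad structure $(m,i)$ and a comonad structure $(d,e)$. A *double entwining* is a natural transformation $\tau:FF\to FF$ which is an entwining (compatible with $m,i,d,e$ in the usual way) both from (monad)(comonad) to (comonad)(monad) and from (comonad)(monad) to (monad)(comonad). $F$ is a *$\tau$-bimonad* if moreover $e$ is a monad morphism to the identity, $i$ is a comonad morphism from the identity, and $mF\circ FFm\circ F\tau F\circ dFF\circ Fd=d\circ m$. It is a *$\tau$-Hopf monad* if in addition there is a natural transformation $S:F\to F$ with $m\circ SF\circ d=i\circ e=m\circ FS\circ d$. The functor $-\otimes H$ on $\mathbb M_R$ is a $\mathrm{tw}$-bimonad, with structure maps given by $\mu,\iota,\Delta,\varepsilon$ and $\mathrm{tw}$ the twist of $H\otimes H$. The functor $[H,-]$ is a $\overline{\mathrm{tw}}$-bimonad with product $[\Delta,-]$, unit $[\varepsilon,-]$,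 coproduct $[\mu,-]$ and counit $[\iota,-]$ (identifying $[H,[H,-]]\cong[H\otimes H,-]$), where $\overline{\mathrm{tw}}$ switches the arguments in $[H,[H,-]]$. **Hopf modules.** Let $\mathbb M^H_H$ be the category of right $H$-Hopf modules: right $H$-modules and right $H$-comodules $M$, with coaction $x\mapsto x_0\otimes x_1$, such that $(xb)_0\otimes (xb)_1=x_0b_1\otimes x_1b_2$; morphisms are the $H$-linear and $H$-colinear maps. Let $\mathbb M^{[H,-]}_{[H,-]}$ be the category of $[H,-]$-Hopf modules (right Hopf contramodules): right $H$-modules $M$ with a module structure $\alpha:[H,M]\to M$ for the monad $[H,-]$ such that $\alpha(f)\,b=\alpha\big(f(b_1\,-)\,b_2\big)$ for $f\in[H,M]$, $b\in H$; morphisms are the maps respecting both structures. For every $R$-module $X$, $X\otimes H$ is an $H$-Hopf module by $X\otimes\mu$ and $X\otimes\Delta$, and $[H,X]$ is an $[H,-]$-Hopf module by $[\mu,X]$ and $[\Delta,X]$. **Corings.** On $H\otimes H$ there are two $H$-coring structures: $H\otimes^rH$, with actions $d(a\otimes b)c=dac_1\otimes bc_2$, coproduct $a\otimes b\mapsto(a\otimes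 b_1)\otimes_H(1\otimes b_2)$ and counit $a\otimes b\mapsto a\,\varepsilon(b)$; and $H\otimes^lH$, with actions $d(a\otimes b)c=d_1a\otimes d_2bc$, coproduct $a\otimes b\mapsto(a_1\otimes1)\otimes_H(a_2\otimes b)$ and counit $a\otimes b\mapsto\varepsilon(a)\,b$. In both, $g=1\otimes1$ is grouplike, and $H$ is regarded as a right comodule by $h\mapsto 1\otimes_H gh$ and as a left comodule by $h\mapsto hg\otimes_H1$. **Galois comodules.** Let $\mathcal C$ be an $A$-coring. * A right $\mathcal C$-comodule $(N,\varrho)$ with $T=\mathrm{End}^{\mathcal C}(N)$ is *$\mathcal C$-Galois* if $\mathrm{Hom}_A(N,X)\otimes_TN\to X\otimes_A\mathcal C$, $f\otimes n\mapsto(f\otimes_A\mathcal C)\varrho(n)$, is an isomorphism for every right $A$-module $X$. It is *$\mathrm{Hom}_{A,-}(\mathcal C,-)$-Galois* if $\mathrm{Hom}_{A,-}(\mathcal C,Q)\to\mathrm{Hom}_T(N,N\otimes_AQ)$, $f\mapsto(N\otimes_Af)\varrho$, is an isomorphism for every left $A$-module $Q$. * A left $\mathcal C$-comodule $(N,\varrho)$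 with $T=\mathrm{End}^{\mathcal C}(N)$ is *$\mathcal C$-Galois* if $N\otimes_T\mathrm{Hom}_A(N,X)\to\mathcal C\otimes_AX$, $n\otimes f\mapsto(\mathcal C\otimes_Af)\varrho(n)$, is an isomorphism for every left $A$-module $X$. It is *$\mathrm{Hom}_{-,A}(\mathcal C,-)$-Galois* if $\mathrm{Hom}_{-,A}(\mathcal C,Q)\to\mathrm{Hom}_T(N,Q\otimes_AN)$, $f\mapsto(f\otimes_AN)\varrho$, is an isomorphism for every right $A$-module $Q$. **Theorem (Characterisations of Hopf algebras).** The following are equivalent, where in (c), (d), (j), (k) the left and right versions are also equivalent to each other. (a) $H$ is a Hopf algebra: there is an $R$-linear map $S:H\to H$ with $\mu\circ(H\otimes S)\circ\Delta=\iota\circ\varepsilon=\mu\circ(S\otimes H)\circ\Delta$. (b) The map $\gamma:H\otimes H\to H\otimes H$, $a\otimes b\mapsto a_1\otimes a_2b$, is an isomorphism. (c) $H$ is an $H\otimes^rH$-Galois right (equivalently, left) comodule. (d) $H$ is an $H\otimes^lH$-Galois right (equivalently, left) comodule. (e) $-\otimes H$ is a $\mathrm{tw}$-Hopf monad on $\mathbb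 M_R$. (f) The natural transformation $$[\gamma,-]:[H,[H,-]]\xrightarrow{[H,[\mu,-]]}[H,[H,[H,-]]]\xrightarrow{[\Delta,[H,-]]}[H,[H,-]]$$ is an isomorphism. (g) $[H,-]$ is a $\overline{\mathrm{tw}}$-Hopf monad on $\mathbb M_R$. (h) $-\otimes H:\mathbb M_R\to\mathbb M^H_H$ is an equivalence. (i) $[H,-]:\mathbb M_R\to\mathbb M^{[H,-]}_{[H,-]}$ is an equivalence. (j) $H$ is a $\mathrm{Hom}_{-,H}(H\otimes^rH,-)$-Galois left comodule (equivalently, a $\mathrm{Hom}_{H,-}(H\otimes^rH,-)$-Galois right comodule). (k) $H$ is a $\mathrm{Hom}_{-,H}(H\otimes^lH,-)$-Galois left comodule (equivalently, a $\mathrm{Hom}_{H,-}(H\otimes^lH,-)$-Galois right comodule). -/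

import Mathlib

open CategoryTheory TensorProduct MulOpposite
open scoped TensorProduct

universe v u

/-! ## Mixed bimodules and Hopf monads -/

/-- A mixed bimodule for a natural transformation `lam : FT ⟶ TF` between a monad `F` and a comonad
`T`: an `F`-module `(A, a)` with a `T`-comodule structure `k` on `A` satisfying the pentagonal law. -/
structure MixedBimodule {C : Type u} [Category.{v} C] (F : Monad C) (T : Comonad C)
    (lam : T.toFunctor ⋙ F.toFunctor ⟶ F.toFunctor ⋙ T.toFunctor) extends F.Algebra where
  k : A ⟶ T.obj A
  k_counit : k ≫ T.ε.app A = 𝟙 A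
  k_coassoc : k ≫ T.δ.app A = k ≫ T.map k
  pentagon : a ≫ k = F.map k ≫ lam.app A ≫ T.map a

namespace MixedBimodule

/-- Morphisms of mixed bimodules: morphisms of modules and of comodules. -/
@[ext]
structure Hom {C : Type u} [Category.{v} C] {F : Monad C} {T : Comonad C}
    {lam : T.toFunctor ⋙ F.toFunctor ⟶ F.toFunctor ⋙ T.toFunctor}
    (X Y : MixedBimodule F T lam) where
  f : X.A ⟶ Y.A
  h : F.map f ≫ Y.a = X.a ≫ f
  k : X.k ≫ T.map f = f ≫ Y.k

instance {C : Type u} [Category.{v} C] {F : Monad C} {T : Comonad C}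
    {lam : T.toFunctor ⋙ F.toFunctor ⟶ F.toFunctor ⋙ T.toFunctor} :
    Category.{v} (MixedBimodule F T lam) where
  Hom X Y := Hom X Y
  id X := ⟨𝟙 X.A, by simp, by simp⟩
  comp φ ψ := ⟨φ.f ≫ ψ.f, by simp [ψ.h, reassoc_of% φ.h],
    by simp [← ψ.k, reassoc_of% φ.k]⟩
  id_comp _ := Hom.ext (Category.id_comp _)
  comp_id _ := Hom.ext (Category.comp_id _)
  assoc _ _ _ := Hom.ext (Category.assoc _ _ _)

end MixedBimodule

/-- A `τ`-bimonad on a category: an endofunctor `F` with a monad structure `(η, μ)`, a comonad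
structure `(e, d)` and a double entwining `τ : FF ⟶ FF`, subject to the compatibility conditions. -/
structure TauBimonad (C : Type u) [Category.{v} C] extends Monad C where
  /-- the counit -/
  e : toFunctor ⟶ 𝟭 C
  /-- the coproduct -/
  d : toFunctor ⟶ toFunctor ⋙ toFunctor
  coassoc : ∀ X, d.app X ≫ toFunctor.map (d.app X) = d.app X ≫ d.app (toFunctor.obj X)
  left_counit : ∀ X, d.app X ≫ e.app (toFunctor.obj X) = 𝟙 _
  right_counit : ∀ X, d.app X ≫ toFunctor.map (e.app X) = 𝟙 _
  /-- the double entwining -/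
  τ : toFunctor ⋙ toFunctor ⟶ toFunctor ⋙ toFunctor
  /- `τ` is an entwining from (monad)(comonad) to (comonad)(monad) -/
  entw_mul : ∀ X, μ.app (toFunctor.obj X) ≫ τ.app X =
    toFunctor.map (τ.app X) ≫ τ.app (toFunctor.obj X) ≫ toFunctor.map (μ.app X)
  entw_unit : ∀ X, η.app (toFunctor.obj X) ≫ τ.app X = toFunctor.map (η.app X)
  entw_comul : ∀ X, τ.app X ≫ d.app (toFunctor.obj X) =
    toFunctor.map (d.app X) ≫ τ.app (toFunctor.obj X) ≫ toFunctor.map (τ.app X)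
  entw_counit : ∀ X, τ.app X ≫ e.app (toFunctor.obj X) = toFunctor.map (e.app X)
  /- `τ` is an entwining from (comonad)(monad) to (monad)(comonad) -/
  entw_mul' : ∀ X, toFunctor.map (μ.app X) ≫ τ.app X =
    τ.app (toFunctor.obj X) ≫ toFunctor.map (τ.app X) ≫ μ.app (toFunctor.obj X)
  entw_unit' : ∀ X, toFunctor.map (η.app X) ≫ τ.app X = η.app (toFunctor.obj X)
  entw_comul' : ∀ X, τ.app X ≫ toFunctor.map (d.app X) =
    d.app (toFunctor.obj X) ≫ toFunctor.map (τ.app X) ≫ τ.app (toFunctor.obj X)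
  entw_counit' : ∀ X, τ.app X ≫ toFunctor.map (e.app X) = e.app (toFunctor.obj X)
  /- the counit is a monad morphism to the identity monad -/
  e_mul : ∀ X, μ.app X ≫ e.app X = e.app (toFunctor.obj X) ≫ e.app X
  e_unit : ∀ X, η.app X ≫ e.app X = 𝟙 X
  /- the unit is a comonad morphism from the identity comonad -/
  unit_d : ∀ X, η.app X ≫ d.app X = η.app X ≫ η.app (toFunctor.obj X)
  /- compatibility of product and coproduct -/
  mul_d : ∀ X, μ.app X ≫ d.app X = toFunctor.map (d.app X) ≫
    d.app (toFunctor.obj (toFunctor.obj X)) ≫ toFunctor.map (τ.app (toFunctor.obj X)) ≫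
    toFunctor.map (toFunctor.map (μ.app X)) ≫ μ.app (toFunctor.obj X)

namespace TauBimonad

/-- The comonad underlying a `τ`-bimonad. -/
abbrev comonad {C : Type u} [Category.{v} C] (B : TauBimonad C) : Comonad C where
  toFunctor := B.toFunctor
  ε := B.e
  δ := B.d
  coassoc := B.coassoc
  left_counit := B.left_counit
  right_counit := B.right_counit

/-- A `τ`-bimonad is a `τ`-Hopf monad if it has an antipode. -/
def IsHopf {C : Type u} [Category.{v} C] (B : TauBimonad C) : Prop :=
  ∃ S : B.toFunctor ⟶ B.toFunctor,
    (∀ X, B.d.app X ≫ S.app (B.obj X) ≫ B.μ.app X = B.e.app X ≫ B.η.app X) ∧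
    (∀ X, B.d.app X ≫ B.map (S.app X) ≫ B.μ.app X = B.e.app X ≫ B.η.app X)

/-- The natural transformation `FF ⟶ FFF ⟶ FF` given by `F d` followed by `m F`. -/
def fusion {C : Type u} [Category.{v} C] (B : TauBimonad C) :
    B.toFunctor ⋙ B.toFunctor ⟶ B.toFunctor ⋙ B.toFunctor where
  app X := B.map (B.d.app X) ≫ B.μ.app (B.obj X)
  naturality X Y f := by
    have h1 := B.d.naturality f
    have h2 := B.μ.naturality (B.map f)
    simp only [Functor.comp_obj, Functor.comp_map, Category.assoc] at h1 h2 ⊢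
    rw [← h2, ← B.map_comp_assoc, h1, B.map_comp_assoc]

/-- If `lam : FF ⟶ FF` satisfies `d ∘ m = F m ∘ lam F ∘ F d`, every `F X` is a mixed bimodule by `m`
and `d`; this is the induced functor to the category of mixed bimodules. -/
def toMixed {C : Type u} [Category.{v} C] (B : TauBimonad C)
    (lam : B.toFunctor ⋙ B.toFunctor ⟶ B.toFunctor ⋙ B.toFunctor)
    (hlam : ∀ X, B.μ.app X ≫ B.d.app X =
      B.map (B.d.app X) ≫ lam.app (B.obj X) ≫ B.map (B.μ.app X)) :
    C ⥤ MixedBimodule B.toMonad B.comonad lam where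
  obj X :=
    { A := B.obj X
      a := B.μ.app X
      unit := B.left_unit X
      assoc := (B.assoc X).symm
      k := B.d.app X
      k_counit := B.left_counit X
      k_coassoc := (B.coassoc X).symm
      pentagon := hlam X }
  map f := ⟨B.map f, B.μ.naturality f, (B.d.naturality f).symm⟩
  map_id X := MixedBimodule.Hom.ext (B.map_id X)
  map_comp f g := MixedBimodule.Hom.ext (B.map_comp f g)

end TauBimonad

/-! ## The bimonads `- ⊗ H` and `Hom(H, -)` -/

section Bialgebra

variable (R H : Type u) [CommRing R] [Ring H] [Bialgebra R H]

/-- `ψ_r(a ⊗ b) = b₁ ⊗ a b₂`. -/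
def psiR : H ⊗[R] H →ₗ[R] H ⊗[R] H :=
  (LinearMap.mul' R H).lTensor H ∘ₗ (TensorProduct.leftComm R H H H).toLinearMap ∘ₗ
    (Coalgebra.comul (R := R) (A := H)).lTensor H

/-- `ψ_l(a ⊗ b) = a₁ b ⊗ a₂`. -/
def psiL : H ⊗[R] H →ₗ[R] H ⊗[R] H :=
  (LinearMap.mul' R H).rTensor H ∘ₗ (TensorProduct.rightComm R H H H).toLinearMap ∘ₗ
    (Coalgebra.comul (R := R) (A := H)).rTensor H

/-- The Galois map `γ(a ⊗ b) = a₁ ⊗ a₂ b`. -/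
def galoisMap : H ⊗[R] H →ₗ[R] H ⊗[R] H :=
  (LinearMap.mul' R H).lTensor H ∘ₗ (TensorProduct.assoc R H H H).toLinearMap ∘ₗ
    (Coalgebra.comul (R := R) (A := H)).rTensor H

section Tensor

variable (X : Type u) [AddCommGroup X] [Module R X]

/-- `x ↦ x ⊗ 1`. -/
def tensorUnit : X →ₗ[R] X ⊗[R] H :=
  (Algebra.linearMap R H).lTensor X ∘ₗ (TensorProduct.rid R X).symm.toLinearMap

/-- `x ⊗ a ⊗ b ↦ x ⊗ a b`. -/
def tensorMul : (X ⊗[R] H) ⊗[R] H →ₗ[R] X ⊗[R] H :=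
  (LinearMap.mul' R H).lTensor X ∘ₗ (TensorProduct.assoc R X H H).toLinearMap

/-- `x ⊗ a ↦ ε(a) x`. -/
def tensorCounit : X ⊗[R] H →ₗ[R] X :=
  (TensorProduct.rid R X).toLinearMap ∘ₗ (Coalgebra.counit (R := R) (A := H)).lTensor X

/-- `x ⊗ a ↦ x ⊗ a₁ ⊗ a₂`. -/
def tensorComul : X ⊗[R] H →ₗ[R] (X ⊗[R] H) ⊗[R] H :=
  (TensorProduct.assoc R X H H).symm.toLinearMap ∘ₗ
    (Coalgebra.comul (R := R) (A := H)).lTensor X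

variable {R H} in
/-- `I_X ⊗ φ` on `X ⊗ H ⊗ H`. -/
def tensorEndo (φ : H ⊗[R] H →ₗ[R] H ⊗[R] H) : (X ⊗[R] H) ⊗[R] H →ₗ[R] (X ⊗[R] H) ⊗[R] H :=
  (TensorProduct.assoc R X H H).symm.toLinearMap ∘ₗ φ.lTensor X ∘ₗ
    (TensorProduct.assoc R X H H).toLinearMap

variable {X}

variable {R} in
lemma tensorUnit_apply (x : X) : tensorUnit R H X x = x ⊗ₜ 1 := by simp [tensorUnit]

variable {R H} in
lemma tensorMul_apply (x : X) (a b : H) : tensorMul R H X ((x ⊗ₜ a) ⊗ₜ b) = x ⊗ₜ (a * b) := by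
  simp [tensorMul]

variable {R H} in
lemma tensorCounit_apply (x : X) (a : H) :
    tensorCounit R H X (x ⊗ₜ a) = Coalgebra.counit (R := R) a • x := by
  simp [tensorCounit]

variable {R H} in
lemma tensorComul_apply (x : X) (a : H) :
    tensorComul R H X (x ⊗ₜ a) =
      (TensorProduct.assoc R X H H).symm (x ⊗ₜ Coalgebra.comul (R := R) a) := by
  simp [tensorComul]

variable {R H} in
lemma tensorEndo_apply (φ : H ⊗[R] H →ₗ[R] H ⊗[R] H) (x : X) (a b : H) :
    tensorEndo X φ ((x ⊗ₜ a) ⊗ₜ b) = (TensorProduct.assoc R X H H).symm (x ⊗ₜ φ (a ⊗ₜ b)) := by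
  simp [tensorEndo]

variable {R H} in
lemma tensorEndo_comm_apply (x : X) (a b : H) :
    tensorEndo X (TensorProduct.comm R H H).toLinearMap ((x ⊗ₜ a) ⊗ₜ b) = (x ⊗ₜ b) ⊗ₜ a := by
  simp [tensorEndo]

variable {R H} in
lemma rTensor_assoc_symm {Y : Type u} [AddCommGroup Y] [Module R Y] (f : X →ₗ[R] Y) (x : X)
    (t : H ⊗[R] H) :
    (f.rTensor H).rTensor H ((TensorProduct.assoc R X H H).symm (x ⊗ₜ t)) =
      (TensorProduct.assoc R Y H H).symm (f x ⊗ₜ t) := by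
  induction t with
  | zero => simp
  | tmul p q => simp
  | add p q hp hq => simp only [TensorProduct.tmul_add, map_add, hp, hq]

end Tensor

/-- The endofunctor `- ⊗ H` of the category of `R`-modules. -/
@[simps]
def tensorFunctor : ModuleCat.{u} R ⥤ ModuleCat.{u} R where
  obj X := ModuleCat.of R (X ⊗[R] H)
  map f := ModuleCat.ofHom (f.hom.rTensor H)
  map_id X := by ext : 1; simp
  map_comp f g := by ext : 1; simp [LinearMap.rTensor_comp]

variable {R H} in
/-- The natural transformation `- ⊗ φ` of `- ⊗ H ⊗ H`. -/
def tensorEndoNat (φ : H ⊗[R] H →ₗ[R] H ⊗[R] H) :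
    tensorFunctor R H ⋙ tensorFunctor R H ⟶ tensorFunctor R H ⋙ tensorFunctor R H where
  app X := ModuleCat.ofHom (tensorEndo X φ)
  naturality X Y f := by
    refine ModuleCat.hom_ext (TensorProduct.ext_threefold fun x a b ↦ ?_)
    change tensorEndo Y φ ((f.hom.rTensor H).rTensor H ((x ⊗ₜ a) ⊗ₜ b)) =
      (f.hom.rTensor H).rTensor H (tensorEndo X φ ((x ⊗ₜ a) ⊗ₜ b))
    rw [tensorEndo_apply, rTensor_assoc_symm]
    exact tensorEndo_apply φ (f.hom x) a b

section TensorLaws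

variable (X : Type u) [AddCommGroup X] [Module R X]

lemma tensor_assoc : tensorMul R H X ∘ₗ (tensorMul R H X).rTensor H =
    tensorMul R H X ∘ₗ tensorMul R H (X ⊗[R] H) :=
  TensorProduct.ext_fourfold fun x a b c ↦ by simp [tensorMul_apply, mul_assoc]

lemma tensor_left_unit : tensorMul R H X ∘ₗ tensorUnit R H (X ⊗[R] H) = LinearMap.id :=
  TensorProduct.ext' fun x a ↦ by simp [tensorMul_apply, tensorUnit_apply]

lemma tensor_right_unit : tensorMul R H X ∘ₗ (tensorUnit R H X).rTensor H = LinearMap.id :=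
  TensorProduct.ext' fun x a ↦ by simp [tensorMul_apply, tensorUnit_apply]

lemma tensor_coassoc : (tensorComul R H X).rTensor H ∘ₗ tensorComul R H X =
    tensorComul R H (X ⊗[R] H) ∘ₗ tensorComul R H X := by
  refine TensorProduct.ext' fun x a ↦ ?_
  set K : H ⊗[R] (H ⊗[R] H) →ₗ[R] ((X ⊗[R] H) ⊗[R] H) ⊗[R] H :=
    ((TensorProduct.mk R X H x).rTensor H).rTensor H ∘ₗ
      (TensorProduct.assoc R H H H).symm.toLinearMap
  have h1 : ∀ t : H ⊗[R] H, (tensorComul R H X).rTensor H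
      ((TensorProduct.assoc R X H H).symm (x ⊗ₜ t)) =
      K (TensorProduct.assoc R H H H ((Coalgebra.comul (R := R)).rTensor H t)) := by
    intro t
    induction t with
    | zero => simp
    | add p q hp hq => simp only [TensorProduct.tmul_add, map_add, hp, hq]
    | tmul p q =>
      simp only [TensorProduct.assoc_symm_tmul, LinearMap.rTensor_tmul, tensorComul_apply, K,
        LinearMap.comp_apply, LinearEquiv.coe_coe, LinearEquiv.symm_apply_apply]
      congr 1
  have h2 : ∀ t : H ⊗[R] H, tensorComul R H (X ⊗[R] H)
      ((TensorProduct.assoc R X H H).symm (x ⊗ₜ t)) =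
      K ((Coalgebra.comul (R := R)).lTensor H t) := by
    intro t
    induction t with
    | zero => simp
    | add p q hp hq => simp only [TensorProduct.tmul_add, map_add, hp, hq]
    | tmul p q =>
      simp only [TensorProduct.assoc_symm_tmul, LinearMap.lTensor_tmul, tensorComul_apply]
      induction Coalgebra.comul (R := R) q with
      | zero => simp
      | add p q hp hq => simp only [TensorProduct.tmul_add, map_add, hp, hq]
      | tmul p q => simp [K]
  rw [LinearMap.comp_apply, LinearMap.comp_apply, tensorComul_apply, h1, h2,
    Coalgebra.coassoc_apply]

lemma tensor_left_counit : tensorCounit R H (X ⊗[R] H) ∘ₗ tensorComul R H X = LinearMap.id := by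
  refine TensorProduct.ext' fun x a ↦ ?_
  have h : ∀ t : H ⊗[R] H, tensorCounit R H (X ⊗[R] H)
      ((TensorProduct.assoc R X H H).symm (x ⊗ₜ t)) =
      x ⊗ₜ TensorProduct.rid R H ((Coalgebra.counit (R := R)).lTensor H t) := by
    intro t
    induction t with
    | zero => simp
    | add p q hp hq => simp only [TensorProduct.tmul_add, map_add, hp, hq]
    | tmul p q => simp [tensorCounit_apply]
  rw [LinearMap.comp_apply, tensorComul_apply, h, Coalgebra.lTensor_counit_comul]
  simp

lemma tensor_right_counit :
    (tensorCounit R H X).rTensor H ∘ₗ tensorComul R H X = LinearMap.id := by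
  refine TensorProduct.ext' fun x a ↦ ?_
  have h : ∀ t : H ⊗[R] H, (tensorCounit R H X).rTensor H
      ((TensorProduct.assoc R X H H).symm (x ⊗ₜ t)) =
      x ⊗ₜ TensorProduct.lid R H ((Coalgebra.counit (R := R)).rTensor H t) := by
    intro t
    induction t with
    | zero => simp
    | add p q hp hq => simp only [TensorProduct.tmul_add, map_add, hp, hq]
    | tmul p q => simp [tensorCounit_apply, TensorProduct.smul_tmul]
  rw [LinearMap.comp_apply, tensorComul_apply, h, Coalgebra.rTensor_counit_comul]
  simp

/-- `x ⊗ a ⊗ b ↦ x ⊗ b ⊗ a`. -/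
abbrev tensorTw : (X ⊗[R] H) ⊗[R] H →ₗ[R] (X ⊗[R] H) ⊗[R] H :=
  tensorEndo X (TensorProduct.comm R H H).toLinearMap

lemma tensor_entw_mul : tensorTw R H X ∘ₗ tensorMul R H (X ⊗[R] H) =
    ((tensorMul R H X).rTensor H ∘ₗ tensorTw R H (X ⊗[R] H)) ∘ₗ (tensorTw R H X).rTensor H :=
  TensorProduct.ext_fourfold fun x a b c ↦ by simp [tensorMul_apply, tensorEndo_comm_apply]

lemma tensor_entw_unit : tensorTw R H X ∘ₗ tensorUnit R H (X ⊗[R] H) =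
    (tensorUnit R H X).rTensor H :=
  TensorProduct.ext' fun x a ↦ by simp [tensorUnit_apply, tensorEndo_comm_apply]

lemma tensor_entw_comul : tensorComul R H (X ⊗[R] H) ∘ₗ tensorTw R H X =
    ((tensorTw R H X).rTensor H ∘ₗ tensorTw R H (X ⊗[R] H)) ∘ₗ (tensorComul R H X).rTensor H := by
  refine TensorProduct.ext_threefold fun x a b ↦ ?_
  simp only [LinearMap.comp_apply, LinearMap.rTensor_tmul, tensorEndo_comm_apply,
    tensorComul_apply]
  induction Coalgebra.comul (R := R) a with
  | zero => simp
  | add p q hp hq => simp only [TensorProduct.tmul_add, TensorProduct.add_tmul, map_add, hp, hq]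
  | tmul p q => simp [tensorEndo_comm_apply]

lemma tensor_entw_counit : tensorCounit R H (X ⊗[R] H) ∘ₗ tensorTw R H X =
    (tensorCounit R H X).rTensor H :=
  TensorProduct.ext_threefold fun x a b ↦ by
    simp [tensorCounit_apply, tensorEndo_comm_apply, TensorProduct.smul_tmul']

lemma tensor_entw_mul' : tensorTw R H X ∘ₗ (tensorMul R H X).rTensor H =
    (tensorMul R H (X ⊗[R] H) ∘ₗ (tensorTw R H X).rTensor H) ∘ₗ tensorTw R H (X ⊗[R] H) :=
  TensorProduct.ext_fourfold fun x a b c ↦ by simp [tensorMul_apply, tensorEndo_comm_apply]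

lemma tensor_entw_unit' : tensorTw R H X ∘ₗ (tensorUnit R H X).rTensor H =
    tensorUnit R H (X ⊗[R] H) :=
  TensorProduct.ext' fun x a ↦ by simp [tensorUnit_apply, tensorEndo_comm_apply]

lemma tensor_entw_comul' : (tensorComul R H X).rTensor H ∘ₗ tensorTw R H X =
    (tensorTw R H (X ⊗[R] H) ∘ₗ (tensorTw R H X).rTensor H) ∘ₗ tensorComul R H (X ⊗[R] H) := by
  refine TensorProduct.ext_threefold fun x a b ↦ ?_
  simp only [LinearMap.comp_apply, LinearMap.rTensor_tmul, tensorEndo_comm_apply,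
    tensorComul_apply]
  induction Coalgebra.comul (R := R) b with
  | zero => simp
  | add p q hp hq => simp only [TensorProduct.tmul_add, TensorProduct.add_tmul, map_add, hp, hq]
  | tmul p q => simp [tensorEndo_comm_apply]

lemma tensor_entw_counit' : (tensorCounit R H X).rTensor H ∘ₗ tensorTw R H X =
    tensorCounit R H (X ⊗[R] H) :=
  TensorProduct.ext_threefold fun x a b ↦ by
    simp [tensorCounit_apply, tensorEndo_comm_apply, TensorProduct.smul_tmul']

lemma tensor_e_mul : tensorCounit R H X ∘ₗ tensorMul R H X =
    tensorCounit R H X ∘ₗ tensorCounit R H (X ⊗[R] H) :=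
  TensorProduct.ext_threefold fun x a b ↦ by
    simp [tensorCounit_apply, tensorMul_apply, smul_smul, mul_comm]

lemma tensor_e_unit : tensorCounit R H X ∘ₗ tensorUnit R H X = LinearMap.id :=
  LinearMap.ext fun x ↦ by simp [tensorCounit_apply, tensorUnit_apply]

lemma tensor_unit_d : tensorComul R H X ∘ₗ tensorUnit R H X =
    tensorUnit R H (X ⊗[R] H) ∘ₗ tensorUnit R H X :=
  LinearMap.ext fun x ↦ by
    simp [tensorComul_apply, tensorUnit_apply, Algebra.TensorProduct.one_def]

lemma tensor_mul_d : tensorComul R H X ∘ₗ tensorMul R H X =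
    (((tensorMul R H (X ⊗[R] H) ∘ₗ ((tensorMul R H X).rTensor H).rTensor H) ∘ₗ
      (tensorTw R H (X ⊗[R] H)).rTensor H) ∘ₗ tensorComul R H ((X ⊗[R] H) ⊗[R] H)) ∘ₗ (tensorComul R H X).rTensor H := by
  refine TensorProduct.ext_threefold fun x a b ↦ ?_
  simp only [LinearMap.comp_apply, LinearMap.rTensor_tmul, tensorMul_apply,
    tensorComul_apply, Bialgebra.comul_mul]
  induction Coalgebra.comul (R := R) a with
  | zero => simp
  | add p q hp hq =>
    simp only [TensorProduct.tmul_add, TensorProduct.add_tmul, map_add, hp, hq, add_mul]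
  | tmul p q =>
    induction Coalgebra.comul (R := R) b with
    | zero => simp
    | add p q hp hq => simp only [TensorProduct.tmul_add, map_add, hp, hq, mul_add]
    | tmul r s => simp [tensorEndo_comm_apply, tensorMul_apply]

lemma tensor_psi : tensorComul R H X ∘ₗ tensorMul R H X =
    ((tensorMul R H X).rTensor H ∘ₗ tensorEndo (X ⊗[R] H) (psiR R H)) ∘ₗ (tensorComul R H X).rTensor H := by
  refine TensorProduct.ext_threefold fun x a b ↦ ?_
  simp only [LinearMap.comp_apply, LinearMap.rTensor_tmul, tensorMul_apply,
    tensorComul_apply, Bialgebra.comul_mul]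
  induction Coalgebra.comul (R := R) a with
  | zero => simp
  | add p q hp hq =>
    simp only [TensorProduct.tmul_add, TensorProduct.add_tmul, map_add, hp, hq, add_mul]
  | tmul p q =>
    simp only [TensorProduct.assoc_symm_tmul, tensorEndo_apply, psiR, LinearMap.comp_apply,
      LinearMap.lTensor_tmul]
    induction Coalgebra.comul (R := R) b with
    | zero => simp
    | add p q hp hq => simp only [TensorProduct.tmul_add, map_add, hp, hq, mul_add]
    | tmul r s => simp [tensorMul_apply]

variable {X}
variable {Y : Type u} [AddCommGroup Y] [Module R Y] (f : X →ₗ[R] Y)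

lemma tensor_unit_nat : tensorUnit R H Y ∘ₗ f = f.rTensor H ∘ₗ tensorUnit R H X :=
  LinearMap.ext fun x ↦ by simp [tensorUnit_apply]

lemma tensor_mul_nat : tensorMul R H Y ∘ₗ (f.rTensor H).rTensor H =
    f.rTensor H ∘ₗ tensorMul R H X :=
  TensorProduct.ext_threefold fun x a b ↦ by simp [tensorMul_apply]

lemma tensor_counit_nat : tensorCounit R H Y ∘ₗ f.rTensor H = f ∘ₗ tensorCounit R H X :=
  TensorProduct.ext' fun x a ↦ by simp [tensorCounit_apply]

lemma tensor_comul_nat : tensorComul R H Y ∘ₗ f.rTensor H =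
    (f.rTensor H).rTensor H ∘ₗ tensorComul R H X :=
  TensorProduct.ext' fun x a ↦ by simp [tensorComul_apply, rTensor_assoc_symm]

end TensorLaws

/-- The `tw`-bimonad `- ⊗ H` on the category of `R`-modules. -/
def tensorBimonad : TauBimonad (ModuleCat.{u} R) where
  toFunctor := tensorFunctor R H
  η := ⟨fun X ↦ ModuleCat.ofHom (tensorUnit R H X),
    fun _ _ f ↦ ModuleCat.hom_ext (tensor_unit_nat R H f.hom)⟩
  μ := ⟨fun X ↦ ModuleCat.ofHom (tensorMul R H X),
    fun _ _ f ↦ ModuleCat.hom_ext (tensor_mul_nat R H f.hom)⟩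
  assoc X := ModuleCat.hom_ext (tensor_assoc R H X)
  left_unit X := ModuleCat.hom_ext (tensor_left_unit R H X)
  right_unit X := ModuleCat.hom_ext (tensor_right_unit R H X)
  e := ⟨fun X ↦ ModuleCat.ofHom (tensorCounit R H X),
    fun _ _ f ↦ ModuleCat.hom_ext (tensor_counit_nat R H f.hom)⟩
  d := ⟨fun X ↦ ModuleCat.ofHom (tensorComul R H X),
    fun _ _ f ↦ ModuleCat.hom_ext (tensor_comul_nat R H f.hom)⟩
  coassoc X := ModuleCat.hom_ext (tensor_coassoc R H X)
  left_counit X := ModuleCat.hom_ext (tensor_left_counit R H X)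
  right_counit X := ModuleCat.hom_ext (tensor_right_counit R H X)
  τ := tensorEndoNat (TensorProduct.comm R H H).toLinearMap
  entw_mul X := ModuleCat.hom_ext (tensor_entw_mul R H X)
  entw_unit X := ModuleCat.hom_ext (tensor_entw_unit R H X)
  entw_comul X := ModuleCat.hom_ext (tensor_entw_comul R H X)
  entw_counit X := ModuleCat.hom_ext (tensor_entw_counit R H X)
  entw_mul' X := ModuleCat.hom_ext (tensor_entw_mul' R H X)
  entw_unit' X := ModuleCat.hom_ext (tensor_entw_unit' R H X)
  entw_comul' X := ModuleCat.hom_ext (tensor_entw_comul' R H X)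
  entw_counit' X := ModuleCat.hom_ext (tensor_entw_counit' R H X)
  e_mul X := ModuleCat.hom_ext (tensor_e_mul R H X)
  e_unit X := ModuleCat.hom_ext (tensor_e_unit R H X)
  unit_d X := ModuleCat.hom_ext (tensor_unit_d R H X)
  mul_d X := ModuleCat.hom_ext (tensor_mul_d R H X)

/-- The mixed distributive law `- ⊗ ψ_r`. -/
def tensorPsi : (tensorBimonad R H).toFunctor ⋙ (tensorBimonad R H).toFunctor ⟶
    (tensorBimonad R H).toFunctor ⋙ (tensorBimonad R H).toFunctor :=
  tensorEndoNat (psiR R H)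

/-- The category of right `H`-Hopf modules: mixed bimodules for the entwining `- ⊗ ψ_r`, that is,
right `H`-modules and right `H`-comodules `M` with `(m b)₀ ⊗ (m b)₁ = m₀ b₁ ⊗ m₁ b₂`. -/
abbrev HopfModuleCat : Type (u + 1) :=
  MixedBimodule (tensorBimonad R H).toMonad (tensorBimonad R H).comonad (tensorPsi R H)

/-- The functor `- ⊗ H` from `R`-modules to right `H`-Hopf modules. -/
def tensorHopfFunctor : ModuleCat.{u} R ⥤ HopfModuleCat R H :=
  (tensorBimonad R H).toMixed (tensorPsi R H) fun X ↦ ModuleCat.hom_ext (tensor_psi R H X)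

section Hom

variable (X : Type u) [AddCommGroup X] [Module R X]

/-- The unit `[ε, X]`. -/
def homUnit : X →ₗ[R] H →ₗ[R] X :=
  LinearMap.lcomp R X (Coalgebra.counit (R := R) (A := H)) ∘ₗ
    (LinearMap.ringLmapEquivSelf R R X).symm.toLinearMap

/-- The product `[Δ, X]`, using `[H, [H, X]] ≅ [H ⊗ H, X]`. -/
def homMul : (H →ₗ[R] H →ₗ[R] X) →ₗ[R] H →ₗ[R] X :=
  LinearMap.lcomp R X (Coalgebra.comul (R := R) (A := H)) ∘ₗ
    (TensorProduct.lift.equiv (RingHom.id R) H H X).toLinearMap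

/-- The counit `[ι, X]`. -/
def homCounit : (H →ₗ[R] X) →ₗ[R] X :=
  (LinearMap.ringLmapEquivSelf R R X).toLinearMap ∘ₗ LinearMap.lcomp R X (Algebra.linearMap R H)

/-- The coproduct `[μ, X]`, using `[H ⊗ H, X] ≅ [H, [H, X]]`. -/
def homComul : (H →ₗ[R] X) →ₗ[R] H →ₗ[R] H →ₗ[R] X :=
  (TensorProduct.lift.equiv (RingHom.id R) H H X).symm.toLinearMap ∘ₗ
    LinearMap.lcomp R X (LinearMap.mul' R H)

variable {R H} in
/-- `[φ, X]` on `[H, [H, X]] ≅ [H ⊗ H, X]`. -/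
def homEndo (φ : H ⊗[R] H →ₗ[R] H ⊗[R] H) : (H →ₗ[R] H →ₗ[R] X) →ₗ[R] H →ₗ[R] H →ₗ[R] X :=
  (TensorProduct.lift.equiv (RingHom.id R) H H X).symm.toLinearMap ∘ₗ LinearMap.lcomp R X φ ∘ₗ
    (TensorProduct.lift.equiv (RingHom.id R) H H X).toLinearMap

/-- Switching the arguments. -/
abbrev homTw : (H →ₗ[R] H →ₗ[R] X) →ₗ[R] H →ₗ[R] H →ₗ[R] X :=
  homEndo X (TensorProduct.comm R H H).toLinearMap

variable {X}

variable {R H} in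
lemma homUnit_apply (x : X) (a : H) : homUnit R H X x a = Coalgebra.counit (R := R) a • x := by
  simp [homUnit]

variable {R H} in
lemma homMul_apply (g : H →ₗ[R] H →ₗ[R] X) (a : H) :
    homMul R H X g a = TensorProduct.lift g (Coalgebra.comul (R := R) a) := by
  rfl

variable {R H} in
lemma homCounit_apply (f : H →ₗ[R] X) : homCounit R H X f = f 1 := by
  simp [homCounit]

variable {R H} in
lemma homComul_apply (f : H →ₗ[R] X) (a b : H) : homComul R H X f a b = f (a * b) := by
  rfl

variable {R H} in
lemma homEndo_apply (φ : H ⊗[R] H →ₗ[R] H ⊗[R] H) (g : H →ₗ[R] H →ₗ[R] X) (a b : H) :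
    homEndo X φ g a b = TensorProduct.lift g (φ (a ⊗ₜ b)) := by
  rfl

variable {R H} in
lemma homTw_apply (g : H →ₗ[R] H →ₗ[R] X) (a b : H) : homTw R H X g a b = g b a := by
  simp [homEndo_apply]

variable {R H} in
/-- Post-composition with a linear map. -/
abbrev homPost {X Y : Type u} [AddCommMonoid X] [Module R X] [AddCommMonoid Y] [Module R Y]
    (f : X →ₗ[R] Y) :
    (H →ₗ[R] X) →ₗ[R] H →ₗ[R] Y := LinearMap.compRight R f

variable {R H} in
lemma lift_homPost {Y : Type u} [AddCommGroup Y] [Module R Y] (f : X →ₗ[R] Y)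
    (g : H →ₗ[R] H →ₗ[R] X) (t : H ⊗[R] H) :
    TensorProduct.lift (homPost (homPost f) g) t = f (TensorProduct.lift g t) := by
  induction t with
  | zero => simp
  | tmul p q => rfl
  | add p q hp hq => simp only [map_add, hp, hq]

end Hom

/-- The endofunctor `Hom_R(H, -)` of the category of `R`-modules. -/
@[simps]
def homFunctor : ModuleCat.{u} R ⥤ ModuleCat.{u} R where
  obj X := ModuleCat.of R (H →ₗ[R] X)
  map f := ModuleCat.ofHom (LinearMap.compRight R f.hom)
  map_id X := by ext : 1; rfl
  map_comp f g := by ext : 1; rfl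

variable {R H} in
/-- The natural transformation `[φ, -]` of `[H, [H, -]] ≅ [H ⊗ H, -]`. -/
def homEndoNat (φ : H ⊗[R] H →ₗ[R] H ⊗[R] H) :
    homFunctor R H ⋙ homFunctor R H ⟶ homFunctor R H ⋙ homFunctor R H where
  app X := ModuleCat.ofHom (homEndo X φ)
  naturality _ _ f := ModuleCat.hom_ext <| LinearMap.ext fun g ↦ LinearMap.ext₂ fun a b ↦
    lift_homPost f.hom g (φ (a ⊗ₜ b))

section HomLaws

variable (X : Type u) [AddCommGroup X] [Module R X]

lemma hom_assoc : homMul R H X ∘ₗ homPost (homMul R H X) =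
    homMul R H X ∘ₗ homMul R H (H →ₗ[R] X) := by
  refine LinearMap.ext fun g ↦ LinearMap.ext fun a ↦ ?_
  set K : H ⊗[R] (H ⊗[R] H) →ₗ[R] X :=
    TensorProduct.lift ((TensorProduct.lift.equiv (RingHom.id R) H H X).toLinearMap ∘ₗ g)
  have h1 : ∀ t : H ⊗[R] H, TensorProduct.lift (homPost (homMul R H X) g) t =
      K ((Coalgebra.comul (R := R)).lTensor H t) := by
    intro t
    induction t with
    | zero => simp
    | add p q hp hq => simp only [map_add, hp, hq]
    | tmul p q => rfl
  have h2 : ∀ t : H ⊗[R] H, TensorProduct.lift (homMul R H (H →ₗ[R] X) g) t =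
      K (TensorProduct.assoc R H H H ((Coalgebra.comul (R := R)).rTensor H t)) := by
    intro t
    induction t with
    | zero => simp
    | add p q hp hq => simp only [map_add, hp, hq]
    | tmul p q =>
      simp only [TensorProduct.lift.tmul, homMul_apply, LinearMap.rTensor_tmul]
      induction Coalgebra.comul (R := R) p with
      | zero => simp
      | add p q hp hq => simp only [TensorProduct.add_tmul, map_add, LinearMap.add_apply, hp, hq]
      | tmul p q => simp [K]
  rw [LinearMap.comp_apply, LinearMap.comp_apply, homMul_apply, homMul_apply, h1, h2,
    Coalgebra.coassoc_apply]

lemma hom_left_unit : homMul R H X ∘ₗ homUnit R H (H →ₗ[R] X) = LinearMap.id := by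
  refine LinearMap.ext fun f ↦ LinearMap.ext fun a ↦ ?_
  have h : ∀ t : H ⊗[R] H, TensorProduct.lift (homUnit R H (H →ₗ[R] X) f) t =
      f (TensorProduct.lid R H ((Coalgebra.counit (R := R)).rTensor H t)) := by
    intro t
    induction t with
    | zero => simp
    | add p q hp hq => simp only [map_add, hp, hq]
    | tmul p q => simp [homUnit_apply]
  rw [LinearMap.comp_apply, homMul_apply, h, Coalgebra.rTensor_counit_comul]
  simp

lemma hom_right_unit : homMul R H X ∘ₗ homPost (homUnit R H X) = LinearMap.id := by
  refine LinearMap.ext fun f ↦ LinearMap.ext fun a ↦ ?_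
  have h : ∀ t : H ⊗[R] H, TensorProduct.lift (homPost (homUnit R H X) f) t =
      f (TensorProduct.rid R H ((Coalgebra.counit (R := R)).lTensor H t)) := by
    intro t
    induction t with
    | zero => simp
    | add p q hp hq => simp only [map_add, hp, hq]
    | tmul p q => simp [homUnit_apply]
  rw [LinearMap.comp_apply, homMul_apply, h, Coalgebra.lTensor_counit_comul]
  simp

lemma hom_coassoc : homPost (homComul R H X) ∘ₗ homComul R H X =
    homComul R H (H →ₗ[R] X) ∘ₗ homComul R H X :=
  LinearMap.ext fun f ↦ LinearMap.ext fun a ↦ LinearMap.ext₂ fun b c ↦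
    congrArg f (mul_assoc a b c).symm

lemma hom_left_counit : homCounit R H (H →ₗ[R] X) ∘ₗ homComul R H X = LinearMap.id :=
  LinearMap.ext fun f ↦ LinearMap.ext fun a ↦ by simp [homCounit_apply, homComul_apply]

lemma hom_right_counit : homPost (homCounit R H X) ∘ₗ homComul R H X = LinearMap.id :=
  LinearMap.ext fun f ↦ LinearMap.ext fun a ↦ by simp [homCounit_apply, homComul_apply]

lemma hom_entw_mul : homTw R H X ∘ₗ homMul R H (H →ₗ[R] X) =
    (homPost (homMul R H X) ∘ₗ homTw R H (H →ₗ[R] X)) ∘ₗ homPost (homTw R H X) := by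
  refine LinearMap.ext fun g ↦ LinearMap.ext₂ fun a b ↦ ?_
  rw [LinearMap.comp_apply, homTw_apply, homMul_apply]
  simp only [LinearMap.comp_apply, LinearMap.compRight_apply, homMul_apply]
  induction Coalgebra.comul (R := R) b with
  | zero => simp
  | add p q hp hq => simp only [map_add, LinearMap.add_apply, hp, hq]
  | tmul p q => simp [homTw_apply]

lemma hom_entw_unit : homTw R H X ∘ₗ homUnit R H (H →ₗ[R] X) = homPost (homUnit R H X) :=
  LinearMap.ext fun g ↦ LinearMap.ext₂ fun a b ↦ by simp [homTw_apply, homUnit_apply]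

lemma hom_entw_comul : homComul R H (H →ₗ[R] X) ∘ₗ homTw R H X =
    (homPost (homTw R H X) ∘ₗ homTw R H (H →ₗ[R] X)) ∘ₗ homPost (homComul R H X) :=
  LinearMap.ext fun g ↦ LinearMap.ext fun a ↦ LinearMap.ext₂ fun b c ↦ by
    simp [homTw_apply, homComul_apply]

lemma hom_entw_counit : homCounit R H (H →ₗ[R] X) ∘ₗ homTw R H X = homPost (homCounit R H X) :=
  LinearMap.ext fun g ↦ LinearMap.ext fun a ↦ by simp [homTw_apply, homCounit_apply]

lemma hom_entw_mul' : homTw R H X ∘ₗ homPost (homMul R H X) =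
    (homMul R H (H →ₗ[R] X) ∘ₗ homPost (homTw R H X)) ∘ₗ homTw R H (H →ₗ[R] X) := by
  refine LinearMap.ext fun g ↦ LinearMap.ext₂ fun a b ↦ ?_
  rw [LinearMap.comp_apply, homTw_apply]
  simp only [LinearMap.comp_apply, LinearMap.compRight_apply, homMul_apply]
  induction Coalgebra.comul (R := R) a with
  | zero => simp
  | add p q hp hq => simp only [map_add, LinearMap.add_apply, hp, hq]
  | tmul p q => simp [homTw_apply]

lemma hom_entw_unit' : homTw R H X ∘ₗ homPost (homUnit R H X) = homUnit R H (H →ₗ[R] X) :=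
  LinearMap.ext fun g ↦ LinearMap.ext₂ fun a b ↦ by simp [homTw_apply, homUnit_apply]

lemma hom_entw_comul' : homPost (homComul R H X) ∘ₗ homTw R H X =
    (homTw R H (H →ₗ[R] X) ∘ₗ homPost (homTw R H X)) ∘ₗ homComul R H (H →ₗ[R] X) :=
  LinearMap.ext fun g ↦ LinearMap.ext fun a ↦ LinearMap.ext₂ fun b c ↦ by
    simp [homTw_apply, homComul_apply]

lemma hom_entw_counit' : homPost (homCounit R H X) ∘ₗ homTw R H X = homCounit R H (H →ₗ[R] X) :=
  LinearMap.ext fun g ↦ LinearMap.ext fun a ↦ by simp [homTw_apply, homCounit_apply]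

lemma hom_e_mul : homCounit R H X ∘ₗ homMul R H X =
    homCounit R H X ∘ₗ homCounit R H (H →ₗ[R] X) :=
  LinearMap.ext fun g ↦ by
    simp [homCounit_apply, homMul_apply, Algebra.TensorProduct.one_def]

lemma hom_e_unit : homCounit R H X ∘ₗ homUnit R H X = LinearMap.id :=
  LinearMap.ext fun x ↦ by simp [homCounit_apply, homUnit_apply]

lemma hom_unit_d : homComul R H X ∘ₗ homUnit R H X =
    homUnit R H (H →ₗ[R] X) ∘ₗ homUnit R H X :=
  LinearMap.ext fun x ↦ LinearMap.ext₂ fun a b ↦ by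
    simp [homComul_apply, homUnit_apply, mul_smul]

lemma hom_mul_d : homComul R H X ∘ₗ homMul R H X =
    (((homMul R H (H →ₗ[R] X) ∘ₗ homPost (homPost (homMul R H X))) ∘ₗ
      homPost (homTw R H (H →ₗ[R] X))) ∘ₗ homComul R H (H →ₗ[R] H →ₗ[R] X)) ∘ₗ homPost (homComul R H X) := by
  refine LinearMap.ext fun g ↦ LinearMap.ext₂ fun a b ↦ ?_
  rw [LinearMap.comp_apply, homComul_apply, homMul_apply, Bialgebra.comul_mul]
  rw [LinearMap.comp_apply, LinearMap.comp_apply, LinearMap.comp_apply, LinearMap.comp_apply,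
    homMul_apply]
  induction Coalgebra.comul (R := R) a with
  | zero => simp
  | add p q hp hq => simp only [map_add, LinearMap.add_apply, add_mul, hp, hq]
  | tmul p q =>
    simp only [TensorProduct.lift.tmul, LinearMap.comp_apply, LinearMap.compRight_apply,
      homMul_apply]
    induction Coalgebra.comul (R := R) b with
    | zero => simp
    | add p q hp hq => simp only [map_add, mul_add, hp, hq]
    | tmul r s => simp [homTw_apply, homComul_apply]

lemma hom_psi : homComul R H X ∘ₗ homMul R H X =
    (homPost (homMul R H X) ∘ₗ homEndo (H →ₗ[R] X) (psiL R H)) ∘ₗ homPost (homComul R H X) := by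
  refine LinearMap.ext fun g ↦ LinearMap.ext₂ fun a b ↦ ?_
  rw [LinearMap.comp_apply, homComul_apply, homMul_apply, Bialgebra.comul_mul]
  simp only [LinearMap.comp_apply, LinearMap.compRight_apply, homMul_apply]
  induction Coalgebra.comul (R := R) b with
  | zero => simp
  | add p q hp hq => simp only [map_add, mul_add, hp, hq]
  | tmul r s =>
    simp only [TensorProduct.lift.tmul, homEndo_apply, psiL, LinearMap.comp_apply,
      LinearMap.rTensor_tmul]
    induction Coalgebra.comul (R := R) a with
    | zero => simp
    | add p q hp hq =>
      simp only [map_add, LinearMap.add_apply, TensorProduct.add_tmul, add_mul, hp, hq]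
    | tmul p q => simp [homComul_apply]

variable {X}
variable {Y : Type u} [AddCommGroup Y] [Module R Y] (f : X →ₗ[R] Y)

lemma hom_unit_nat : homUnit R H Y ∘ₗ f = homPost f ∘ₗ homUnit R H X :=
  LinearMap.ext fun x ↦ LinearMap.ext fun a ↦ by simp [homUnit_apply]

lemma hom_mul_nat : homMul R H Y ∘ₗ homPost (homPost f) = homPost f ∘ₗ homMul R H X :=
  LinearMap.ext fun g ↦ LinearMap.ext fun a ↦ lift_homPost f g (Coalgebra.comul a)

lemma hom_counit_nat : homCounit R H Y ∘ₗ homPost f = f ∘ₗ homCounit R H X :=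
  LinearMap.ext fun g ↦ by simp [homCounit_apply]

lemma hom_comul_nat : homComul R H Y ∘ₗ homPost f =
    homPost (homPost f) ∘ₗ homComul R H X :=
  LinearMap.ext fun g ↦ LinearMap.ext₂ fun a b ↦ by simp [homComul_apply]

end HomLaws

/-- The bimonad `Hom_R(H, -)` on the category of `R`-modules, with the double entwining switching
the arguments of `Hom_R(H, Hom_R(H, -))`. -/
def homBimonad : TauBimonad (ModuleCat.{u} R) where
  toFunctor := homFunctor R H
  η := ⟨fun X ↦ ModuleCat.ofHom (homUnit R H X),
    fun _ _ f ↦ ModuleCat.hom_ext (hom_unit_nat R H f.hom)⟩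
  μ := ⟨fun X ↦ ModuleCat.ofHom (homMul R H X),
    fun _ _ f ↦ ModuleCat.hom_ext (hom_mul_nat R H f.hom)⟩
  assoc X := ModuleCat.hom_ext (hom_assoc R H X)
  left_unit X := ModuleCat.hom_ext (hom_left_unit R H X)
  right_unit X := ModuleCat.hom_ext (hom_right_unit R H X)
  e := ⟨fun X ↦ ModuleCat.ofHom (homCounit R H X),
    fun _ _ f ↦ ModuleCat.hom_ext (hom_counit_nat R H f.hom)⟩
  d := ⟨fun X ↦ ModuleCat.ofHom (homComul R H X),
    fun _ _ f ↦ ModuleCat.hom_ext (hom_comul_nat R H f.hom)⟩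
  coassoc X := ModuleCat.hom_ext (hom_coassoc R H X)
  left_counit X := ModuleCat.hom_ext (hom_left_counit R H X)
  right_counit X := ModuleCat.hom_ext (hom_right_counit R H X)
  τ := homEndoNat (TensorProduct.comm R H H).toLinearMap
  entw_mul X := ModuleCat.hom_ext (hom_entw_mul R H X)
  entw_unit X := ModuleCat.hom_ext (hom_entw_unit R H X)
  entw_comul X := ModuleCat.hom_ext (hom_entw_comul R H X)
  entw_counit X := ModuleCat.hom_ext (hom_entw_counit R H X)
  entw_mul' X := ModuleCat.hom_ext (hom_entw_mul' R H X)
  entw_unit' X := ModuleCat.hom_ext (hom_entw_unit' R H X)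
  entw_comul' X := ModuleCat.hom_ext (hom_entw_comul' R H X)
  entw_counit' X := ModuleCat.hom_ext (hom_entw_counit' R H X)
  e_mul X := ModuleCat.hom_ext (hom_e_mul R H X)
  e_unit X := ModuleCat.hom_ext (hom_e_unit R H X)
  unit_d X := ModuleCat.hom_ext (hom_unit_d R H X)
  mul_d X := ModuleCat.hom_ext (hom_mul_d R H X)

/-- The mixed distributive law `[ψ_l, -]`. -/
def homPsi : (homBimonad R H).toFunctor ⋙ (homBimonad R H).toFunctor ⟶
    (homBimonad R H).toFunctor ⋙ (homBimonad R H).toFunctor :=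
  homEndoNat (psiL R H)

/-- The category of `[H, -]`-Hopf modules (right Hopf contramodules): mixed bimodules for the
entwining `[ψ_l, -]`. Writing `m b` for `k m b`, where `k : M → [H, M]` is the comodule structure,
these are right `H`-modules `M` with a contramodule structure `α : [H, M] → M` such that
`α(f) b = α(f(b₁ -) b₂)`. -/
abbrev HopfContramoduleCat : Type (u + 1) :=
  MixedBimodule (homBimonad R H).toMonad (homBimonad R H).comonad (homPsi R H)

/-- The functor `Hom_R(H, -)` from `R`-modules to `[H, -]`-Hopf modules. -/
def homHopfFunctor : ModuleCat.{u} R ⥤ HopfContramoduleCat R H :=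
  (homBimonad R H).toMixed (homPsi R H) fun X ↦ ModuleCat.hom_ext (hom_psi R H X)

end Bialgebra

/-! ## Relative tensor products -/

/-- The relations `l i m ⊗ n = m ⊗ r i n` in `M ⊗[R] N`. -/
def balancedSubmodule {R : Type*} [CommRing R] {M N : Type*} [AddCommGroup M] [Module R M]
    [AddCommGroup N] [Module R N] {ι : Type*} (l : ι → M → M) (r : ι → N → N) :
    Submodule R (M ⊗[R] N) :=
  Submodule.span R {z | ∃ i m n, z = l i m ⊗ₜ[R] n - m ⊗ₜ[R] r i n}

/-- The tensor product `M ⊗_A N` of a right module `M` and a left module `N` over an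
`R`-algebra `A`. -/
def RelTensor (R A M N : Type*) [CommRing R] [Ring A] [Algebra R A]
    [AddCommGroup M] [Module R M] [Module Aᵐᵒᵖ M] [AddCommGroup N] [Module R N] [Module A N] :
    Type _ :=
  (M ⊗[R] N) ⧸ balancedSubmodule (R := R) (fun (a : A) (m : M) ↦ op a • m)
    (fun (a : A) (n : N) ↦ a • n)

namespace RelTensor

section Basic

variable (R A : Type*) [CommRing R] [Ring A] [Algebra R A]
variable {M M' N N' X : Type*}
variable [AddCommGroup M] [Module R M] [Module Aᵐᵒᵖ M]
variable [AddCommGroup M'] [Module R M'] [Module Aᵐᵒᵖ M']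
variable [AddCommGroup N] [Module R N] [Module A N]
variable [AddCommGroup N'] [Module R N'] [Module A N']
variable [AddCommGroup X] [Module R X]

instance : AddCommGroup (RelTensor R A M N) :=
  inferInstanceAs (AddCommGroup ((M ⊗[R] N) ⧸ balancedSubmodule (R := R)
    (fun (a : A) (m : M) ↦ op a • m) (fun (a : A) (n : N) ↦ a • n)))

instance : Module R (RelTensor R A M N) :=
  inferInstanceAs (Module R ((M ⊗[R] N) ⧸ balancedSubmodule (R := R)
    (fun (a : A) (m : M) ↦ op a • m) (fun (a : A) (n : N) ↦ a • n)))

/-- The canonical projection from the tensor product over `R`. -/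
def proj : M ⊗[R] N →ₗ[R] RelTensor R A M N := Submodule.mkQ _

/-- The element `m ⊗ n` of `M ⊗_A N`. -/
def mk : M →ₗ[R] N →ₗ[R] RelTensor R A M N := (TensorProduct.mk R M N).compr₂ (proj R A)

lemma mk_smul (a : A) (m : M) (n : N) : mk R A (op a • m) n = mk R A m (a • n) :=
  (Submodule.Quotient.eq _).2 (Submodule.subset_span ⟨a, m, n, rfl⟩)

variable {R A}

@[elab_as_elim]
lemma induction {p : RelTensor R A M N → Prop} (zero : p 0) (tmul : ∀ m n, p (mk R A m n))
    (add : ∀ x y, p x → p y → p (x + y)) (x : RelTensor R A M N) : p x := by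
  obtain ⟨z, rfl⟩ := Submodule.mkQ_surjective _ x
  change p (proj R A z)
  induction z with
  | zero => simpa using zero
  | tmul m n => exact tmul m n
  | add x y hx hy => rw [map_add]; exact add _ _ hx hy

/-- The universal property of `M ⊗_A N`. -/
def lift (f : M →ₗ[R] N →ₗ[R] X) (hf : ∀ (a : A) m n, f (op a • m) n = f m (a • n)) :
    RelTensor R A M N →ₗ[R] X :=
  Submodule.liftQ _ (TensorProduct.lift f) <| Submodule.span_le.2 <| by
    rintro _ ⟨a, m, n, rfl⟩
    simp [hf a m n]

@[simp]
lemma lift_mk (f : M →ₗ[R] N →ₗ[R] X) (hf : ∀ (a : A) m n, f (op a • m) n = f m (a • n))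
    (m : M) (n : N) : lift f hf (mk R A m n) = f m n := rfl

variable [IsScalarTower R Aᵐᵒᵖ M] [IsScalarTower R Aᵐᵒᵖ M']
variable [IsScalarTower R A N] [IsScalarTower R A N']

variable (R) in
/-- The map `f ⊗ g` for a right `A`-linear map `f` and a left `A`-linear map `g`. -/
def map (f : M →ₗ[Aᵐᵒᵖ] M') (g : N →ₗ[A] N') : RelTensor R A M N →ₗ[R] RelTensor R A M' N' :=
  lift ((mk R A).compl₁₂ (f.restrictScalars R) (g.restrictScalars R)) fun a m n ↦ by
    simpa using mk_smul R A a (f m) (g n)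

@[simp]
lemma map_mk (f : M →ₗ[Aᵐᵒᵖ] M') (g : N →ₗ[A] N') (m : M) (n : N) :
    map R f g (mk R A m n) = mk R A (f m) (g n) := rfl

end Basic

section Modules

/-- Left multiplication by `a` on a bimodule, as a right linear map. -/
def lmul {A M : Type*} [Ring A] [AddCommGroup M] [Module A M] [Module Aᵐᵒᵖ M]
    [SMulCommClass A Aᵐᵒᵖ M] (a : A) : M →ₗ[Aᵐᵒᵖ] M where
  toFun m := a • m
  map_add' := smul_add a
  map_smul' b m := smul_comm a b m

/-- Right multiplication by `a` on a bimodule, as a left linear map. -/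
def rmul {A M : Type*} [Ring A] [AddCommGroup M] [Module A M] [Module Aᵐᵒᵖ M]
    [SMulCommClass A Aᵐᵒᵖ M] (a : Aᵐᵒᵖ) : M →ₗ[A] M where
  toFun m := a • m
  map_add' := smul_add a
  map_smul' b m := (smul_comm b a m).symm

variable {R A : Type*} [CommRing R] [Ring A] [Algebra R A]
variable {M N P : Type*}
variable [AddCommGroup M] [Module R M] [Module Aᵐᵒᵖ M] [IsScalarTower R Aᵐᵒᵖ M]
variable [AddCommGroup N] [Module R N] [Module A N] [IsScalarTower R A N]
variable [AddCommGroup P] [Module R P] [Module A P] [IsScalarTower R A P]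

section Left

variable [Module A M] [SMulCommClass A Aᵐᵒᵖ M]

instance : SMul A (RelTensor R A M N) := ⟨fun a ↦ map R (lmul a) LinearMap.id⟩

@[simp]
lemma smul_mk (a : A) (m : M) (n : N) : a • mk R A m n = mk R A (a • m) n := rfl

lemma smul_add_aux (a : A) (x y : RelTensor R A M N) : a • (x + y) = a • x + a • y :=
  map_add (map R (lmul a) LinearMap.id) x y

lemma smul_zero_aux (a : A) : a • (0 : RelTensor R A M N) = 0 :=
  map_zero (map R (lmul a) LinearMap.id)

/-- If `M` is an `A`-bimodule, then `M ⊗_A N` is a left `A`-module by `a (m ⊗ n) = a m ⊗ n`. -/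
instance : Module A (RelTensor R A M N) where
  smul_add := smul_add_aux
  smul_zero := smul_zero_aux
  one_smul x := by
    induction x using induction with
    | zero => exact smul_zero_aux 1
    | tmul m n => rw [smul_mk, one_smul]
    | add x y hx hy => rw [smul_add_aux, hx, hy]
  mul_smul a b x := by
    induction x using induction with
    | zero => simp only [smul_zero_aux]
    | tmul m n => simp only [smul_mk, mul_smul]
    | add x y hx hy => simp only [smul_add_aux, hx, hy]
  add_smul a b x := by
    induction x using induction with
    | zero => simp only [smul_zero_aux, add_zero]
    | tmul m n => simp only [smul_mk, add_smul, map_add, LinearMap.add_apply]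
    | add x y hx hy => simp only [smul_add_aux, hx, hy, add_add_add_comm]
  zero_smul x := by
    induction x using induction with
    | zero => exact smul_zero_aux 0
    | tmul m n => simp only [smul_mk, zero_smul, map_zero, LinearMap.zero_apply]
    | add x y hx hy => simp only [smul_add_aux, hx, hy, add_zero]

instance [IsScalarTower R A M] : IsScalarTower R A (RelTensor R A M N) where
  smul_assoc r a x := by
    induction x using induction with
    | zero => simp
    | tmul m n => simp
    | add x y hx hy => simp only [smul_add, hx, hy]

end Left

section Right

variable [Module Aᵐᵒᵖ N] [SMulCommClass A Aᵐᵒᵖ N]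

instance : SMul Aᵐᵒᵖ (RelTensor R A M N) := ⟨fun a ↦ map R LinearMap.id (rmul a)⟩

@[simp]
lemma op_smul_mk (a : Aᵐᵒᵖ) (m : M) (n : N) : a • mk R A m n = mk R A m (a • n) := rfl

lemma op_smul_add_aux (a : Aᵐᵒᵖ) (x y : RelTensor R A M N) : a • (x + y) = a • x + a • y :=
  map_add (map R LinearMap.id (rmul a)) x y

lemma op_smul_zero_aux (a : Aᵐᵒᵖ) : a • (0 : RelTensor R A M N) = 0 :=
  map_zero (map R LinearMap.id (rmul a))

/-- If `N` is an `A`-bimodule, then `M ⊗_A N` is a right `A`-module by `(m ⊗ n) a = m ⊗ n a`. -/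
instance : Module Aᵐᵒᵖ (RelTensor R A M N) where
  smul_add := op_smul_add_aux
  smul_zero := op_smul_zero_aux
  one_smul x := by
    induction x using induction with
    | zero => exact op_smul_zero_aux 1
    | tmul m n => rw [op_smul_mk, one_smul]
    | add x y hx hy => rw [op_smul_add_aux, hx, hy]
  mul_smul a b x := by
    induction x using induction with
    | zero => simp only [op_smul_zero_aux]
    | tmul m n => simp only [op_smul_mk, mul_smul]
    | add x y hx hy => simp only [op_smul_add_aux, hx, hy]
  add_smul a b x := by
    induction x using induction with
    | zero => simp only [op_smul_zero_aux, add_zero]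
    | tmul m n => simp only [op_smul_mk, add_smul, map_add]
    | add x y hx hy => simp only [op_smul_add_aux, hx, hy, add_add_add_comm]
  zero_smul x := by
    induction x using induction with
    | zero => exact op_smul_zero_aux 0
    | tmul m n => simp only [op_smul_mk, zero_smul, map_zero]
    | add x y hx hy => simp only [op_smul_add_aux, hx, hy, add_zero]

instance [IsScalarTower R Aᵐᵒᵖ N] : IsScalarTower R Aᵐᵒᵖ (RelTensor R A M N) where
  smul_assoc r a x := by
    induction x using induction with
    | zero => simp
    | tmul m n => simp
    | add x y hx hy => simp only [smul_add, hx, hy]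

instance [Module A M] [SMulCommClass A Aᵐᵒᵖ M] : SMulCommClass A Aᵐᵒᵖ (RelTensor R A M N) where
  smul_comm a b x := by
    induction x using induction with
    | zero => simp
    | tmul m n => simp
    | add x y hx hy => simp only [smul_add, hx, hy]

variable (R A M N P) in
/-- The associativity map `(M ⊗_A N) ⊗_A P → M ⊗_A (N ⊗_A P)`, `(m ⊗ n) ⊗ p ↦ m ⊗ (n ⊗ p)`. -/
def assoc [IsScalarTower R Aᵐᵒᵖ N] :
    RelTensor R A (RelTensor R A M N) P →ₗ[R] RelTensor R A M (RelTensor R A N P) :=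
  lift (lift
    { toFun := fun m ↦ (mk R A : N →ₗ[R] P →ₗ[R] _).compr₂ (mk R A m)
      map_add' := fun m m' ↦ by ext; simp
      map_smul' := fun r m ↦ by ext; simp }
    fun a m n ↦ by
      ext p
      exact mk_smul R A a m (mk R A n p))
    fun a x p ↦ by
      induction x using induction with
      | zero => simp
      | tmul m n => exact congrArg (mk R A m) (mk_smul R A a n p)
      | add x y hx hy => simp only [smul_add, map_add, LinearMap.add_apply, hx, hy]

@[simp]
lemma assoc_mk [IsScalarTower R Aᵐᵒᵖ N] (m : M) (n : N) (p : P) :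
    assoc R A M N P (mk R A (mk R A m n) p) = mk R A m (mk R A n p) := rfl

end Right

end Modules

end RelTensor

namespace RelTensor

variable {R A : Type*} [CommRing R] [Ring A] [Algebra R A]
variable {M M' N N' X : Type*}
variable [AddCommGroup M] [Module R M] [Module Aᵐᵒᵖ M] [IsScalarTower R Aᵐᵒᵖ M]
variable [AddCommGroup M'] [Module R M'] [Module Aᵐᵒᵖ M'] [IsScalarTower R Aᵐᵒᵖ M']
variable [AddCommGroup N] [Module R N] [Module A N] [IsScalarTower R A N]
variable [AddCommGroup N'] [Module R N'] [Module A N'] [IsScalarTower R A N']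

variable (R A N) in
/-- The canonical map `A ⊗_A N → N`. -/
def lid : RelTensor R A A N →ₗ[R] N :=
  lift (Algebra.lsmul R R N).toLinearMap fun a b n ↦ by simp

@[simp]
lemma lid_mk (a : A) (n : N) : lid R A N (mk R A a n) = a • n := rfl

variable (R A M) in
/-- The canonical map `M ⊗_A A → M`. -/
def rid : RelTensor R A M A →ₗ[R] M :=
  lift ((Algebra.lsmul R R M).toLinearMap ∘ₗ (opLinearEquiv R : A ≃ₗ[R] Aᵐᵒᵖ).toLinearMap).flip
    fun a m b ↦ by simp

@[simp]
lemma rid_mk (m : M) (a : A) : rid R A M (mk R A m a) = op a • m := rfl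

lemma map_add_left (f f' : M →ₗ[Aᵐᵒᵖ] M') (g : N →ₗ[A] N') (x : RelTensor R A M N) :
    map R (f + f') g x = map R f g x + map R f' g x := by
  induction x using induction with
  | zero => simp
  | tmul m n => simp
  | add x y hx hy => simp only [map_add, hx, hy, add_add_add_comm]

lemma map_smul_left (r : R) (f : M →ₗ[Aᵐᵒᵖ] M') (g : N →ₗ[A] N') (x : RelTensor R A M N) :
    map R (r • f) g x = r • map R f g x := by
  induction x using induction with
  | zero => simp
  | tmul m n => simp
  | add x y hx hy => simp only [map_add, hx, hy, smul_add]

lemma map_add_right (f : M →ₗ[Aᵐᵒᵖ] M') (g g' : N →ₗ[A] N') (x : RelTensor R A M N) :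
    map R f (g + g') x = map R f g x + map R f g' x := by
  induction x using induction with
  | zero => simp
  | tmul m n => simp
  | add x y hx hy => simp only [map_add, hx, hy, add_add_add_comm]

lemma map_smul_right (r : R) (f : M →ₗ[Aᵐᵒᵖ] M') (g : N →ₗ[A] N') (x : RelTensor R A M N) :
    map R f (r • g) x = r • map R f g x := by
  induction x using induction with
  | zero => simp
  | tmul m n => simp
  | add x y hx hy => simp only [map_add, hx, hy, smul_add]

lemma map_map {M'' N'' : Type*} [AddCommGroup M''] [Module R M''] [Module Aᵐᵒᵖ M'']
    [IsScalarTower R Aᵐᵒᵖ M''] [AddCommGroup N''] [Module R N''] [Module A N'']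
    [IsScalarTower R A N''] (f : M →ₗ[Aᵐᵒᵖ] M') (g : N →ₗ[A] N') (f' : M' →ₗ[Aᵐᵒᵖ] M'')
    (g' : N' →ₗ[A] N'') (x : RelTensor R A M N) :
    map R f' g' (map R f g x) = map R (f' ∘ₗ f) (g' ∘ₗ g) x := by
  induction x using induction with
  | zero => simp
  | tmul m n => simp
  | add x y hx hy => simp only [map_add, hx, hy]

end RelTensor

/-! ## Corings, comodules and Galois comodules -/

/-- An `A`-coring structure on an `A`-bimodule `C`. The coproduct and the counit are `A`-bilinear:
each is recorded both as a left and as a right `A`-linear map, with the same values. -/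
class Coring (R A C : Type*) [CommRing R] [Ring A] [Algebra R A] [AddCommGroup C] [Module R C]
    [Module A C] [Module Aᵐᵒᵖ C] [SMulCommClass A Aᵐᵒᵖ C] [IsScalarTower R A C]
    [IsScalarTower R Aᵐᵒᵖ C] where
  comul : C →ₗ[A] RelTensor R A C C
  comulR : C →ₗ[Aᵐᵒᵖ] RelTensor R A C C
  comulR_apply : ∀ c, comulR c = comul c
  counit : C →ₗ[A] A
  counitR : C →ₗ[Aᵐᵒᵖ] A
  counitR_apply : ∀ c, counitR c = counit c
  coassoc : ∀ c, RelTensor.assoc R A C C C (RelTensor.map R comulR LinearMap.id (comul c)) =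
    RelTensor.map R LinearMap.id comul (comul c)
  counit_comul : ∀ c, RelTensor.lid R A C (RelTensor.map R counitR LinearMap.id (comul c)) = c
  comul_counit : ∀ c, RelTensor.rid R A C (RelTensor.map R LinearMap.id counit (comul c)) = c

section Comodules

variable (R A C : Type*) [CommRing R] [Ring A] [Algebra R A] [AddCommGroup C] [Module R C]
  [Module A C] [Module Aᵐᵒᵖ C] [SMulCommClass A Aᵐᵒᵖ C] [IsScalarTower R A C]
  [IsScalarTower R Aᵐᵒᵖ C] [Coring R A C]

/-- A left `C`-comodule structure on a left `A`-module `N`. -/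
structure LeftComodule (N : Type*) [AddCommGroup N] [Module R N] [Module A N]
    [IsScalarTower R A N] where
  coact : N →ₗ[A] RelTensor R A C N
  coassoc : ∀ n, RelTensor.assoc R A C C N
      (RelTensor.map R (Coring.comulR (R := R) (A := A) (C := C)) LinearMap.id (coact n)) =
    RelTensor.map R LinearMap.id coact (coact n)
  counit : ∀ n, RelTensor.lid R A N
    (RelTensor.map R (Coring.counitR R (A := A) (C := C)) LinearMap.id (coact n)) = n

/-- A right `C`-comodule structure on a right `A`-module `N`. -/
structure RightComodule (N : Type*) [AddCommGroup N] [Module R N] [Module Aᵐᵒᵖ N]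
    [IsScalarTower R Aᵐᵒᵖ N] where
  coact : N →ₗ[Aᵐᵒᵖ] RelTensor R A N C
  coassoc : ∀ n, RelTensor.assoc R A N C C (RelTensor.map R coact LinearMap.id (coact n)) =
    RelTensor.map R LinearMap.id (Coring.comul (R := R) (A := A) (C := C)) (coact n)
  counit : ∀ n, RelTensor.rid R A N
    (RelTensor.map R LinearMap.id (Coring.counit R (A := A) (C := C)) (coact n)) = n

end Comodules

namespace LeftComodule

variable {R A C N : Type u} [CommRing R] [Ring A] [Algebra R A] [AddCommGroup C] [Module R C]
  [Module A C] [Module Aᵐᵒᵖ C] [SMulCommClass A Aᵐᵒᵖ C] [IsScalarTower R A C]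
  [IsScalarTower R Aᵐᵒᵖ C] [Coring R A C] [AddCommGroup N] [Module R N] [Module A N]
  [IsScalarTower R A N] (ρ : LeftComodule R A C N)

/-- The endomorphisms `T = End^C(N)` of a left comodule. -/
def endos : Set (N →ₗ[A] N) :=
  {t | ∀ n, ρ.coact (t n) = RelTensor.map R LinearMap.id t (ρ.coact n)}

section Galois

variable (X : Type u) [AddCommGroup X] [Module R X] [Module A X] [IsScalarTower R A X]

/-- The tensor product `N ⊗_T Hom_A(N, X)` over `T = End^C(N)`. -/
abbrev homTensor : Type u :=
  (N ⊗[R] (N →ₗ[A] X)) ⧸ balancedSubmodule (R := R) (fun (t : ρ.endos) (n : N) ↦ t.1 n)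
    (fun (t : ρ.endos) (f : N →ₗ[A] X) ↦ f ∘ₗ t.1)

/-- The canonical map `N ⊗_T Hom_A(N, X) → C ⊗_A X`, `n ⊗ f ↦ (I ⊗ f)(ρ(n))`. -/
def can : ρ.homTensor X →ₗ[R] RelTensor R A C X :=
  Submodule.liftQ _ (TensorProduct.lift (LinearMap.mk₂ R
      (fun n f ↦ RelTensor.map R LinearMap.id f (ρ.coact n))
      (fun n n' f ↦ by simp) (fun r n f ↦ by simp [LinearMap.map_smul_of_tower])
      (fun n f f' ↦ RelTensor.map_add_right _ _ _ _)
      (fun r n f ↦ RelTensor.map_smul_right _ _ _ _))) <| Submodule.span_le.2 <| by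
    rintro _ ⟨t, n, f, rfl⟩
    simp [t.2 n, RelTensor.map_map]

end Galois

/-- `N` is a `C`-Galois left comodule: `N ⊗_T Hom_A(N, -) → C ⊗_A -` is an isomorphism of functors
on left `A`-modules. -/
def IsGalois : Prop :=
  ∀ (X : Type u) [AddCommGroup X] [Module R X] [Module A X] [IsScalarTower R A X],
    Function.Bijective (ρ.can X)

section HomGalois

variable (Q : Type u) [AddCommGroup Q] [Module R Q] [Module Aᵐᵒᵖ Q] [IsScalarTower R Aᵐᵒᵖ Q]

/-- `Hom_T(N, Q ⊗_A N)` for `T = End^C(N)`. -/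
def tensorHom : Submodule R (N →ₗ[R] RelTensor R A Q N) where
  carrier := {φ | ∀ t ∈ ρ.endos, ∀ n, φ (t n) = RelTensor.map R LinearMap.id t (φ n)}
  add_mem' h h' t ht n := by simp [h t ht n, h' t ht n]
  zero_mem' t _ n := by simp
  smul_mem' r φ h t ht n := by simp [h t ht n]

/-- The canonical map `Hom_A(C, Q) → Hom_T(N, Q ⊗_A N)`, `f ↦ (f ⊗ I) ∘ ρ`. -/
def homCan : (C →ₗ[Aᵐᵒᵖ] Q) →ₗ[R] ρ.tensorHom Q where
  toFun f := ⟨RelTensor.map R f LinearMap.id ∘ₗ ρ.coact.restrictScalars R, fun t ht n ↦ by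
    simp [ht n, RelTensor.map_map]⟩
  map_add' f f' := by
    ext n
    exact RelTensor.map_add_left _ _ _ _
  map_smul' r f := by
    ext n
    exact RelTensor.map_smul_left _ _ _ _

end HomGalois

/-- `N` is a `Hom_{-,A}(C, -)`-Galois left comodule: `Hom_A(C, -) → Hom_T(N, - ⊗_A N)` is an
isomorphism of functors on right `A`-modules. -/
def IsHomGalois : Prop :=
  ∀ (Q : Type u) [AddCommGroup Q] [Module R Q] [Module Aᵐᵒᵖ Q] [IsScalarTower R Aᵐᵒᵖ Q],
    Function.Bijective (ρ.homCan Q)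

end LeftComodule

namespace RightComodule

variable {R A C N : Type u} [CommRing R] [Ring A] [Algebra R A] [AddCommGroup C] [Module R C]
  [Module A C] [Module Aᵐᵒᵖ C] [SMulCommClass A Aᵐᵒᵖ C] [IsScalarTower R A C]
  [IsScalarTower R Aᵐᵒᵖ C] [Coring R A C] [AddCommGroup N] [Module R N] [Module Aᵐᵒᵖ N]
  [IsScalarTower R Aᵐᵒᵖ N] (ρ : RightComodule R A C N)

/-- The endomorphisms `T = End^C(N)` of a right comodule. -/
def endos : Set (N →ₗ[Aᵐᵒᵖ] N) :=
  {t | ∀ n, ρ.coact (t n) = RelTensor.map R t LinearMap.id (ρ.coact n)}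

section Galois

variable (X : Type u) [AddCommGroup X] [Module R X] [Module Aᵐᵒᵖ X] [IsScalarTower R Aᵐᵒᵖ X]

/-- The tensor product `Hom_A(N, X) ⊗_T N` over `T = End^C(N)`. -/
abbrev homTensor : Type u :=
  ((N →ₗ[Aᵐᵒᵖ] X) ⊗[R] N) ⧸ balancedSubmodule (R := R)
    (fun (t : ρ.endos) (f : N →ₗ[Aᵐᵒᵖ] X) ↦ f ∘ₗ t.1) (fun (t : ρ.endos) (n : N) ↦ t.1 n)

/-- The canonical map `Hom_A(N, X) ⊗_T N → X ⊗_A C`, `f ⊗ n ↦ (f ⊗ I)(ρ(n))`. -/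
def can : ρ.homTensor X →ₗ[R] RelTensor R A X C :=
  Submodule.liftQ _ (TensorProduct.lift (LinearMap.mk₂ R
      (fun f n ↦ RelTensor.map R f LinearMap.id (ρ.coact n))
      (fun f f' n ↦ RelTensor.map_add_left _ _ _ _)
      (fun r f n ↦ RelTensor.map_smul_left _ _ _ _)
      (fun f n n' ↦ by simp) (fun r f n ↦ by simp [LinearMap.map_smul_of_tower]))) <|
    Submodule.span_le.2 <| by
      rintro _ ⟨t, f, n, rfl⟩
      simp [t.2 n, RelTensor.map_map]

end Galois

/-- `N` is a `C`-Galois right comodule: `Hom_A(N, -) ⊗_T N → - ⊗_A C` is an isomorphism of functors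
on right `A`-modules. -/
def IsGalois : Prop :=
  ∀ (X : Type u) [AddCommGroup X] [Module R X] [Module Aᵐᵒᵖ X] [IsScalarTower R Aᵐᵒᵖ X],
    Function.Bijective (ρ.can X)

section HomGalois

variable (Q : Type u) [AddCommGroup Q] [Module R Q] [Module A Q] [IsScalarTower R A Q]

/-- `Hom_T(N, N ⊗_A Q)` for `T = End^C(N)`. -/
def tensorHom : Submodule R (N →ₗ[R] RelTensor R A N Q) where
  carrier := {φ | ∀ t ∈ ρ.endos, ∀ n, φ (t n) = RelTensor.map R t LinearMap.id (φ n)}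
  add_mem' h h' t ht n := by simp [h t ht n, h' t ht n]
  zero_mem' t _ n := by simp
  smul_mem' r φ h t ht n := by simp [h t ht n]

/-- The canonical map `Hom_A(C, Q) → Hom_T(N, N ⊗_A Q)`, `f ↦ (I ⊗ f) ∘ ρ`. -/
def homCan : (C →ₗ[A] Q) →ₗ[R] ρ.tensorHom Q where
  toFun f := ⟨RelTensor.map R LinearMap.id f ∘ₗ ρ.coact.restrictScalars R, fun t ht n ↦ by
    simp [ht n, RelTensor.map_map]⟩
  map_add' f f' := by
    ext n
    exact RelTensor.map_add_right _ _ _ _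
  map_smul' r f := by
    ext n
    exact RelTensor.map_smul_right _ _ _ _

end HomGalois

/-- `N` is a `Hom_{A,-}(C, -)`-Galois right comodule: `Hom_A(C, -) → Hom_T(N, N ⊗_A -)` is an
isomorphism of functors on left `A`-modules. -/
def IsHomGalois : Prop :=
  ∀ (Q : Type u) [AddCommGroup Q] [Module R Q] [Module A Q] [IsScalarTower R A Q],
    Function.Bijective (ρ.homCan Q)

end RightComodule

/-! ## Grouplike elements -/

section Grouplike

variable {R A C : Type*} [CommRing R] [Ring A] [Algebra R A] [AddCommGroup C] [Module R C]
  [Module A C] [Module Aᵐᵒᵖ C] [SMulCommClass A Aᵐᵒᵖ C] [IsScalarTower R A C]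
  [IsScalarTower R Aᵐᵒᵖ C] [Coring R A C]

/-- Grouplike elements of a coring. -/
structure Coring.IsGrouplike (R A : Type*) {C : Type*} [CommRing R] [Ring A] [Algebra R A]
    [AddCommGroup C] [Module R C] [Module A C] [Module Aᵐᵒᵖ C] [SMulCommClass A Aᵐᵒᵖ C]
    [IsScalarTower R A C] [IsScalarTower R Aᵐᵒᵖ C] [Coring R A C] (g : C) : Prop where
  comul : Coring.comul (R := R) (A := A) g = RelTensor.mk R A g g
  counit : Coring.counit R (A := A) g = 1

/-- The left linear map `a ↦ a g ⊗ 1`. -/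
def LeftComodule.grouplikeCoact (g : C) : A →ₗ[A] RelTensor R A C A where
  toFun a := RelTensor.mk R A (a • g) 1
  map_add' a b := by simp only [add_smul, map_add, LinearMap.add_apply]
  map_smul' a b := by simp only [smul_eq_mul, mul_smul, RelTensor.smul_mk, RingHom.id_apply]

lemma LeftComodule.grouplikeCoact_apply (g : C) (a : A) :
    LeftComodule.grouplikeCoact (R := R) g a = RelTensor.mk R A (a • g) 1 := rfl

/-- The right linear map `a ↦ 1 ⊗ g a`. -/
def RightComodule.grouplikeCoact (g : C) : A →ₗ[Aᵐᵒᵖ] RelTensor R A A C where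
  toFun a := RelTensor.mk R A 1 (op a • g)
  map_add' a b := by rw [MulOpposite.op_add, add_smul, map_add]
  map_smul' a b := by
    simp only [MulOpposite.smul_eq_mul_unop, op_mul, mul_smul, RelTensor.op_smul_mk,
      RingHom.id_apply, op_unop]

lemma RightComodule.grouplikeCoact_apply (g : C) (a : A) :
    RightComodule.grouplikeCoact (R := R) g a = RelTensor.mk R A 1 (op a • g) := rfl

/-- The left `C`-comodule `A` with coaction `a ↦ a g ⊗ 1` for a grouplike element `g`. -/
def LeftComodule.ofGrouplike {g : C} (hg : Coring.IsGrouplike R A g) : LeftComodule R A C A where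
  coact := LeftComodule.grouplikeCoact g
  coassoc a := by
    simp [LeftComodule.grouplikeCoact_apply, Coring.comulR_apply, hg.comul]
  counit a := by
    simp [LeftComodule.grouplikeCoact_apply, Coring.counitR_apply, hg.counit]

/-- The right `C`-comodule `A` with coaction `a ↦ 1 ⊗ g a` for a grouplike element `g`. -/
def RightComodule.ofGrouplike {g : C} (hg : Coring.IsGrouplike R A g) :
    RightComodule R A C A where
  coact := RightComodule.grouplikeCoact g
  coassoc a := by
    have h : Coring.comul (R := R) (A := A) (op a • g) = op a • RelTensor.mk R A g g := by
      rw [← Coring.comulR_apply, map_smul, Coring.comulR_apply, hg.comul]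
    simp [RightComodule.grouplikeCoact_apply, h]
  counit a := by
    have h : Coring.counit R (A := A) (op a • g) = op a • 1 := by
      rw [← Coring.counitR_apply, map_smul, Coring.counitR_apply, hg.counit]
    simp [RightComodule.grouplikeCoact_apply, h]

end Grouplike

/-! ## The corings `H ⊗ʳ H` and `H ⊗ˡ H` -/

/-- The `R`-algebra `B` viewed as an `A`-bimodule with `a x b = f(a) x g(b)`, for algebra maps
`f, g : A → B`. -/
def AlgBimodule {R A B : Type*} [CommRing R] [Ring A] [Algebra R A] [Ring B] [Algebra R B]
    (_f _g : A →ₐ[R] B) : Type _ := B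

namespace AlgBimodule

variable {R A B : Type*} [CommRing R] [Ring A] [Algebra R A] [Ring B] [Algebra R B]
  (f g : A →ₐ[R] B)

instance : AddCommGroup (AlgBimodule f g) := inferInstanceAs (AddCommGroup B)

instance : Module R (AlgBimodule f g) := inferInstanceAs (Module R B)

/-- The identity map from `B` to the bimodule. -/
def of : B ≃ₗ[R] AlgBimodule f g := LinearEquiv.refl R B

instance : SMul A (AlgBimodule f g) := ⟨fun a x ↦ of f g (f a * (of f g).symm x)⟩

instance : SMul Aᵐᵒᵖ (AlgBimodule f g) := ⟨fun a x ↦ of f g ((of f g).symm x * g (unop a))⟩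

variable {f g}

lemma smul_of (a : A) (x : B) : a • of f g x = of f g (f a * x) := rfl

lemma op_smul_of (a : Aᵐᵒᵖ) (x : B) : a • of f g x = of f g (x * g (unop a)) := rfl

instance : Module A (AlgBimodule f g) where
  one_smul x := by obtain ⟨x, rfl⟩ := (of f g).surjective x; simp [smul_of]
  mul_smul a b x := by obtain ⟨x, rfl⟩ := (of f g).surjective x; simp [smul_of, mul_assoc]
  smul_zero a := by rw [← map_zero (of f g), smul_of, mul_zero]
  smul_add a x y := by
    obtain ⟨x, rfl⟩ := (of f g).surjective x
    obtain ⟨y, rfl⟩ := (of f g).surjective y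
    rw [← map_add, smul_of, smul_of, smul_of, mul_add, map_add]
  add_smul a b x := by
    obtain ⟨x, rfl⟩ := (of f g).surjective x
    rw [smul_of, smul_of, smul_of, map_add, add_mul, map_add]
  zero_smul x := by obtain ⟨x, rfl⟩ := (of f g).surjective x; simp [smul_of]

instance : Module Aᵐᵒᵖ (AlgBimodule f g) where
  one_smul x := by obtain ⟨x, rfl⟩ := (of f g).surjective x; simp [op_smul_of]
  mul_smul a b x := by obtain ⟨x, rfl⟩ := (of f g).surjective x; simp [op_smul_of, mul_assoc]
  smul_zero a := by rw [← map_zero (of f g), op_smul_of, zero_mul]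
  smul_add a x y := by
    obtain ⟨x, rfl⟩ := (of f g).surjective x
    obtain ⟨y, rfl⟩ := (of f g).surjective y
    rw [← map_add, op_smul_of, op_smul_of, op_smul_of, add_mul, map_add]
  add_smul a b x := by
    obtain ⟨x, rfl⟩ := (of f g).surjective x
    rw [op_smul_of, op_smul_of, op_smul_of, MulOpposite.unop_add, map_add, mul_add, map_add]
  zero_smul x := by obtain ⟨x, rfl⟩ := (of f g).surjective x; simp [op_smul_of]

instance : SMulCommClass A Aᵐᵒᵖ (AlgBimodule f g) where
  smul_comm a b x := by
    obtain ⟨x, rfl⟩ := (of f g).surjective x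
    simp [smul_of, op_smul_of, mul_assoc]

instance : IsScalarTower R A (AlgBimodule f g) where
  smul_assoc r a x := by
    obtain ⟨x, rfl⟩ := (of f g).surjective x
    simp [smul_of]

instance : IsScalarTower R Aᵐᵒᵖ (AlgBimodule f g) where
  smul_assoc r a x := by
    obtain ⟨x, rfl⟩ := (of f g).surjective x
    simp [op_smul_of]

end AlgBimodule

section HopfCorings

variable (R H : Type u) [CommRing R] [Ring H] [Bialgebra R H]

/-- The bimodule `H ⊗ʳ H`: `H ⊗ H` with `d (a ⊗ b) c = d a c₁ ⊗ b c₂`. -/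
abbrev HopfR : Type u :=
  AlgBimodule (Algebra.TensorProduct.includeLeft : H →ₐ[R] H ⊗[R] H) (Bialgebra.comulAlgHom R H)

/-- The bimodule `H ⊗ˡ H`: `H ⊗ H` with `d (a ⊗ b) c = d₁ a ⊗ d₂ b c`. -/
abbrev HopfL : Type u :=
  AlgBimodule (Bialgebra.comulAlgHom R H) (Algebra.TensorProduct.includeRight : H →ₐ[R] H ⊗[R] H)

namespace HopfR

variable {R H} in
/-- `a ⊗ b` as an element of `H ⊗ʳ H`. -/
abbrev tmul (a b : H) : HopfR R H := AlgBimodule.of _ _ (a ⊗ₜ b)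

/-- The map `(x, q) ↦ x ⊗_H (1 ⊗ q)`. -/
def place : (H ⊗[R] H) ⊗[R] H →ₗ[R] RelTensor R H (HopfR R H) (HopfR R H) :=
  RelTensor.proj R H ∘ₗ TensorProduct.map (AlgBimodule.of _ _).toLinearMap
    ((AlgBimodule.of _ _).toLinearMap ∘ₗ TensorProduct.mk R H H 1)

/-- The coproduct `a ⊗ b ↦ (a ⊗ b₁) ⊗_H (1 ⊗ b₂)`. -/
def comulAux : H ⊗[R] H →ₗ[R] RelTensor R H (HopfR R H) (HopfR R H) :=
  place R H ∘ₗ (TensorProduct.assoc R H H H).symm.toLinearMap ∘ₗ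
    (Coalgebra.comul (R := R) (A := H)).lTensor H

/-- The counit `a ⊗ b ↦ a ε(b)`. -/
def counitAux : H ⊗[R] H →ₗ[R] H :=
  (TensorProduct.rid R H).toLinearMap ∘ₗ (Coalgebra.counit (R := R) (A := H)).lTensor H

lemma place_tmul (x : H ⊗[R] H) (q : H) : place R H (x ⊗ₜ q) =
    RelTensor.mk R H (AlgBimodule.of _ _ x : HopfR R H) (tmul 1 q) := rfl

lemma comulAux_tmul (a b : H) : comulAux R H (a ⊗ₜ b) =
    place R H ((TensorProduct.assoc R H H H).symm (a ⊗ₜ Coalgebra.comul (R := R) b)) := rfl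

lemma comulAux_left (d : H) (x : H ⊗[R] H) :
    comulAux R H ((d ⊗ₜ 1) * x) = d • comulAux R H x := by
  induction x with
  | zero => simp
  | add x y hx hy => simp only [mul_add, map_add, smul_add, hx, hy]
  | tmul a b =>
    rw [Algebra.TensorProduct.tmul_mul_tmul, one_mul, comulAux_tmul, comulAux_tmul]
    induction Coalgebra.comul (R := R) b with
    | zero => simp
    | add x y hx hy => simp only [TensorProduct.tmul_add, map_add, smul_add, hx, hy]
    | tmul p q =>
      simp only [TensorProduct.assoc_symm_tmul, place_tmul, RelTensor.smul_mk,
        AlgBimodule.smul_of, Algebra.TensorProduct.includeLeft_apply,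
        Algebra.TensorProduct.tmul_mul_tmul, one_mul]

lemma place_mul (p : H ⊗[R] H) (s : H) (z : H ⊗[R] H) :
    place R H ((p ⊗ₜ s) * (Coalgebra.comul (R := R) (A := H)).rTensor H z) =
      RelTensor.mk R H (AlgBimodule.of _ _ p : HopfR R H)
        (AlgBimodule.of _ _ ((1 ⊗ₜ s) * z) : HopfR R H) := by
  induction z with
  | zero => simp
  | add x y hx hy => simp only [mul_add, map_add, hx, hy]
  | tmul u v =>
    rw [LinearMap.rTensor_tmul, Algebra.TensorProduct.tmul_mul_tmul, place_tmul,
      Algebra.TensorProduct.tmul_mul_tmul, one_mul]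
    have h : (AlgBimodule.of _ _ (p * Coalgebra.comul (R := R) u) : HopfR R H) =
      op u • (AlgBimodule.of _ _ p : HopfR R H) := rfl
    rw [h, RelTensor.mk_smul, AlgBimodule.smul_of, Algebra.TensorProduct.includeLeft_apply,
      Algebra.TensorProduct.tmul_mul_tmul, mul_one, one_mul]

lemma comulAux_right (c : H) (x : H ⊗[R] H) :
    comulAux R H (x * Coalgebra.comul c) = op c • comulAux R H x := by
  induction x with
  | zero => simp
  | add x y hx hy => simp only [add_mul, map_add, smul_add, hx, hy]
  | tmul a b =>
    have h1 : ∀ z : H ⊗[R] H, comulAux R H ((a ⊗ₜ b) * z) =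
        place R H ((TensorProduct.assoc R H H H).symm (a ⊗ₜ Coalgebra.comul (R := R) b) *
          (TensorProduct.assoc R H H H).symm ((Coalgebra.comul (R := R)).lTensor H z)) := by
      intro z
      induction z with
      | zero => simp
      | add x y hx hy => simp only [mul_add, map_add, hx, hy]
      | tmul u v =>
        rw [Algebra.TensorProduct.tmul_mul_tmul, comulAux_tmul, Bialgebra.comul_mul,
          LinearMap.lTensor_tmul]
        congr 1
        induction Coalgebra.comul (R := R) b with
        | zero => simp
        | add x y hx hy => simp only [TensorProduct.tmul_add, map_add, add_mul, hx, hy]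
        | tmul p q =>
          induction Coalgebra.comul (R := R) v with
          | zero => simp
          | add x y hx hy => simp only [TensorProduct.tmul_add, map_add, mul_add, hx, hy]
          | tmul p q => simp
    rw [h1, Coalgebra.coassoc_symm_apply, comulAux_tmul]
    induction Coalgebra.comul (R := R) b with
    | zero => simp
    | add x y hx hy => simp only [TensorProduct.tmul_add, map_add, add_mul, smul_add, hx, hy]
    | tmul p q =>
      rw [TensorProduct.assoc_symm_tmul, place_mul, place_tmul, RelTensor.op_smul_mk,
        AlgBimodule.op_smul_of]
      rfl

lemma counitAux_tmul (a b : H) : counitAux R H (a ⊗ₜ b) = Coalgebra.counit (R := R) b • a := by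
  simp [counitAux]

lemma counitAux_left (d : H) (x : H ⊗[R] H) :
    counitAux R H ((d ⊗ₜ 1) * x) = d * counitAux R H x := by
  induction x with
  | zero => simp
  | add x y hx hy => simp only [mul_add, map_add, hx, hy]
  | tmul a b => simp [counitAux_tmul]

lemma counitAux_right (c : H) (x : H ⊗[R] H) :
    counitAux R H (x * Coalgebra.comul c) = counitAux R H x * c := by
  induction x with
  | zero => simp
  | add x y hx hy => simp only [add_mul, map_add, hx, hy]
  | tmul a b =>
    have h : ∀ z : H ⊗[R] H, counitAux R H ((a ⊗ₜ b) * z) = Coalgebra.counit (R := R) b •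
        (a * TensorProduct.rid R H ((Coalgebra.counit (R := R)).lTensor H z)) := by
      intro z
      induction z with
      | zero => simp
      | add x y hx hy => simp only [mul_add, map_add, smul_add, hx, hy]
      | tmul u v => simp [counitAux_tmul, mul_smul]
    rw [h, Coalgebra.lTensor_counit_comul, counitAux_tmul]
    simp

/-- The coproduct as a left linear map. -/
def comulL : HopfR R H →ₗ[H] RelTensor R H (HopfR R H) (HopfR R H) where
  toFun x := comulAux R H ((AlgBimodule.of _ _).symm x)
  map_add' x y := by rw [map_add, map_add]
  map_smul' d x := comulAux_left R H d _

/-- The coproduct as a right linear map. -/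
def comulR : HopfR R H →ₗ[Hᵐᵒᵖ] RelTensor R H (HopfR R H) (HopfR R H) where
  toFun x := comulAux R H ((AlgBimodule.of _ _).symm x)
  map_add' x y := by rw [map_add, map_add]
  map_smul' c x := comulAux_right R H (unop c) _

/-- The counit as a left linear map. -/
def counitL : HopfR R H →ₗ[H] H where
  toFun x := counitAux R H ((AlgBimodule.of _ _).symm x)
  map_add' x y := by rw [map_add, map_add]
  map_smul' d x := counitAux_left R H d _

/-- The counit as a right linear map. -/
def counitR : HopfR R H →ₗ[Hᵐᵒᵖ] H where
  toFun x := counitAux R H ((AlgBimodule.of _ _).symm x)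
  map_add' x y := by rw [map_add, map_add]
  map_smul' c x := counitAux_right R H (unop c) _

lemma comulL_tmul (a b : H) : comulL R H (tmul a b) =
    place R H ((TensorProduct.assoc R H H H).symm (a ⊗ₜ Coalgebra.comul (R := R) b)) := rfl

lemma comulR_tmul (a b : H) : comulR R H (tmul a b) =
    place R H ((TensorProduct.assoc R H H H).symm (a ⊗ₜ Coalgebra.comul (R := R) b)) := rfl

lemma counitL_tmul (a b : H) : counitL R H (tmul a b) = Coalgebra.counit (R := R) b • a :=
  counitAux_tmul R H a b

lemma counitR_tmul (a b : H) : counitR R H (tmul a b) = Coalgebra.counit (R := R) b • a :=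
  counitAux_tmul R H a b

@[elab_as_elim]
lemma induction {p : HopfR R H → Prop} (zero : p 0) (tmul : ∀ a b, p (tmul a b))
    (add : ∀ x y, p x → p y → p (x + y)) (x : HopfR R H) : p x :=
  TensorProduct.induction_on (motive := fun x ↦ p (AlgBimodule.of _ _ x)) x zero tmul
    fun x y ↦ add (AlgBimodule.of _ _ x) (AlgBimodule.of _ _ y)

lemma coassoc_aux (x : HopfR R H) :
    RelTensor.assoc R H (HopfR R H) (HopfR R H) (HopfR R H)
      (RelTensor.map R (comulR R H) LinearMap.id (comulL R H x)) =
    RelTensor.map R LinearMap.id (comulL R H) (comulL R H x) := by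
  induction x using induction with
  | zero => simp
  | add x y hx hy => simp only [map_add, hx, hy]
  | tmul a b =>
    set K : H ⊗[R] (H ⊗[R] H) →ₗ[R]
        RelTensor R H (HopfR R H) (RelTensor R H (HopfR R H) (HopfR R H)) :=
      TensorProduct.lift (((RelTensor.mk R H).compl₁₂
        ((AlgBimodule.of _ _).toLinearMap ∘ₗ TensorProduct.mk R H H a)
        (place R H ∘ₗ (TensorProduct.mk R H H 1).rTensor H)))
    have hK : ∀ p q s : H, K (p ⊗ₜ (q ⊗ₜ s)) =
      RelTensor.mk R H (tmul a p) (RelTensor.mk R H (tmul 1 q) (tmul 1 s)) := fun _ _ _ ↦ rfl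
    rw [comulL_tmul]
    have h1 : ∀ z : H ⊗[R] H, RelTensor.assoc R H (HopfR R H) (HopfR R H) (HopfR R H)
        (RelTensor.map R (comulR R H) LinearMap.id
          (place R H ((TensorProduct.assoc R H H H).symm (a ⊗ₜ z)))) =
        K (TensorProduct.assoc R H H H ((Coalgebra.comul (R := R)).rTensor H z)) := by
      intro z
      induction z with
      | zero => simp
      | add x y hx hy => simp only [TensorProduct.tmul_add, map_add, hx, hy]
      | tmul p q =>
        rw [TensorProduct.assoc_symm_tmul, place_tmul, RelTensor.map_mk, comulR_tmul,
          LinearMap.rTensor_tmul]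
        induction Coalgebra.comul (R := R) p with
        | zero => simp
        | add x y hx hy =>
          simp only [TensorProduct.tmul_add, TensorProduct.add_tmul, map_add,
            LinearMap.add_apply, hx, hy]
        | tmul u v =>
          rw [TensorProduct.assoc_symm_tmul, place_tmul, TensorProduct.assoc_tmul, hK]
          rfl
    have h2 : ∀ z : H ⊗[R] H, RelTensor.map R LinearMap.id (comulL R H)
          (place R H ((TensorProduct.assoc R H H H).symm (a ⊗ₜ z))) =
        K ((Coalgebra.comul (R := R)).lTensor H z) := by
      intro z
      induction z with
      | zero => simp
      | add x y hx hy => simp only [TensorProduct.tmul_add, map_add, hx, hy]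
      | tmul p q =>
        rw [TensorProduct.assoc_symm_tmul, place_tmul, RelTensor.map_mk, comulL_tmul,
          LinearMap.lTensor_tmul]
        induction Coalgebra.comul (R := R) q with
        | zero => simp
        | add x y hx hy => simp only [TensorProduct.tmul_add, map_add, hx, hy]
        | tmul u v =>
          rw [TensorProduct.assoc_symm_tmul, place_tmul, hK]
          rfl
    rw [h1, h2, Coalgebra.coassoc_apply]

lemma counit_comul_aux (x : HopfR R H) :
    RelTensor.lid R H (HopfR R H)
      (RelTensor.map R (counitR R H) LinearMap.id (comulL R H x)) = x := by
  induction x using induction with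
  | zero => simp
  | add x y hx hy => simp only [map_add, hx, hy]
  | tmul a b =>
    have h : ∀ z : H ⊗[R] H, RelTensor.lid R H (HopfR R H)
        (RelTensor.map R (counitR R H) LinearMap.id
          (place R H ((TensorProduct.assoc R H H H).symm (a ⊗ₜ z)))) =
        AlgBimodule.of _ _ (a ⊗ₜ (TensorProduct.lid R H
          ((Coalgebra.counit (R := R)).rTensor H z))) := by
      intro z
      induction z with
      | zero => simp
      | add x y hx hy => simp only [TensorProduct.tmul_add, map_add, hx, hy]
      | tmul p q =>
        rw [TensorProduct.assoc_symm_tmul, place_tmul, RelTensor.map_mk, counitR_tmul,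
          RelTensor.lid_mk, LinearMap.id_apply, AlgBimodule.smul_of]
        simp
    rw [comulL_tmul, h, Coalgebra.rTensor_counit_comul]
    simp

lemma comul_counit_aux (x : HopfR R H) :
    RelTensor.rid R H (HopfR R H)
      (RelTensor.map R LinearMap.id (counitL R H) (comulL R H x)) = x := by
  induction x using induction with
  | zero => simp
  | add x y hx hy => simp only [map_add, hx, hy]
  | tmul a b =>
    have h : ∀ z : H ⊗[R] H, RelTensor.rid R H (HopfR R H)
        (RelTensor.map R LinearMap.id (counitL R H)
          (place R H ((TensorProduct.assoc R H H H).symm (a ⊗ₜ z)))) =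
        AlgBimodule.of _ _ (a ⊗ₜ (TensorProduct.rid R H
          ((Coalgebra.counit (R := R)).lTensor H z))) := by
      intro z
      induction z with
      | zero => simp
      | add x y hx hy => simp only [TensorProduct.tmul_add, map_add, hx, hy]
      | tmul p q =>
        rw [TensorProduct.assoc_symm_tmul, place_tmul, RelTensor.map_mk, counitL_tmul,
          RelTensor.rid_mk, LinearMap.id_apply, op_smul, op_one, smul_assoc, one_smul]
        simp
    rw [comulL_tmul, h, Coalgebra.lTensor_counit_comul]
    simp

/-- The `H`-coring `H ⊗ʳ H` with coproduct `I ⊗ Δ` and counit `I ⊗ ε`. -/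
instance : Coring R H (HopfR R H) where
  comul := comulL R H
  comulR := comulR R H
  comulR_apply _ := rfl
  counit := counitL R H
  counitR := counitR R H
  counitR_apply _ := rfl
  coassoc := coassoc_aux R H
  counit_comul := counit_comul_aux R H
  comul_counit := comul_counit_aux R H

lemma isGrouplike_one : Coring.IsGrouplike R H (tmul 1 1 : HopfR R H) where
  comul := by
    change comulL R H _ = _
    rw [comulL_tmul, Bialgebra.comul_one, Algebra.TensorProduct.one_def,
      TensorProduct.assoc_symm_tmul, place_tmul]
  counit := by
    change counitL R H _ = _
    rw [counitL_tmul, Bialgebra.counit_one, one_smul]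

end HopfR

namespace HopfL

variable {R H} in
/-- `a ⊗ b` as an element of `H ⊗ˡ H`. -/
abbrev tmul (a b : H) : HopfL R H := AlgBimodule.of _ _ (a ⊗ₜ b)

/-- The map `(p, x) ↦ (p ⊗ 1) ⊗_H x`. -/
def place : H ⊗[R] (H ⊗[R] H) →ₗ[R] RelTensor R H (HopfL R H) (HopfL R H) :=
  RelTensor.proj R H ∘ₗ TensorProduct.map
    ((AlgBimodule.of _ _).toLinearMap ∘ₗ (TensorProduct.mk R H H).flip 1)
    (AlgBimodule.of _ _).toLinearMap

/-- The coproduct `a ⊗ b ↦ (a₁ ⊗ 1) ⊗_H (a₂ ⊗ b)`. -/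
def comulAux : H ⊗[R] H →ₗ[R] RelTensor R H (HopfL R H) (HopfL R H) :=
  place R H ∘ₗ (TensorProduct.assoc R H H H).toLinearMap ∘ₗ
    (Coalgebra.comul (R := R) (A := H)).rTensor H

/-- The counit `a ⊗ b ↦ ε(a) b`. -/
def counitAux : H ⊗[R] H →ₗ[R] H :=
  (TensorProduct.lid R H).toLinearMap ∘ₗ (Coalgebra.counit (R := R) (A := H)).rTensor H

lemma place_tmul (p : H) (x : H ⊗[R] H) : place R H (p ⊗ₜ x) =
    RelTensor.mk R H (tmul p 1) (AlgBimodule.of _ _ x : HopfL R H) := rfl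

lemma comulAux_tmul (a b : H) : comulAux R H (a ⊗ₜ b) =
    place R H (TensorProduct.assoc R H H H (Coalgebra.comul (R := R) a ⊗ₜ b)) := rfl

lemma comulAux_right (d : H) (x : H ⊗[R] H) :
    comulAux R H (x * (1 ⊗ₜ d)) = op d • comulAux R H x := by
  induction x with
  | zero => simp
  | add x y hx hy => simp only [add_mul, map_add, smul_add, hx, hy]
  | tmul a b =>
    rw [Algebra.TensorProduct.tmul_mul_tmul, mul_one, comulAux_tmul, comulAux_tmul]
    induction Coalgebra.comul (R := R) a with
    | zero => simp
    | add x y hx hy => simp only [TensorProduct.add_tmul, map_add, smul_add, hx, hy]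
    | tmul p q =>
      simp only [TensorProduct.assoc_tmul, place_tmul, RelTensor.op_smul_mk,
        AlgBimodule.op_smul_of, Algebra.TensorProduct.includeRight_apply,
        Algebra.TensorProduct.tmul_mul_tmul, mul_one, unop_op]

lemma place_mul (p : H) (x : H ⊗[R] H) (z : H ⊗[R] H) :
    place R H ((Coalgebra.comul (R := R) (A := H)).lTensor H z * (p ⊗ₜ x)) =
      RelTensor.mk R H (AlgBimodule.of _ _ (z * (p ⊗ₜ 1)) : HopfL R H)
        (AlgBimodule.of _ _ x : HopfL R H) := by
  induction z with
  | zero => simp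
  | add x y hx hy => simp only [add_mul, map_add, LinearMap.add_apply, hx, hy]
  | tmul u v =>
    rw [LinearMap.lTensor_tmul, Algebra.TensorProduct.tmul_mul_tmul, place_tmul,
      Algebra.TensorProduct.tmul_mul_tmul, mul_one]
    have h : (AlgBimodule.of _ _ (Coalgebra.comul (R := R) v * x) : HopfL R H) =
      v • (AlgBimodule.of _ _ x : HopfL R H) := rfl
    rw [h, ← RelTensor.mk_smul, AlgBimodule.op_smul_of, Algebra.TensorProduct.includeRight_apply,
      Algebra.TensorProduct.tmul_mul_tmul, mul_one, unop_op, one_mul]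

lemma comulAux_left (c : H) (x : H ⊗[R] H) :
    comulAux R H (Coalgebra.comul c * x) = c • comulAux R H x := by
  induction x with
  | zero => simp
  | add x y hx hy => simp only [mul_add, map_add, smul_add, hx, hy]
  | tmul a b =>
    have h1 : ∀ z : H ⊗[R] H, comulAux R H (z * (a ⊗ₜ b)) =
        place R H (TensorProduct.assoc R H H H ((Coalgebra.comul (R := R)).rTensor H z) *
          TensorProduct.assoc R H H H (Coalgebra.comul (R := R) a ⊗ₜ b)) := by
      intro z
      induction z with
      | zero => simp
      | add x y hx hy => simp only [add_mul, map_add, hx, hy]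
      | tmul u v =>
        rw [Algebra.TensorProduct.tmul_mul_tmul, comulAux_tmul, Bialgebra.comul_mul,
          LinearMap.rTensor_tmul]
        congr 1
        induction Coalgebra.comul (R := R) a with
        | zero => simp
        | add x y hx hy => simp only [TensorProduct.add_tmul, map_add, mul_add, hx, hy]
        | tmul p q =>
          induction Coalgebra.comul (R := R) u with
          | zero => simp
          | add x y hx hy => simp only [TensorProduct.add_tmul, map_add, add_mul, hx, hy]
          | tmul p q => simp
    rw [h1, Coalgebra.coassoc_apply, comulAux_tmul]
    induction Coalgebra.comul (R := R) a with
    | zero => simp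
    | add x y hx hy => simp only [TensorProduct.add_tmul, map_add, mul_add, smul_add, hx, hy]
    | tmul p q =>
      rw [TensorProduct.assoc_tmul, place_mul, place_tmul, RelTensor.smul_mk,
        AlgBimodule.smul_of]
      rfl

lemma counitAux_tmul (a b : H) : counitAux R H (a ⊗ₜ b) = Coalgebra.counit (R := R) a • b := by
  simp [counitAux]

lemma counitAux_right (d : H) (x : H ⊗[R] H) :
    counitAux R H (x * (1 ⊗ₜ d)) = counitAux R H x * d := by
  induction x with
  | zero => simp
  | add x y hx hy => simp only [add_mul, map_add, hx, hy]
  | tmul a b => simp [counitAux_tmul]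

lemma counitAux_left (c : H) (x : H ⊗[R] H) :
    counitAux R H (Coalgebra.comul c * x) = c * counitAux R H x := by
  induction x with
  | zero => simp
  | add x y hx hy => simp only [mul_add, map_add, hx, hy]
  | tmul a b =>
    have h : ∀ z : H ⊗[R] H, counitAux R H (z * (a ⊗ₜ b)) = Coalgebra.counit (R := R) a •
        (TensorProduct.lid R H ((Coalgebra.counit (R := R)).rTensor H z) * b) := by
      intro z
      induction z with
      | zero => simp
      | add x y hx hy => simp only [add_mul, map_add, smul_add, hx, hy]
      | tmul u v => simp [counitAux_tmul, smul_smul, mul_comm]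
    rw [h, Coalgebra.rTensor_counit_comul, counitAux_tmul]
    simp

/-- The coproduct as a left linear map. -/
def comulL : HopfL R H →ₗ[H] RelTensor R H (HopfL R H) (HopfL R H) where
  toFun x := comulAux R H ((AlgBimodule.of _ _).symm x)
  map_add' x y := by rw [map_add, map_add]
  map_smul' d x := comulAux_left R H d _

/-- The coproduct as a right linear map. -/
def comulR : HopfL R H →ₗ[Hᵐᵒᵖ] RelTensor R H (HopfL R H) (HopfL R H) where
  toFun x := comulAux R H ((AlgBimodule.of _ _).symm x)
  map_add' x y := by rw [map_add, map_add]
  map_smul' c x := comulAux_right R H (unop c) _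

/-- The counit as a left linear map. -/
def counitL : HopfL R H →ₗ[H] H where
  toFun x := counitAux R H ((AlgBimodule.of _ _).symm x)
  map_add' x y := by rw [map_add, map_add]
  map_smul' d x := counitAux_left R H d _

/-- The counit as a right linear map. -/
def counitR : HopfL R H →ₗ[Hᵐᵒᵖ] H where
  toFun x := counitAux R H ((AlgBimodule.of _ _).symm x)
  map_add' x y := by rw [map_add, map_add]
  map_smul' c x := counitAux_right R H (unop c) _

lemma comulL_tmul (a b : H) : comulL R H (tmul a b) =
    place R H (TensorProduct.assoc R H H H (Coalgebra.comul (R := R) a ⊗ₜ b)) := rfl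

lemma comulR_tmul (a b : H) : comulR R H (tmul a b) =
    place R H (TensorProduct.assoc R H H H (Coalgebra.comul (R := R) a ⊗ₜ b)) := rfl

lemma counitL_tmul (a b : H) : counitL R H (tmul a b) = Coalgebra.counit (R := R) a • b :=
  counitAux_tmul R H a b

lemma counitR_tmul (a b : H) : counitR R H (tmul a b) = Coalgebra.counit (R := R) a • b :=
  counitAux_tmul R H a b

@[elab_as_elim]
lemma induction {p : HopfL R H → Prop} (zero : p 0) (tmul : ∀ a b, p (tmul a b))
    (add : ∀ x y, p x → p y → p (x + y)) (x : HopfL R H) : p x :=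
  TensorProduct.induction_on (motive := fun x ↦ p (AlgBimodule.of _ _ x)) x zero tmul
    fun x y ↦ add (AlgBimodule.of _ _ x) (AlgBimodule.of _ _ y)

lemma coassoc_aux (x : HopfL R H) :
    RelTensor.assoc R H (HopfL R H) (HopfL R H) (HopfL R H)
      (RelTensor.map R (comulR R H) LinearMap.id (comulL R H x)) =
    RelTensor.map R LinearMap.id (comulL R H) (comulL R H x) := by
  induction x using induction with
  | zero => simp
  | add x y hx hy => simp only [map_add, hx, hy]
  | tmul a b =>
    set K : H ⊗[R] (H ⊗[R] H) →ₗ[R]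
        RelTensor R H (HopfL R H) (RelTensor R H (HopfL R H) (HopfL R H)) :=
      TensorProduct.lift (((RelTensor.mk R H).compl₁₂
        ((AlgBimodule.of _ _).toLinearMap ∘ₗ (TensorProduct.mk R H H).flip 1)
        (place R H ∘ₗ ((TensorProduct.mk R H H).flip b).lTensor H)))
    have hK : ∀ p q s : H, K (p ⊗ₜ (q ⊗ₜ s)) =
      RelTensor.mk R H (tmul p 1) (RelTensor.mk R H (tmul q 1) (tmul s b)) := fun _ _ _ ↦ rfl
    rw [comulL_tmul]
    have h1 : ∀ z : H ⊗[R] H, RelTensor.assoc R H (HopfL R H) (HopfL R H) (HopfL R H)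
        (RelTensor.map R (comulR R H) LinearMap.id
          (place R H (TensorProduct.assoc R H H H (z ⊗ₜ b)))) =
        K (TensorProduct.assoc R H H H ((Coalgebra.comul (R := R)).rTensor H z)) := by
      intro z
      induction z with
      | zero => simp
      | add x y hx hy => simp only [TensorProduct.add_tmul, map_add, hx, hy]
      | tmul p q =>
        rw [TensorProduct.assoc_tmul, place_tmul, RelTensor.map_mk, comulR_tmul,
          LinearMap.rTensor_tmul]
        induction Coalgebra.comul (R := R) p with
        | zero => simp
        | add x y hx hy =>
          simp only [TensorProduct.add_tmul, map_add, LinearMap.add_apply, hx, hy]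
        | tmul u v =>
          rw [TensorProduct.assoc_tmul, place_tmul, TensorProduct.assoc_tmul, hK]
          rfl
    have h2 : ∀ z : H ⊗[R] H, RelTensor.map R LinearMap.id (comulL R H)
          (place R H (TensorProduct.assoc R H H H (z ⊗ₜ b))) =
        K ((Coalgebra.comul (R := R)).lTensor H z) := by
      intro z
      induction z with
      | zero => simp
      | add x y hx hy => simp only [TensorProduct.add_tmul, map_add, hx, hy]
      | tmul p q =>
        rw [TensorProduct.assoc_tmul, place_tmul, RelTensor.map_mk, comulL_tmul,
          LinearMap.lTensor_tmul]
        induction Coalgebra.comul (R := R) q with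
        | zero => simp
        | add x y hx hy =>
          simp only [TensorProduct.tmul_add, TensorProduct.add_tmul, map_add, hx, hy]
        | tmul u v =>
          rw [TensorProduct.assoc_tmul, place_tmul, hK]
          rfl
    rw [h1, h2, Coalgebra.coassoc_apply]

lemma counit_comul_aux (x : HopfL R H) :
    RelTensor.lid R H (HopfL R H)
      (RelTensor.map R (counitR R H) LinearMap.id (comulL R H x)) = x := by
  induction x using induction with
  | zero => simp
  | add x y hx hy => simp only [map_add, hx, hy]
  | tmul a b =>
    have h : ∀ z : H ⊗[R] H, RelTensor.lid R H (HopfL R H)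
        (RelTensor.map R (counitR R H) LinearMap.id
          (place R H (TensorProduct.assoc R H H H (z ⊗ₜ b)))) =
        AlgBimodule.of _ _ ((TensorProduct.lid R H
          ((Coalgebra.counit (R := R)).rTensor H z)) ⊗ₜ b) := by
      intro z
      induction z with
      | zero => simp
      | add x y hx hy => simp only [TensorProduct.add_tmul, map_add, hx, hy]
      | tmul p q =>
        rw [TensorProduct.assoc_tmul, place_tmul, RelTensor.map_mk, counitR_tmul,
          RelTensor.lid_mk, LinearMap.id_apply, smul_assoc, one_smul,
          LinearMap.rTensor_tmul, TensorProduct.lid_tmul, ← TensorProduct.smul_tmul', map_smul]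
    rw [comulL_tmul, h, Coalgebra.rTensor_counit_comul]
    simp

lemma comul_counit_aux (x : HopfL R H) :
    RelTensor.rid R H (HopfL R H)
      (RelTensor.map R LinearMap.id (counitL R H) (comulL R H x)) = x := by
  induction x using induction with
  | zero => simp
  | add x y hx hy => simp only [map_add, hx, hy]
  | tmul a b =>
    have h : ∀ z : H ⊗[R] H, RelTensor.rid R H (HopfL R H)
        (RelTensor.map R LinearMap.id (counitL R H)
          (place R H (TensorProduct.assoc R H H H (z ⊗ₜ b)))) =
        AlgBimodule.of _ _ ((TensorProduct.rid R H
          ((Coalgebra.counit (R := R)).lTensor H z)) ⊗ₜ b) := by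
      intro z
      induction z with
      | zero => simp
      | add x y hx hy => simp only [TensorProduct.add_tmul, map_add, hx, hy]
      | tmul p q =>
        rw [TensorProduct.assoc_tmul, place_tmul, RelTensor.map_mk, counitL_tmul,
          RelTensor.rid_mk, LinearMap.id_apply, AlgBimodule.op_smul_of]
        simp [TensorProduct.smul_tmul']
    rw [comulL_tmul, h, Coalgebra.lTensor_counit_comul]
    simp

/-- The `H`-coring `H ⊗ˡ H` with coproduct `Δ ⊗ I` and counit `ε ⊗ I`. -/
instance : Coring R H (HopfL R H) where
  comul := comulL R H
  comulR := comulR R H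
  comulR_apply _ := rfl
  counit := counitL R H
  counitR := counitR R H
  counitR_apply _ := rfl
  coassoc := coassoc_aux R H
  counit_comul := counit_comul_aux R H
  comul_counit := comul_counit_aux R H

lemma isGrouplike_one : Coring.IsGrouplike R H (tmul 1 1 : HopfL R H) where
  comul := by
    change comulL R H _ = _
    rw [comulL_tmul, Bialgebra.comul_one, Algebra.TensorProduct.one_def,
      TensorProduct.assoc_tmul, place_tmul]
  counit := by
    change counitL R H _ = _
    rw [counitL_tmul, Bialgebra.counit_one, one_smul]

end HopfL

end HopfCorings

/-! Everything reduces to the bijectivity of γ(a ⊗ b) = a₁ ⊗ a₂ b or of its mirror image β(a ⊗ b) =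
a b₁ ⊗ b₂, and these two meet in the existence of an antipode.

The categorical half is carried out once, for a bimonad F on an arbitrary category. An antipode S
gives the inverses of the operators `fus` and `cofus`, in the notation of F = - ⊗ H the maps a ⊗ b ↦
a₁ ⊗ S(a₂) b and a ⊗ b ↦ a S(b₁) ⊗ b₂. Conversely, from either inverse the unit and the counit of F
cut out an antipode (`isHopf_iff_isIso_fus`, `isHopf_iff_isIso_cofus`). For - ⊗ H the two operators
are - ⊗ γ and - ⊗ β, and for [H, -] the operator `fus` is [γ, -]. Evaluation at R in the first case
and the Yoneda argument in the second pass from the functors to H.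

For Hopf modules, the comparison functor X ↦ F X is always fully faithful, because the coinvariants
of F Y are Y. If there is an antipode, x ↦ x₀ S(x₁) is an idempotent on a Hopf module M; splitting
it produces the object X of coinvariants, and acting on it gives F X ≅ M. This is the fundamental
theorem of Hopf modules. Conversely, if the functor is essentially surjective, then the Hopf module
F F X with cofree coaction and diagonal action is some F Y; comparing coinvariants gives Y ≅ F X,
and this forces `cofus` to be invertible (`toMixed_isEquivalence_iff`).

For a grouplike g of an A-coring C, a comodule endomorphism of A is multiplication by an element
commuting with g. In both corings on H ⊗ H only the scalars from R commute with g = 1 ⊗ 1, so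
tensoring over T is tensoring over R and T-linearity is implied by R-linearity. All the Galois
conditions then say that a ⊗ b ↦ a g b is a bijection A ⊗ A → C: the canonical map at X = A is this
map, and the Hom version is what this map represents. For H ⊗ʳ H the map is β, for H ⊗ˡ H it is γ.
-/

namespace TauBimonad

variable {C : Type u} [Category.{v} C] (B : TauBimonad C)

/-! ### Componentwise form of the monad and comonad laws -/

section Laws

/-- The components of the product. -/
def mul (X : C) : B.obj (B.obj X) ⟶ B.obj X := B.μ.app X

/-- The components of the unit. -/
def one (X : C) : X ⟶ B.obj X := B.η.app X

/-- The components of the coproduct. -/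
def comul (X : C) : B.obj X ⟶ B.obj (B.obj X) := B.d.app X

/-- The components of the counit. -/
def counit (X : C) : B.obj X ⟶ X := B.e.app X

variable {X Y : C}

lemma mul_naturality (f : X ⟶ Y) : B.map (B.map f) ≫ B.mul Y = B.mul X ≫ B.map f :=
  B.μ.naturality f

lemma one_naturality (f : X ⟶ Y) : f ≫ B.one Y = B.one X ≫ B.map f :=
  B.η.naturality f

lemma comul_naturality (f : X ⟶ Y) : B.map f ≫ B.comul Y = B.comul X ≫ B.map (B.map f) :=
  B.d.naturality f

lemma counit_naturality (f : X ⟶ Y) : B.map f ≫ B.counit Y = B.counit X ≫ f :=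
  B.e.naturality f

variable (X)

lemma map_mul_mul : B.map (B.mul X) ≫ B.mul X = B.mul (B.obj X) ≫ B.mul X := B.assoc X

lemma one_mul : B.one (B.obj X) ≫ B.mul X = 𝟙 (B.obj X) := B.left_unit X

lemma map_one_mul : B.map (B.one X) ≫ B.mul X = 𝟙 (B.obj X) := B.right_unit X

lemma comul_map_comul : B.comul X ≫ B.map (B.comul X) = B.comul X ≫ B.comul (B.obj X) :=
  B.coassoc X

lemma comul_counit : B.comul X ≫ B.counit (B.obj X) = 𝟙 (B.obj X) := B.left_counit X

lemma comul_map_counit : B.comul X ≫ B.map (B.counit X) = 𝟙 (B.obj X) := B.right_counit X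

lemma one_counit : B.one X ≫ B.counit X = 𝟙 X := B.e_unit X

lemma one_comul : B.one X ≫ B.comul X = B.one X ≫ B.one (B.obj X) := B.unit_d X

end Laws

/-! ### Fusion operators and the antipode -/

section Antipode

/-- The components of the fusion operator. -/
def fus (X : C) : B.obj (B.obj X) ⟶ B.obj (B.obj X) := B.map (B.comul X) ≫ B.mul (B.obj X)

/-- The components `d F` followed by `F m` of the opposite fusion operator. -/
def cofus (X : C) : B.obj (B.obj X) ⟶ B.obj (B.obj X) := B.comul (B.obj X) ≫ B.map (B.mul X)

variable {X Y : C}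

lemma fus_naturality (f : X ⟶ Y) :
    B.map (B.map f) ≫ B.fus Y = B.fus X ≫ B.map (B.map f) :=
  B.fusion.naturality f

lemma cofus_naturality (f : X ⟶ Y) :
    B.map (B.map f) ≫ B.cofus Y = B.cofus X ≫ B.map (B.map f) := by
  simp only [cofus, Category.assoc, reassoc_of% B.comul_naturality (B.map f), ← B.map_comp,
    B.mul_naturality]

variable (X)

/-- For `- ⊗ H` the operator is a ⊗ b ↦ a₁ ⊗ a₂ b. This identity and the next three are all that the
construction of an antipode needs: b = 1 gives Δ, ε on the first factor gives the product, and the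
operator is linear in the last factor and colinear in the first. -/
lemma one_fus : B.one (B.obj X) ≫ B.fus X = B.comul X := by
  rw [fus, ← reassoc_of% B.one_naturality (B.comul X), one_mul, Category.comp_id]

lemma fus_map_counit : B.fus X ≫ B.map (B.counit X) = B.mul X := by
  rw [fus, Category.assoc, ← B.mul_naturality, ← B.map_comp_assoc, comul_map_counit, B.map_id,
    Category.id_comp]

lemma mul_fus : B.mul (B.obj X) ≫ B.fus X = B.map (B.fus X) ≫ B.mul (B.obj X) := by
  rw [fus, B.map_comp, Category.assoc, map_mul_mul, reassoc_of% B.mul_naturality (B.comul X)]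

lemma fus_map_comul : B.fus X ≫ B.map (B.comul X) = B.map (B.comul X) ≫ B.fus (B.obj X) := by
  rw [fus, fus, Category.assoc, ← B.mul_naturality, ← B.map_comp_assoc, comul_map_comul,
    B.map_comp_assoc]

/-- The mirror image, for a ⊗ b ↦ a b₁ ⊗ b₂: a = 1 gives Δ, ε on the last factor gives the product,
and the operator is colinear in the last factor and linear in the first. -/
lemma map_one_cofus : B.map (B.one X) ≫ B.cofus X = B.comul X := by
  rw [cofus, reassoc_of% B.comul_naturality (B.one X), ← B.map_comp, map_one_mul, B.map_id,
    Category.comp_id]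

lemma cofus_counit : B.cofus X ≫ B.counit (B.obj X) = B.mul X := by
  rw [cofus, Category.assoc, B.counit_naturality, reassoc_of% B.comul_counit (B.obj X)]

lemma cofus_comul : B.cofus X ≫ B.comul (B.obj X) = B.comul (B.obj X) ≫ B.map (B.cofus X) := by
  rw [cofus, Category.assoc, B.comul_naturality, ← reassoc_of% B.comul_map_comul (B.obj X),
    B.map_comp]

lemma map_mul_cofus : B.map (B.mul X) ≫ B.cofus X = B.cofus (B.obj X) ≫ B.map (B.mul X) := by
  rw [cofus, cofus, reassoc_of% B.comul_naturality (B.mul X), Category.assoc, ← B.map_comp,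
    map_mul_mul, B.map_comp]

variable {B}

lemma isHopf_iff : B.IsHopf ↔ ∃ S : ∀ X, B.obj X ⟶ B.obj X,
    (∀ {X Y : C} (f : X ⟶ Y), B.map f ≫ S Y = S X ≫ B.map f) ∧
    (∀ X, B.comul X ≫ S (B.obj X) ≫ B.mul X = B.counit X ≫ B.one X) ∧
    (∀ X, B.comul X ≫ B.map (S X) ≫ B.mul X = B.counit X ≫ B.one X) :=
  ⟨fun ⟨S, h, h'⟩ ↦ ⟨S.app, fun f ↦ S.naturality f, h, h'⟩,
    fun ⟨S, n, h, h'⟩ ↦ ⟨⟨S, fun _ _ f ↦ n f⟩, h, h'⟩⟩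

/-- In elements S(a) = (ε ⊗ H) γ⁻¹(a ⊗ 1). The inverse inherits linearity and colinearity from γ, so
it is governed by this one value, and each antipode identity becomes a unit or counit property of
γ⁻¹. -/
lemma isHopf_of_isIso_fus [∀ X, IsIso (B.fus X)] : B.IsHopf := by
  have h1 (X : C) : B.map (B.comul X) ≫ inv (B.fus (B.obj X)) =
      inv (B.fus X) ≫ B.map (B.comul X) := by
    rw [IsIso.comp_inv_eq, Category.assoc, ← fus_map_comul, IsIso.inv_hom_id_assoc]
  have h2 (X : C) : B.mul (B.obj X) ≫ inv (B.fus X) =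
      B.map (inv (B.fus X)) ≫ B.mul (B.obj X) := by
    rw [IsIso.comp_inv_eq, Category.assoc, mul_fus, ← B.map_comp_assoc, IsIso.inv_hom_id, B.map_id,
      Category.id_comp]
  have h3 (X : C) : inv (B.fus X) ≫ B.mul X = B.map (B.counit X) := by
    rw [IsIso.inv_comp_eq, fus_map_counit]
  have h4 (X : C) : B.comul X ≫ inv (B.fus X) = B.one (B.obj X) := by
    rw [IsIso.comp_inv_eq, one_fus]
  -- Linearity in the last factor: (ε ⊗ H) γ⁻¹(a ⊗ b) = S(a) b.
  have h5 (X : C) : inv (B.fus X) ≫ B.map (B.counit X) =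
      B.map (B.one (B.obj X) ≫ inv (B.fus X) ≫ B.map (B.counit X)) ≫ B.mul X := by
    rw [B.map_comp, B.map_comp, Category.assoc, Category.assoc, B.mul_naturality,
      ← reassoc_of% h2 X, reassoc_of% B.map_one_mul (B.obj X)]
  -- Colinearity in the first factor: a₁ ⊗ S(a₂) = γ⁻¹(a ⊗ 1).
  have h6 (X : C) : B.comul X ≫ B.one (B.obj (B.obj X)) ≫ inv (B.fus (B.obj X)) ≫
      B.map (B.counit (B.obj X)) = B.one (B.obj X) ≫ inv (B.fus X) := by
    rw [reassoc_of% B.one_naturality (B.comul X), reassoc_of% h1 X, ← B.map_comp, comul_counit,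
      B.map_id, Category.comp_id]
  refine isHopf_iff.2 ⟨fun X ↦ B.one (B.obj X) ≫ inv (B.fus X) ≫ B.map (B.counit X), ?_, ?_, ?_⟩
  · intro X Y f
    have h7 : B.map (B.map f) ≫ inv (B.fus Y) = inv (B.fus X) ≫ B.map (B.map f) := by
      rw [IsIso.comp_inv_eq, Category.assoc, fus_naturality, IsIso.inv_hom_id_assoc]
    rw [reassoc_of% B.one_naturality (B.map f), reassoc_of% h7, Category.assoc, Category.assoc,
      ← B.map_comp, ← B.map_comp, counit_naturality]
  · intro X
    simp only [Category.assoc]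
    rw [reassoc_of% h6 X, h3, ← one_naturality]
  · intro X
    rw [← h5, reassoc_of% h4 X, ← one_naturality]

/-- Here S(a) = (H ⊗ ε) β⁻¹(1 ⊗ a). As before, β⁻¹ inherits the (co)linearity of β: this gives (H ⊗
ε) β⁻¹(a ⊗ b) = a S(b) in `h5` and β⁻¹(1 ⊗ a) = S(a₁) ⊗ a₂ in `h6`. -/
lemma isHopf_of_isIso_cofus [∀ X, IsIso (B.cofus X)] : B.IsHopf := by
  have h1 (X : C) : inv (B.cofus X) ≫ B.comul (B.obj X) =
      B.comul (B.obj X) ≫ B.map (inv (B.cofus X)) := by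
    rw [IsIso.inv_comp_eq, reassoc_of% B.cofus_comul X, ← B.map_comp, IsIso.hom_inv_id, B.map_id,
      Category.comp_id]
  have h2 (X : C) : B.map (B.mul X) ≫ inv (B.cofus X) =
      inv (B.cofus (B.obj X)) ≫ B.map (B.mul X) := by
    rw [IsIso.comp_inv_eq, Category.assoc, map_mul_cofus, IsIso.inv_hom_id_assoc]
  have h3 (X : C) : inv (B.cofus X) ≫ B.mul X = B.counit (B.obj X) := by
    rw [IsIso.inv_comp_eq, cofus_counit]
  have h4 (X : C) : B.comul X ≫ inv (B.cofus X) = B.map (B.one X) := by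
    rw [IsIso.comp_inv_eq, map_one_cofus]
  have h5 (X : C) : inv (B.cofus X) ≫ B.counit (B.obj X) =
      (B.map (B.one (B.obj X)) ≫ inv (B.cofus (B.obj X)) ≫ B.counit (B.obj (B.obj X))) ≫
        B.mul X := by
    rw [Category.assoc, Category.assoc, ← counit_naturality, ← reassoc_of% h2 X,
      ← B.map_comp_assoc, B.one_mul, B.map_id, Category.id_comp]
  have h6 (X : C) : B.map (B.one X) ≫ inv (B.cofus X) =
      B.comul X ≫ B.map (B.map (B.one X) ≫ inv (B.cofus X) ≫ B.counit (B.obj X)) := by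
    rw [B.map_comp, B.map_comp, ← reassoc_of% B.comul_naturality (B.one X),
      ← reassoc_of% h1 X, comul_map_counit, Category.comp_id]
  refine isHopf_iff.2 ⟨fun X ↦ B.map (B.one X) ≫ inv (B.cofus X) ≫ B.counit (B.obj X),
    ?_, ?_, ?_⟩
  · intro X Y f
    have h7 : B.map (B.map f) ≫ inv (B.cofus Y) = inv (B.cofus X) ≫ B.map (B.map f) := by
      rw [IsIso.comp_inv_eq, Category.assoc, cofus_naturality, IsIso.inv_hom_id_assoc]
    rw [← B.map_comp_assoc, B.one_naturality, B.map_comp_assoc, reassoc_of% h7, Category.assoc,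
      Category.assoc, counit_naturality]
  · intro X
    rw [← h5, reassoc_of% h4 X, counit_naturality]
  · intro X
    rw [← reassoc_of% h6 X, h3, counit_naturality]

/-- The inverse is a ⊗ b ↦ a₁ ⊗ S(a₂) b. Coassociativity brings the two factors that are to be
multiplied next to each other, where one antipode identity serves each composite. -/
lemma IsHopf.isIso_fus (h : B.IsHopf) (X : C) : IsIso (B.fus X) := by
  obtain ⟨S, n, h1, h2⟩ := isHopf_iff.1 h
  refine ⟨B.map (B.comul X ≫ S (B.obj X)) ≫ B.mul (B.obj X), ?_, ?_⟩
  · rw [fus, Category.assoc, ← reassoc_of% B.mul_naturality, ← map_mul_mul, ← B.map_comp_assoc,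
      ← B.map_comp_assoc, B.map_comp (B.comul X) (S _), Category.assoc, Category.assoc,
      reassoc_of% B.comul_map_comul X, h2, reassoc_of% B.comul_counit X, map_one_mul]
  · rw [fus, Category.assoc, ← reassoc_of% B.mul_naturality, ← map_mul_mul, ← B.map_comp_assoc,
      ← B.map_comp_assoc, Category.assoc, Category.assoc, ← reassoc_of% n (B.comul X),
      reassoc_of% B.comul_map_comul X, h1, reassoc_of% B.comul_counit X, map_one_mul]

/-- The inverse is a ⊗ b ↦ a S(b₁) ⊗ b₂; the two composites use the two antipode identities. -/
lemma IsHopf.isIso_cofus (h : B.IsHopf) (X : C) : IsIso (B.cofus X) := by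
  obtain ⟨S, n, h1, h2⟩ := isHopf_iff.1 h
  refine ⟨B.comul (B.obj X) ≫ B.map (S (B.obj X) ≫ B.mul X), ?_, ?_⟩
  · rw [cofus, Category.assoc, reassoc_of% B.comul_naturality (B.mul X),
      ← reassoc_of% B.comul_map_comul (B.obj X), ← B.map_comp, ← B.map_comp,
      reassoc_of% n (B.mul X), map_mul_mul, reassoc_of% h1 (B.obj X), B.one_mul, Category.comp_id,
      comul_map_counit]
  · rw [cofus, Category.assoc, reassoc_of% B.comul_naturality (S (B.obj X) ≫ B.mul X),
      ← reassoc_of% B.comul_map_comul (B.obj X), ← B.map_comp, ← B.map_comp,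
      B.map_comp (S _), Category.assoc, map_mul_mul, reassoc_of% h2 (B.obj X), B.one_mul,
      Category.comp_id, comul_map_counit]

lemma isIso_fusion_iff : IsIso B.fusion ↔ ∀ X, IsIso (B.fus X) :=
  NatTrans.isIso_iff_isIso_app _

lemma isHopf_iff_isIso_fus : B.IsHopf ↔ ∀ X, IsIso (B.fus X) :=
  ⟨fun h ↦ h.isIso_fus, fun _ ↦ isHopf_of_isIso_fus⟩

lemma isHopf_iff_isIso_cofus : B.IsHopf ↔ ∀ X, IsIso (B.cofus X) :=
  ⟨fun h ↦ h.isIso_cofus, fun _ ↦ isHopf_of_isIso_cofus⟩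

end Antipode

end TauBimonad

/-! ### Isomorphisms of mixed bimodules -/

namespace MixedBimodule

variable {C : Type u} [Category.{v} C] {F : Monad C} {T : Comonad C}
  {lam : T.toFunctor ⋙ F.toFunctor ⟶ F.toFunctor ⋙ T.toFunctor}

/-- A morphism of mixed bimodules which is an isomorphism in the base category is one. -/
noncomputable def isoOfIsIso {X Y : MixedBimodule F T lam} (φ : X ⟶ Y) [IsIso φ.f] : X ≅ Y where
  hom := φ
  inv := ⟨inv φ.f, by
      rw [← cancel_epi (F.map φ.f), ← F.map_comp_assoc, IsIso.hom_inv_id, F.map_id,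
        Category.id_comp, reassoc_of% φ.h, IsIso.hom_inv_id, Category.comp_id], by
      rw [← cancel_epi φ.f, ← reassoc_of% φ.k, ← T.map_comp, IsIso.hom_inv_id, T.map_id,
        Category.comp_id, IsIso.hom_inv_id_assoc]⟩
  hom_inv_id := Hom.ext (IsIso.hom_inv_id φ.f)
  inv_hom_id := Hom.ext (IsIso.inv_hom_id φ.f)

end MixedBimodule

namespace TauBimonad

variable {C : Type u} [Category.{v} C] (B : TauBimonad C)

/-- The compatibility of a natural transformation `FF ⟶ FF` with the product, the unit and the
coproduct of `F` which turns it into a mixed distributive law lifting the coproduct. -/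
structure IsMixedLaw (l : ∀ X, B.obj (B.obj X) ⟶ B.obj (B.obj X)) : Prop where
  naturality : ∀ {X Y : C} (f : X ⟶ Y), B.map (B.map f) ≫ l Y = l X ≫ B.map (B.map f)
  mul : ∀ X, B.mul (B.obj X) ≫ l X = B.map (l X) ≫ l (B.obj X) ≫ B.map (B.mul X)
  one : ∀ X, B.one (B.obj X) ≫ l X = B.map (B.one X)
  comul : ∀ X, l X ≫ B.comul (B.obj X) = B.map (B.comul X) ≫ l (B.obj X) ≫ B.map (l X)
  map_one : ∀ X, B.map (B.one X) ≫ l X = B.comul X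

variable {B}

/-! ### Convolution with the identity -/

section Convolution

variable {Z A : C} {k : Z ⟶ B.obj Z} {a : B.obj A ⟶ A}

/-- Convolving with S undoes convolving with the identity: w is recovered from x ↦ w(x₀) x₁ because
w(x₀) x₁ S(x₂) = w(x). Neither compatibility between `k` and `a` nor a common carrier is required,
so the lemma can be applied to maps into a different module. -/
lemma convolution_injective (hk : k ≫ B.counit Z = 𝟙 Z) (hk' : k ≫ B.comul Z = k ≫ B.map k)
    (ha : B.one A ≫ a = 𝟙 A) (ha' : B.mul A ≫ a = B.map a ≫ a) (h : B.IsHopf) {u v : Z ⟶ A}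
    (huv : k ≫ B.map u ≫ a = k ≫ B.map v ≫ a) : u = v := by
  obtain ⟨S, n, h1, h2⟩ := isHopf_iff.1 h
  have key (w : Z ⟶ A) : k ≫ S Z ≫ B.map (k ≫ B.map w ≫ a) ≫ a = w := by
    rw [B.map_comp, B.map_comp, Category.assoc, Category.assoc, ← ha',
      reassoc_of% B.mul_naturality w, ← reassoc_of% n k, ← reassoc_of% hk',
      reassoc_of% h1 Z, reassoc_of% hk, ← reassoc_of% B.one_naturality w, ha, Category.comp_id]
  rw [← key u, huv, key]

end Convolution

/-! ### The projection onto the coinvariants -/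

section Retract

variable {A : C} {k : A ⟶ B.obj A} {a : B.obj A ⟶ A} {S : ∀ X, B.obj X ⟶ B.obj X}

/-- Since 1 is grouplike, the identity a₁ S(a₂) = ε(a) at a = 1 reads 1 · S(1) = 1. -/
lemma one_antipode (n : ∀ {X Y : C} (f : X ⟶ Y), B.map f ≫ S Y = S X ≫ B.map f)
    (h1 : ∀ X, B.comul X ≫ S (B.obj X) ≫ B.mul X = B.counit X ≫ B.one X) (X : C) :
    B.one X ≫ S X = B.one X := by
  have := B.one X ≫= h1 X
  rwa [reassoc_of% B.one_comul X, reassoc_of% B.one_counit X,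
    reassoc_of% B.one_naturality (B.one X), reassoc_of% n (B.one X), map_one_mul, Category.comp_id] at this

variable (k a S) in
/-- The projection `x ↦ x₀ S(x₁)` onto the coinvariants. -/
def coinvProj : A ⟶ A := k ≫ S A ≫ a

/-- In elements x₀ S(x₁) x₂ = x: every element is recovered from the projections of its coaction.
This yields one half of the isomorphism F X ≅ M. -/
lemma comul_coinvProj (hk' : k ≫ B.comul A = k ≫ B.map k)
    (hk : k ≫ B.counit A = 𝟙 A) (ha : B.one A ≫ a = 𝟙 A) (ha' : B.mul A ≫ a = B.map a ≫ a)
    (h2 : ∀ X, B.comul X ≫ B.map (S X) ≫ B.mul X = B.counit X ≫ B.one X) :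
    k ≫ B.map (coinvProj k a S) ≫ a = 𝟙 A := by
  rw [coinvProj, B.map_comp, B.map_comp, Category.assoc, Category.assoc, ← ha',
    ← reassoc_of% hk', reassoc_of% h2 A, reassoc_of% hk, ha]

/-- The usual computation of the coaction on x₀ S(x₁) would need S to reverse coproducts. Instead
the two sides are compared after convolution with the identity, which is injective; both then become
the coaction `k`. -/
lemma coinvProj_coaction {l : ∀ X, B.obj (B.obj X) ⟶ B.obj (B.obj X)} (hl : B.IsMixedLaw l)
    (hk : k ≫ B.counit A = 𝟙 A) (hk' : k ≫ B.comul A = k ≫ B.map k)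
    (ha : B.one A ≫ a = 𝟙 A) (ha' : B.mul A ≫ a = B.map a ≫ a)
    (p : a ≫ k = B.map k ≫ l A ≫ B.map a)
    (n : ∀ {X Y : C} (f : X ⟶ Y), B.map f ≫ S Y = S X ≫ B.map f)
    (h1 : ∀ X, B.comul X ≫ S (B.obj X) ≫ B.mul X = B.counit X ≫ B.one X)
    (h2 : ∀ X, B.comul X ≫ B.map (S X) ≫ B.mul X = B.counit X ≫ B.one X) :
    coinvProj k a S ≫ k = coinvProj k a S ≫ B.one A := by
  have h3 := comul_coinvProj hk' hk ha ha' h2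
  -- The target is F A with the action lifted along `l`; its unit and associativity laws are the
  -- first two goals. In the last goal, the pentagon treats the left side and `hl.map_one` the
  -- right.
  refine convolution_injective (a := l A ≫ B.map a) hk hk' ?_ ?_ (isHopf_iff.2 ⟨S, n, h1, h2⟩) ?_
  · rw [reassoc_of% hl.one A, ← B.map_comp, ha, B.map_id]
  · rw [reassoc_of% hl.mul A, ← B.map_comp, ha', B.map_comp, B.map_comp, Category.assoc,
      reassoc_of% hl.naturality a]
  · rw [B.map_comp, Category.assoc, ← p, reassoc_of% h3, B.map_comp, Category.assoc,
      reassoc_of% hl.map_one A, reassoc_of% B.comul_naturality (coinvProj k a S),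
      reassoc_of% hk', ← B.map_comp, ← B.map_comp, h3, B.map_id, Category.comp_id]

/-- If y is coinvariant, the coaction of y a is y a₁ ⊗ a₂, so acting on coinvariants is a comodule
map from the cofree comodule. -/
lemma map_comp_action_coaction {l : ∀ X, B.obj (B.obj X) ⟶ B.obj (B.obj X)}
    (hl : B.IsMixedLaw l) (p : a ≫ k = B.map k ≫ l A ≫ B.map a) {X : C} {i : X ⟶ A}
    (hi : i ≫ k = i ≫ B.one A) :
    B.map i ≫ a ≫ k = B.comul X ≫ B.map (B.map i ≫ a) := by
  rw [p, ← B.map_comp_assoc, hi, B.map_comp_assoc, reassoc_of% hl.map_one A,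
    reassoc_of% B.comul_naturality i, B.map_comp]

/-- On y a with y coinvariant the projection is y a₁ S(a₂) = ε(a) y. -/
lemma map_comp_action_coinvProj {l : ∀ X, B.obj (B.obj X) ⟶ B.obj (B.obj X)}
    (hl : B.IsMixedLaw l) (ha : B.one A ≫ a = 𝟙 A) (ha' : B.mul A ≫ a = B.map a ≫ a)
    (p : a ≫ k = B.map k ≫ l A ≫ B.map a)
    (n : ∀ {X Y : C} (f : X ⟶ Y), B.map f ≫ S Y = S X ≫ B.map f)
    (h1 : ∀ X, B.comul X ≫ S (B.obj X) ≫ B.mul X = B.counit X ≫ B.one X)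
    {X : C} {i : X ⟶ A} (hi : i ≫ k = i ≫ B.one A) :
    B.map i ≫ a ≫ coinvProj k a S = B.counit X ≫ i := by
  rw [coinvProj, reassoc_of% map_comp_action_coaction hl p hi, reassoc_of% n (B.map i ≫ a),
    B.map_comp, Category.assoc, ← ha', reassoc_of% B.mul_naturality i, reassoc_of% h1 X,
    ← reassoc_of% B.one_naturality i, ha, Category.comp_id]

end Retract

/-! ### The comparison functor to mixed bimodules -/

section Equivalence

variable {lam : B.toFunctor ⋙ B.toFunctor ⟶ B.toFunctor ⋙ B.toFunctor}
  {hlam : ∀ X, B.μ.app X ≫ B.d.app X =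
      B.map (B.d.app X) ≫ lam.app (B.obj X) ≫ B.map (B.μ.app X)}

instance : (B.toMixed lam hlam).Faithful where
  map_injective {X Y f g} h := by
    have h : B.map f = B.map g := congrArg MixedBimodule.Hom.f h
    rw [← Category.comp_id f, ← Category.comp_id g, ← one_counit, reassoc_of% B.one_naturality f,
      reassoc_of% B.one_naturality g, h]

/-- The coinvariants of F Y are Y: if Δ(u) = u ⊗ 1, applying ε to the first factor shows that u =
ε(u) 1. -/
lemma comp_counit_one {X Y : C} {u : X ⟶ B.obj Y} (h : u ≫ B.comul Y = u ≫ B.one (B.obj Y)) :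
    u ≫ B.counit Y ≫ B.one Y = u := by
  rw [one_naturality, ← reassoc_of% h, comul_map_counit, Category.comp_id]

/-- The unit of F X is coinvariant, and comodule maps preserve coinvariants. -/
lemma one_comp_coinvariant {X : C} {Z : C} {k : Z ⟶ B.obj Z} {φ : B.obj X ⟶ Z}
    (h : B.comul X ≫ B.map φ = φ ≫ k) :
    (B.one X ≫ φ) ≫ k = (B.one X ≫ φ) ≫ B.one Z := by
  rw [Category.assoc, ← h, reassoc_of% B.one_comul X, ← B.one_naturality φ, Category.assoc]

/-- By linearity f is determined by its restriction along the unit X → F X. By colinearity this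
restriction lands in the coinvariants of F Y, which is Y, so f comes from a morphism X → Y. -/
lemma map_one_comp_counit {X Y : C} {f : B.obj X ⟶ B.obj Y}
    (h : B.map f ≫ B.mul Y = B.mul X ≫ f) (h' : B.comul X ≫ B.map f = f ≫ B.comul Y) :
    B.map (B.one X ≫ f ≫ B.counit Y) = f := by
  have h3 := comp_counit_one (one_comp_coinvariant h')
  have h4 : B.map (B.one X ≫ f ≫ B.counit Y) ≫ B.map (B.one Y) ≫ B.mul Y =
      B.map (B.one X ≫ f) ≫ B.mul Y := by
    rw [← B.map_comp_assoc, Category.assoc, Category.assoc, ← Category.assoc (B.one X), h3]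
  rw [map_one_mul, Category.comp_id] at h4
  rw [h4, B.map_comp, Category.assoc, h, reassoc_of% B.map_one_mul X]

instance : (B.toMixed lam hlam).Full where
  map_surjective φ := ⟨_, MixedBimodule.Hom.ext (map_one_comp_counit φ.h φ.k)⟩

/-- The fundamental theorem of Hopf modules. Idempotent completeness replaces the equalizer defining
the coinvariants: these are the image of x ↦ x₀ S(x₁). The isomorphism is y ⊗ a ↦ y a with inverse x
↦ x₀ S(x₁) ⊗ x₂. -/
theorem toMixed_essSurj_of_isHopf [IsIdempotentComplete C] (hl : B.IsMixedLaw lam.app)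
    (h : B.IsHopf) : (B.toMixed lam hlam).EssSurj where
  mem_essImage M := by
    obtain ⟨S, n, h1, h2⟩ := isHopf_iff.1 h
    let k : M.A ⟶ B.obj M.A := M.k
    let a : B.obj M.A ⟶ M.A := M.a
    have ha : B.one M.A ≫ a = 𝟙 M.A := M.unit
    have ha' : B.mul M.A ≫ a = B.map a ≫ a := M.assoc
    have hk : k ≫ B.counit M.A = 𝟙 M.A := M.k_counit
    have hk' : k ≫ B.comul M.A = k ≫ B.map k := M.k_coassoc
    have p : a ≫ k = B.map k ≫ lam.app M.A ≫ B.map a := M.pentagon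
    have e1 : coinvProj k a S ≫ k = coinvProj k a S ≫ B.one M.A :=
      coinvProj_coaction hl hk hk' ha ha' p n h1 h2
    have e2 := comul_coinvProj hk' hk ha ha' h2
    -- The projection E has coinvariant values, so E(E x) = E(x) S(1) = E(x).
    have e3 : coinvProj k a S ≫ coinvProj k a S = coinvProj k a S := by
      nth_rewrite 2 [coinvProj]
      rw [reassoc_of% e1, reassoc_of% one_antipode n h1 M.A, ha, Category.comp_id]
    obtain ⟨X, i, q, hi, hq⟩ := IsIdempotentComplete.idempotents_split _ _ e3
    -- Since i is unchanged by composition with the projection, coinvariance of the projection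
    -- passes to i.
    have hik : i ≫ k = i ≫ B.one M.A := by
      have := i ≫= e1
      rwa [← hq, Category.assoc, Category.assoc, reassoc_of% hi, reassoc_of% hi] at this
    have e4 := map_comp_action_coaction hl p hik
    have e5 : B.map i ≫ a ≫ coinvProj k a S = B.counit X ≫ i :=
      map_comp_action_coinvProj hl ha ha' p n h1 hik
    let φ : (B.toMixed lam hlam).obj X ⟶ M := ⟨B.map i ≫ a, by
        change B.map (B.map i ≫ a) ≫ a = B.mul X ≫ B.map i ≫ a
        rw [B.map_comp, Category.assoc, ← ha', reassoc_of% B.mul_naturality i], by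
        change B.comul X ≫ B.map (B.map i ≫ a) = (B.map i ≫ a) ≫ k
        rw [Category.assoc, e4]⟩
    have : IsIso φ.f := by
      refine ⟨k ≫ B.map q, ?_, ?_⟩
      · change (B.map i ≫ a) ≫ k ≫ B.map q = 𝟙 (B.obj X)
        -- The identity `e5` holds after composition with i, which is a split monomorphism.
        have e6 : (B.map i ≫ a) ≫ q = B.counit X := by
          have := mono_of_mono_fac hi
          rw [← cancel_mono i, Category.assoc, Category.assoc, hq, e5]
        rw [Category.assoc, reassoc_of% e4, ← B.map_comp, e6, comul_map_counit]
      · change (k ≫ B.map q) ≫ B.map i ≫ a = 𝟙 M.A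
        rw [Category.assoc, ← B.map_comp_assoc, hq, e2]
    exact ⟨X, ⟨MixedBimodule.isoOfIsIso φ⟩⟩

/-- The mixed bimodule `F F X`, with the `F`-module structure lifted along `lam`. -/
def inducedMixed (hl : B.IsMixedLaw lam.app) (X : C) :
    MixedBimodule B.toMonad B.comonad lam where
  A := B.obj (B.obj X)
  a := lam.app (B.obj X) ≫ B.map (B.mul X)
  unit := by
    change B.one (B.obj (B.obj X)) ≫ lam.app (B.obj X) ≫ B.map (B.mul X) = 𝟙 _
    rw [reassoc_of% hl.one (B.obj X), ← B.map_comp, B.one_mul, B.map_id]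
  assoc := by
    change B.mul (B.obj (B.obj X)) ≫ lam.app (B.obj X) ≫ B.map (B.mul X) =
      B.map (lam.app (B.obj X) ≫ B.map (B.mul X)) ≫ lam.app (B.obj X) ≫ B.map (B.mul X)
    rw [reassoc_of% hl.mul (B.obj X), ← B.map_comp, ← map_mul_mul, B.map_comp, B.map_comp,
      Category.assoc, reassoc_of% hl.naturality (B.mul X)]
  k := B.comul (B.obj X)
  k_counit := B.left_counit (B.obj X)
  k_coassoc := (B.coassoc (B.obj X)).symm
  pentagon := by
    change (lam.app (B.obj X) ≫ B.map (B.mul X)) ≫ B.comul (B.obj X) =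
      B.map (B.comul (B.obj X)) ≫ lam.app (B.obj (B.obj X)) ≫
        B.map (lam.app (B.obj X) ≫ B.map (B.mul X))
    rw [Category.assoc, comul_naturality, reassoc_of% hl.comul (B.obj X), B.map_comp]

/-- Both sides are cofree comodules, with coinvariants Y and F X, so f restricts to an isomorphism Y
≅ F X. A linear map is determined by this restriction: f is its image under F followed by the action
on the coinvariants F X of F F X. That action is `cofus`. -/
lemma isIso_cofus_of_iso {X Y : C} {l : B.obj (B.obj (B.obj X)) ⟶ B.obj (B.obj (B.obj X))}
    (hl : B.map (B.one (B.obj X)) ≫ l = B.comul (B.obj X))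
    {f : B.obj Y ⟶ B.obj (B.obj X)} {g : B.obj (B.obj X) ⟶ B.obj Y}
    (hfg : f ≫ g = 𝟙 _) (hgf : g ≫ f = 𝟙 _)
    (hf : B.map f ≫ l ≫ B.map (B.mul X) = B.mul Y ≫ f)
    (hf' : B.comul Y ≫ B.map f = f ≫ B.comul (B.obj X))
    (hg' : B.comul (B.obj X) ≫ B.map g = g ≫ B.comul Y) : IsIso (B.cofus X) := by
  -- The restrictions of f and g along the units are coinvariant and hence come from morphisms Y → F
  -- X and F X → Y.
  have h1 := comp_counit_one (one_comp_coinvariant hf')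
  have h2 := comp_counit_one (one_comp_coinvariant hg')
  rw [Category.assoc] at h1 h2
  have h3 : f = B.map (B.one Y ≫ f ≫ B.counit (B.obj X)) ≫ B.cofus X := by
    rw [cofus, ← hl, Category.assoc, ← B.map_comp_assoc, Category.assoc, Category.assoc, h1,
      B.map_comp, Category.assoc, hf, reassoc_of% B.map_one_mul Y]
  -- The restrictions of f and g are mutually inverse, since `h1` and `h2` let the intermediate
  -- counit and unit cancel.
  have : IsIso (B.one Y ≫ f ≫ B.counit (B.obj X)) := by
    refine ⟨B.one (B.obj X) ≫ g ≫ B.counit Y, ?_, ?_⟩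
    · simp only [Category.assoc]
      rw [reassoc_of% h1, reassoc_of% hfg, one_counit]
    · simp only [Category.assoc]
      rw [reassoc_of% h2, reassoc_of% hgf, one_counit]
  have : IsIso f := ⟨g, hfg, hgf⟩
  rw [← IsIso.inv_comp_eq] at h3
  rw [← h3]
  infer_instance

/-- It suffices that the Hopf modules F F X with cofree coaction and action lifted along `lam` lie
in the essential image. -/
theorem isIso_cofus_of_essSurj (hl : B.IsMixedLaw lam.app) [(B.toMixed lam hlam).EssSurj] (X : C) :
    IsIso (B.cofus X) := by
  let φ := (B.toMixed lam hlam).objObjPreimageIso (inducedMixed hl X)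
  exact isIso_cofus_of_iso (hl.map_one (B.obj X))
    (congrArg MixedBimodule.Hom.f φ.hom_inv_id) (congrArg MixedBimodule.Hom.f φ.inv_hom_id)
    φ.hom.h φ.hom.k φ.inv.k

theorem toMixed_isEquivalence_iff [IsIdempotentComplete C] (hl : B.IsMixedLaw lam.app) :
    (B.toMixed lam hlam).IsEquivalence ↔ B.IsHopf := by
  refine ⟨fun _ ↦ isHopf_iff_isIso_cofus.2 (isIso_cofus_of_essSurj (hlam := hlam) hl), fun h ↦ ?_⟩
  have := toMixed_essSurj_of_isHopf (hlam := hlam) hl h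
  exact { }

end Equivalence

end TauBimonad

/-! ### Canonical maps of a bialgebra -/

section Bialgebra

variable (R H : Type u) [CommRing R] [Ring H] [Bialgebra R H]

/-- The map `a ⊗ b ↦ a b₁ ⊗ b₂`. -/
def cogaloisMap : H ⊗[R] H →ₗ[R] H ⊗[R] H :=
  (LinearMap.mul' R H).rTensor H ∘ₗ (TensorProduct.assoc R H H H).symm.toLinearMap ∘ₗ
    (Coalgebra.comul (R := R) (A := H)).lTensor H

variable {R H}

/-- In this and the next three formulas the map is a product in the algebra H ⊗ H. Multiplicativity
of Δ then applies directly, and coproducts need only be expanded where a factor is separated. -/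
lemma galoisMap_tmul (a b : H) :
    galoisMap R H (a ⊗ₜ b) = Coalgebra.comul (R := R) a * (1 ⊗ₜ b) := by
  rw [galoisMap, LinearMap.comp_apply, LinearMap.comp_apply, LinearMap.rTensor_tmul]
  induction Coalgebra.comul (R := R) a with
  | zero => simp
  | tmul p q => simp
  | add p q hp hq => simp only [TensorProduct.add_tmul, map_add, add_mul, hp, hq]

lemma cogaloisMap_tmul (a b : H) :
    cogaloisMap R H (a ⊗ₜ b) = (a ⊗ₜ 1) * Coalgebra.comul (R := R) b := by
  rw [cogaloisMap, LinearMap.comp_apply, LinearMap.comp_apply, LinearMap.lTensor_tmul]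
  induction Coalgebra.comul (R := R) b with
  | zero => simp
  | tmul p q => simp
  | add p q hp hq => simp only [TensorProduct.tmul_add, map_add, mul_add, hp, hq]

lemma psiR_tmul (a b : H) :
    psiR R H (a ⊗ₜ b) = (1 ⊗ₜ a) * Coalgebra.comul (R := R) b := by
  rw [psiR, LinearMap.comp_apply, LinearMap.comp_apply, LinearMap.lTensor_tmul]
  induction Coalgebra.comul (R := R) b with
  | zero => simp
  | tmul p q => simp
  | add p q hp hq => simp only [TensorProduct.tmul_add, map_add, mul_add, hp, hq]

lemma psiL_tmul (a b : H) :
    psiL R H (a ⊗ₜ b) = Coalgebra.comul (R := R) a * (b ⊗ₜ 1) := by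
  rw [psiL, LinearMap.comp_apply, LinearMap.comp_apply, LinearMap.rTensor_tmul]
  induction Coalgebra.comul (R := R) a with
  | zero => simp
  | tmul p q => simp
  | add p q hp hq => simp only [TensorProduct.add_tmul, map_add, add_mul, hp, hq]

/-! ### The functor `- ⊗ H`: antipodes and canonical maps -/

section Tensor

lemma tensorEndo_bijective_of_bijective {φ : H ⊗[R] H →ₗ[R] H ⊗[R] H}
    (h : Function.Bijective φ) (X : Type u) [AddCommGroup X] [Module R X] :
    Function.Bijective (tensorEndo X φ) :=
  ((TensorProduct.assoc R X H H).trans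
    (((LinearEquiv.ofBijective φ h).lTensor X).trans (TensorProduct.assoc R X H H).symm)).bijective

/-- The component at R is φ up to the identification R ⊗ H ⊗ H ≅ H ⊗ H. -/
lemma bijective_of_tensorEndo_bijective {φ : H ⊗[R] H →ₗ[R] H ⊗[R] H}
    (h : Function.Bijective (tensorEndo R φ)) : Function.Bijective φ := by
  let e : (R ⊗[R] H) ⊗[R] H ≃ₗ[R] H ⊗[R] H :=
    (TensorProduct.assoc R R H H).trans (TensorProduct.lid R (H ⊗[R] H))
  have h1 : φ ∘ₗ e.toLinearMap = e.toLinearMap ∘ₗ tensorEndo R φ := by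
    refine TensorProduct.ext_threefold fun x a b ↦ ?_
    rw [LinearMap.comp_apply, LinearMap.comp_apply, tensorEndo_apply]
    simp [e]
  have h2 : φ ∘ e = e ∘ tensorEndo R φ := funext (LinearMap.congr_fun h1)
  rw [← Function.Bijective.of_comp_iff φ e.bijective, h2]
  exact e.bijective.comp h

lemma tensorBimonad_fus (X : ModuleCat.{u} R) :
    (tensorBimonad R H).fus X = ModuleCat.ofHom (tensorEndo X (galoisMap R H)) := by
  refine ModuleCat.hom_ext (TensorProduct.ext_threefold fun x a b ↦ ?_)
  change tensorMul R H (X ⊗[R] H) ((tensorComul R H X).rTensor H ((x ⊗ₜ a) ⊗ₜ b)) =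
    tensorEndo X (galoisMap R H) ((x ⊗ₜ a) ⊗ₜ b)
  rw [tensorEndo_apply, galoisMap_tmul, LinearMap.rTensor_tmul, tensorComul_apply]
  induction Coalgebra.comul (R := R) a with
  | zero => simp
  | tmul p q => simp [tensorMul_apply]
  | add p q hp hq =>
    simp only [TensorProduct.add_tmul, TensorProduct.tmul_add, map_add, add_mul, hp, hq]

lemma tensorBimonad_cofus (X : ModuleCat.{u} R) :
    (tensorBimonad R H).cofus X = ModuleCat.ofHom (tensorEndo X (cogaloisMap R H)) := by
  refine ModuleCat.hom_ext (TensorProduct.ext_threefold fun x a b ↦ ?_)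
  change (tensorMul R H X).rTensor H (tensorComul R H (X ⊗[R] H) ((x ⊗ₜ a) ⊗ₜ b)) =
    tensorEndo X (cogaloisMap R H) ((x ⊗ₜ a) ⊗ₜ b)
  rw [tensorEndo_apply, cogaloisMap_tmul, tensorComul_apply]
  induction Coalgebra.comul (R := R) b with
  | zero => simp
  | tmul p q => simp [tensorMul_apply]
  | add p q hp hq => simp only [TensorProduct.tmul_add, map_add, mul_add, hp, hq]

lemma isIso_tensorEndo_iff (φ : H ⊗[R] H →ₗ[R] H ⊗[R] H) :
    (∀ X : ModuleCat.{u} R, IsIso (ModuleCat.ofHom (tensorEndo X φ))) ↔ Function.Bijective φ := by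
  simp only [ConcreteCategory.isIso_iff_bijective]
  exact ⟨fun h ↦ bijective_of_tensorEndo_bijective (h (ModuleCat.of R R)),
    fun h X ↦ tensorEndo_bijective_of_bijective h X⟩

variable (R H)

theorem tensorBimonad_isHopf_iff_galoisMap :
    (tensorBimonad R H).IsHopf ↔ Function.Bijective (galoisMap R H) := by
  rw [TauBimonad.isHopf_iff_isIso_fus, ← isIso_tensorEndo_iff]
  exact forall_congr' fun X ↦ by rw [tensorBimonad_fus]; rfl

theorem tensorBimonad_isHopf_iff_cogaloisMap :
    (tensorBimonad R H).IsHopf ↔ Function.Bijective (cogaloisMap R H) := by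
  rw [TauBimonad.isHopf_iff_isIso_cofus, ← isIso_tensorEndo_iff]
  exact forall_congr' fun X ↦ by rw [tensorBimonad_cofus]; rfl

/-- A natural endomorphism of `- ⊗ H` is `- ⊗ T` for a single linear map T, its component at R.
Under this correspondence each law of the monad antipode at X is x ⊗ - applied to the matching law
for T. -/
theorem tensorBimonad_isHopf_iff_antipode :
    (tensorBimonad R H).IsHopf ↔ ∃ S : H →ₗ[R] H,
      LinearMap.mul' R H ∘ₗ S.lTensor H ∘ₗ Coalgebra.comul =
        Algebra.linearMap R H ∘ₗ Coalgebra.counit ∧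
      LinearMap.mul' R H ∘ₗ S.rTensor H ∘ₗ Coalgebra.comul =
        Algebra.linearMap R H ∘ₗ Coalgebra.counit := by
  have key (X : Type u) [AddCommGroup X] [Module R X] (T : H →ₗ[R] H) (x : X) (a : H) :
      tensorMul R H X (T.lTensor (X ⊗[R] H) (tensorComul R H X (x ⊗ₜ a))) =
        x ⊗ₜ (LinearMap.mul' R H (T.lTensor H (Coalgebra.comul (R := R) a))) := by
    rw [tensorComul_apply]
    induction Coalgebra.comul (R := R) a with
    | zero => simp
    | tmul p q => simp [tensorMul_apply]
    | add p q hp hq => simp only [TensorProduct.tmul_add, map_add, hp, hq]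
  have key' (X : Type u) [AddCommGroup X] [Module R X] (T : H →ₗ[R] H) (x : X) (a : H) :
      tensorMul R H X ((T.lTensor X).rTensor H (tensorComul R H X (x ⊗ₜ a))) =
        x ⊗ₜ (LinearMap.mul' R H (T.rTensor H (Coalgebra.comul (R := R) a))) := by
    rw [tensorComul_apply]
    induction Coalgebra.comul (R := R) a with
    | zero => simp
    | tmul p q => simp [tensorMul_apply]
    | add p q hp hq => simp only [TensorProduct.tmul_add, map_add, hp, hq]
  have key'' (X : Type u) [AddCommGroup X] [Module R X] (x : X) (a : H) :
      tensorUnit R H X (tensorCounit R H X (x ⊗ₜ a)) =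
        x ⊗ₜ (Algebra.linearMap R H (Coalgebra.counit (R := R) a)) := by
    rw [tensorCounit_apply, tensorUnit_apply, Algebra.linearMap_apply,
      Algebra.algebraMap_eq_smul_one, TensorProduct.smul_tmul]
  constructor
  · rintro ⟨S, h1, h2⟩
    let s (X : ModuleCat.{u} R) : X ⊗[R] H →ₗ[R] X ⊗[R] H := (S.app X).hom
    let T : H →ₗ[R] H := (TensorProduct.lid R H).toLinearMap ∘ₗ
      s (ModuleCat.of R R) ∘ₗ (TensorProduct.lid R H).symm.toLinearMap
    -- Naturality along the map R → X, 1 ↦ x, transports the component at R to the elements x ⊗ a.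
    have hT (X : ModuleCat.{u} R) : s X = T.lTensor X := by
      refine TensorProduct.ext' fun x a ↦ ?_
      have h3 : s X ((LinearMap.toSpanSingleton R X x).rTensor H (1 ⊗ₜ a)) =
          (LinearMap.toSpanSingleton R X x).rTensor H (s (ModuleCat.of R R) (1 ⊗ₜ a)) :=
        congrArg (fun f ↦ f.hom ((1 : R) ⊗ₜ[R] a))
          (S.naturality (ModuleCat.ofHom (LinearMap.toSpanSingleton R X x)))
      rw [LinearMap.rTensor_tmul, LinearMap.toSpanSingleton_apply, one_smul] at h3
      rw [h3, LinearMap.lTensor_tmul]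
      change _ = x ⊗ₜ TensorProduct.lid R H (s (ModuleCat.of R R) ((TensorProduct.lid R H).symm a))
      rw [TensorProduct.lid_symm_apply]
      induction s (ModuleCat.of R R) (1 ⊗ₜ a) using TensorProduct.induction_on with
      | zero => simp
      | tmul r b =>
        rw [LinearMap.rTensor_tmul, LinearMap.toSpanSingleton_apply, TensorProduct.smul_tmul]
        rfl
      | add p q hp hq => rw [map_add, map_add, hp, hq, TensorProduct.tmul_add]
    refine ⟨T, LinearMap.ext fun a ↦ ?_, LinearMap.ext fun a ↦ ?_⟩
    · have h3 : tensorMul R H R (s (ModuleCat.of R (R ⊗[R] H)) (tensorComul R H R (1 ⊗ₜ a))) =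
          tensorUnit R H R (tensorCounit R H R (1 ⊗ₜ a)) :=
        congrArg (fun f ↦ f.hom ((1 : R) ⊗ₜ[R] a)) (h1 (ModuleCat.of R R))
      rw [hT, key''] at h3
      exact (TensorProduct.lid R H).symm.injective ((key R T 1 a).symm.trans h3)
    · have h3 : tensorMul R H R ((s (ModuleCat.of R R)).rTensor H (tensorComul R H R (1 ⊗ₜ a))) =
          tensorUnit R H R (tensorCounit R H R (1 ⊗ₜ a)) :=
        congrArg (fun f ↦ f.hom ((1 : R) ⊗ₜ[R] a)) (h2 (ModuleCat.of R R))
      rw [hT, key''] at h3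
      exact (TensorProduct.lid R H).symm.injective ((key' R T 1 a).symm.trans h3)
  · rintro ⟨T, h1, h2⟩
    refine ⟨⟨fun X ↦ ModuleCat.ofHom (T.lTensor X), fun X Y f ↦ ModuleCat.hom_ext ?_⟩,
      fun X ↦ ModuleCat.hom_ext (TensorProduct.ext' fun x a ↦ ?_),
      fun X ↦ ModuleCat.hom_ext (TensorProduct.ext' fun x a ↦ ?_)⟩
    · exact TensorProduct.ext' fun x a ↦ rfl
    · exact (key X T x a).trans ((congrArg (x ⊗ₜ[R] ·) (LinearMap.congr_fun h1 a)).trans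
        (key'' X x a).symm)
    · exact (key' X T x a).trans ((congrArg (x ⊗ₜ[R] ·) (LinearMap.congr_fun h2 a)).trans
        (key'' X x a).symm)

end Tensor

/-! ### The functor `[H, -]`: the Yoneda argument -/

section Hom

lemma homEndo_bijective_of_bijective {φ : H ⊗[R] H →ₗ[R] H ⊗[R] H}
    (h : Function.Bijective φ) (X : Type u) [AddCommGroup X] [Module R X] :
    Function.Bijective (homEndo X φ) :=
  ((TensorProduct.lift.equiv (RingHom.id R) H H X).trans
    (((LinearEquiv.ofBijective φ h).congrLeft X R).symm.trans
      (TensorProduct.lift.equiv (RingHom.id R) H H X).symm)).bijective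

/-- After uncurrying, precomposition with φ is bijective on maps into every module, so φ is
invertible by Yoneda. -/
lemma bijective_of_homEndo_bijective {φ : H ⊗[R] H →ₗ[R] H ⊗[R] H}
    (h : ∀ (X : Type u) [AddCommGroup X] [Module R X], Function.Bijective (homEndo X φ)) :
    Function.Bijective φ := by
  have h1 (X : Type u) [AddCommGroup X] [Module R X] :
      Function.Bijective fun f : H ⊗[R] H →ₗ[R] X ↦ f ∘ₗ φ := by
    let e := TensorProduct.lift.equiv (RingHom.id R) H H X
    have h2 : (fun f : H ⊗[R] H →ₗ[R] X ↦ f ∘ₗ φ) = e ∘ homEndo X φ ∘ e.symm := by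
      ext f : 1
      simp [homEndo, e]
      rfl
    rw [h2]
    exact e.bijective.comp ((h X).comp e.symm.bijective)
  -- Surjectivity at X = H ⊗ H gives ψ with ψ φ = 1. Since (φ ψ) φ = φ, injectivity at the same
  -- module gives φ ψ = 1.
  obtain ⟨ψ, h2⟩ := (h1 (H ⊗[R] H)).2 LinearMap.id
  have h3 : φ ∘ₗ ψ = LinearMap.id := (h1 (H ⊗[R] H)).1 (by
    change (φ ∘ₗ ψ) ∘ₗ φ = LinearMap.id ∘ₗ φ
    rw [LinearMap.comp_assoc]
    exact congrArg (φ ∘ₗ ·) h2)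
  exact Function.bijective_iff_has_inverse.2
    ⟨ψ, LinearMap.congr_fun h2, LinearMap.congr_fun h3⟩

lemma isIso_homEndo_iff (φ : H ⊗[R] H →ₗ[R] H ⊗[R] H) :
    (∀ X : ModuleCat.{u} R, IsIso (ModuleCat.ofHom (homEndo X φ))) ↔ Function.Bijective φ := by
  simp only [ConcreteCategory.isIso_iff_bijective]
  exact ⟨fun h ↦ bijective_of_homEndo_bijective fun X ↦ h (ModuleCat.of R X),
    fun h X ↦ homEndo_bijective_of_bijective h X⟩

/-- Contravariance reverses the order: the coproduct [μ, -] followed by the product [Δ, -] is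
precomposition with Δ in the first factor followed by μ, that is, with γ itself rather than β. -/
lemma homBimonad_fus (X : ModuleCat.{u} R) :
    (homBimonad R H).fus X = ModuleCat.ofHom (homEndo X (galoisMap R H)) := by
  refine ModuleCat.hom_ext (LinearMap.ext fun g ↦ LinearMap.ext₂ fun a b ↦ ?_)
  change homMul R H (H →ₗ[R] X) (homPost (homComul R H X) g) a b = _
  refine Eq.trans ?_ (homEndo_apply (galoisMap R H) g a b).symm
  rw [galoisMap_tmul, homMul_apply]
  induction Coalgebra.comul (R := R) a with
  | zero => simp
  | tmul p q => rw [Algebra.TensorProduct.tmul_mul_tmul, mul_one]; rfl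
  | add p q hp hq => simp only [map_add, LinearMap.add_apply, add_mul, hp, hq]

variable (R H)

theorem homBimonad_isHopf_iff_galoisMap :
    (homBimonad R H).IsHopf ↔ Function.Bijective (galoisMap R H) := by
  rw [TauBimonad.isHopf_iff_isIso_fus, ← isIso_homEndo_iff]
  exact forall_congr' fun X ↦ by rw [homBimonad_fus]; rfl

end Hom

/-! ### The mixed distributive laws given by ψ_r and ψ_l -/

section MixedLaw

/-- With ψ_r(a ⊗ b) = (1 ⊗ a) Δ(b), compatibility with the product is Δ(b c) = Δ(b) Δ(c),
compatibility with the coproduct is coassociativity, and the two unit laws are Δ(1) = 1 ⊗ 1 and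
ψ_r(1 ⊗ b) = Δ(b). -/
theorem tensorPsi_isMixedLaw : (tensorBimonad R H).IsMixedLaw (tensorPsi R H).app where
  naturality f := (tensorPsi R H).naturality f
  mul X := by
    refine ModuleCat.hom_ext (TensorProduct.ext_fourfold fun x a b c ↦ ?_)
    change tensorEndo X (psiR R H) (tensorMul R H (X ⊗[R] H) (((x ⊗ₜ a) ⊗ₜ b) ⊗ₜ c)) =
      (tensorMul R H X).rTensor H (tensorEndo (X ⊗[R] H) (psiR R H)
        ((tensorEndo X (psiR R H)).rTensor H (((x ⊗ₜ a) ⊗ₜ b) ⊗ₜ c)))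
    rw [tensorMul_apply, tensorEndo_apply, psiR_tmul, LinearMap.rTensor_tmul, tensorEndo_apply,
      psiR_tmul, Bialgebra.comul_mul]
    induction Coalgebra.comul (R := R) b with
    | zero => simp
    | add p q hp hq =>
      simp only [TensorProduct.tmul_add, TensorProduct.add_tmul, map_add, mul_add, add_mul, hp, hq]
    | tmul p q =>
      simp only [Algebra.TensorProduct.tmul_mul_tmul, TensorProduct.assoc_symm_tmul,
        tensorEndo_apply, psiR_tmul]
      induction Coalgebra.comul (R := R) c with
      | zero => simp
      | add p q hp hq => simp only [TensorProduct.tmul_add, map_add, mul_add, hp, hq]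
      | tmul r s => simp [tensorMul_apply, mul_assoc]
  one X := by
    refine ModuleCat.hom_ext (TensorProduct.ext' fun x a ↦ ?_)
    change tensorEndo X (psiR R H) (tensorUnit R H (X ⊗[R] H) (x ⊗ₜ a)) =
      (tensorUnit R H X).rTensor H (x ⊗ₜ a)
    rw [tensorUnit_apply, tensorEndo_apply, psiR_tmul, Bialgebra.comul_one, mul_one,
      LinearMap.rTensor_tmul, tensorUnit_apply, TensorProduct.assoc_symm_tmul]
  map_one X := by
    refine ModuleCat.hom_ext (TensorProduct.ext' fun x a ↦ ?_)
    change tensorEndo X (psiR R H) ((tensorUnit R H X).rTensor H (x ⊗ₜ a)) =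
      tensorComul R H X (x ⊗ₜ a)
    rw [LinearMap.rTensor_tmul, tensorUnit_apply, tensorEndo_apply, psiR_tmul,
      ← Algebra.TensorProduct.one_def, _root_.one_mul, tensorComul_apply]
  comul X := by
    refine ModuleCat.hom_ext (TensorProduct.ext_threefold fun x a b ↦ ?_)
    change tensorComul R H (X ⊗[R] H) (tensorEndo X (psiR R H) ((x ⊗ₜ a) ⊗ₜ b)) =
      (tensorEndo X (psiR R H)).rTensor H (tensorEndo (X ⊗[R] H) (psiR R H)
        ((tensorComul R H X).rTensor H ((x ⊗ₜ a) ⊗ₜ b)))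
    -- The pairing of p ⊗ q and r ⊗ (s ⊗ t) into ((x ⊗ r) ⊗ p s) ⊗ q t. Both sides are its value at
    -- Δ(a) and a twofold coproduct of b, so they agree by coassociativity.
    let K : H ⊗[R] H →ₗ[R] H ⊗[R] (H ⊗[R] H) →ₗ[R] ((X ⊗[R] H) ⊗[R] H) ⊗[R] H :=
      (LinearMap.llcomp R _ _ _ ((TensorProduct.assoc R (X ⊗[R] H) H H).symm.toLinearMap ∘ₗ
        (TensorProduct.mk R X H x).rTensor (H ⊗[R] H))) ∘ₗ LinearMap.lTensorHom H ∘ₗ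
        LinearMap.mul R (H ⊗[R] H)
    have hK (p q r s t : H) : K (p ⊗ₜ q) (r ⊗ₜ (s ⊗ₜ t)) =
        ((x ⊗ₜ r) ⊗ₜ (p * s)) ⊗ₜ (q * t) := by simp [K]
    have h1 (z : H ⊗[R] H) : tensorComul R H (X ⊗[R] H)
        ((TensorProduct.assoc R X H H).symm (x ⊗ₜ ((1 ⊗ₜ a) * z))) =
        K (Coalgebra.comul (R := R) a) ((Coalgebra.comul (R := R)).lTensor H z) := by
      induction z with
      | zero => simp
      | add p q hp hq => simp only [TensorProduct.tmul_add, map_add, mul_add, hp, hq]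
      | tmul p q =>
        simp [tensorComul_apply, K]
    have h2 (y : H ⊗[R] H) : (tensorEndo X (psiR R H)).rTensor H
        (tensorEndo (X ⊗[R] H) (psiR R H) ((TensorProduct.assoc R X H H).symm (x ⊗ₜ y) ⊗ₜ b)) =
        K y (TensorProduct.assoc R H H H ((Coalgebra.comul (R := R)).rTensor H
          (Coalgebra.comul (R := R) b))) := by
      induction y with
      | zero => simp
      | add p q hp hq =>
        simp only [TensorProduct.tmul_add, TensorProduct.add_tmul, map_add, LinearMap.add_apply,
          hp, hq]
      | tmul p q =>
        rw [TensorProduct.assoc_symm_tmul, tensorEndo_apply, psiR_tmul]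
        induction Coalgebra.comul (R := R) b with
        | zero => simp
        | add p q hp hq => simp only [TensorProduct.tmul_add, map_add, mul_add, hp, hq]
        | tmul r s =>
          simp only [Algebra.TensorProduct.tmul_mul_tmul, TensorProduct.assoc_symm_tmul,
            LinearMap.rTensor_tmul, tensorEndo_apply, psiR_tmul, _root_.one_mul]
          induction Coalgebra.comul (R := R) r with
          | zero => simp
          | add p q hp hq =>
            simp only [TensorProduct.tmul_add, TensorProduct.add_tmul, map_add, mul_add, hp, hq]
          | tmul r t => simp [hK]
    rw [tensorEndo_apply, psiR_tmul, h1, LinearMap.rTensor_tmul, tensorComul_apply, h2,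
      Coalgebra.coassoc_apply]

lemma lift_homPost_homComul {X : Type u} [AddCommGroup X] [Module R X] (g : H →ₗ[R] H →ₗ[R] X)
    (z : H ⊗[R] H) (b : H) :
    TensorProduct.lift (homPost (homComul R H X) g) z b = TensorProduct.lift g (z * (1 ⊗ₜ b)) := by
  induction z with
  | zero => simp
  | add p q hp hq => simp only [map_add, LinearMap.add_apply, add_mul, hp, hq]
  | tmul p q => rw [Algebra.TensorProduct.tmul_mul_tmul, mul_one]; rfl

/-- The roles are dual to those for ψ_r. The product of [H, -] comes from Δ, so its compatibility
uses coassociativity together with multiplicativity of Δ. The coproduct comes from μ, so its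
compatibility is Δ(a b) = Δ(a) Δ(b). The unit laws come from the counit. -/
theorem homPsi_isMixedLaw : (homBimonad R H).IsMixedLaw (homPsi R H).app where
  naturality f := (homPsi R H).naturality f
  mul X := by
    refine ModuleCat.hom_ext (LinearMap.ext fun (g : H →ₗ[R] H →ₗ[R] H →ₗ[R] X) ↦
      LinearMap.ext₂ fun a b ↦ ?_)
    change homEndo X (psiL R H) (homMul R H (H →ₗ[R] X) g) a b =
      homMul R H X (homEndo (H →ₗ[R] X) (psiL R H) (homPost (homEndo X (psiL R H)) g) a) b
    -- The trilinear map g, uncurried. Both sides are its value at a twofold coproduct of a times b₁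
    -- ⊗ (b₂ ⊗ 1).
    let L : H ⊗[R] (H ⊗[R] H) →ₗ[R] X :=
      TensorProduct.lift ((TensorProduct.lift.equiv (RingHom.id R) H H X).toLinearMap ∘ₗ g)
    have hL (u : H ⊗[R] H) (q : H) :
        L (TensorProduct.assoc R H H H (u ⊗ₜ q)) = TensorProduct.lift g u q := by
      induction u with
      | zero => simp
      | add p q hp hq => simp only [TensorProduct.add_tmul, map_add, LinearMap.add_apply, hp, hq]
      | tmul p r => rfl
    have hA (x y : (H ⊗[R] H) ⊗[R] H) : TensorProduct.assoc R H H H (x * y) =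
        TensorProduct.assoc R H H H x * TensorProduct.assoc R H H H y :=
      map_mul (Algebra.TensorProduct.assoc R R R H H H) x y
    have h1 (z : H ⊗[R] H) : TensorProduct.lift (homMul R H (H →ₗ[R] X) g) (z * (b ⊗ₜ 1)) =
        L (TensorProduct.assoc R H H H ((Coalgebra.comul (R := R)).rTensor H z) *
          TensorProduct.assoc R H H H (Coalgebra.comul (R := R) b ⊗ₜ 1)) := by
      induction z with
      | zero => simp
      | add p q hp hq => simp only [map_add, add_mul, hp, hq]
      | tmul p q =>
        rw [Algebra.TensorProduct.tmul_mul_tmul, LinearMap.rTensor_tmul, ← hA,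
          Algebra.TensorProduct.tmul_mul_tmul, hL, ← Bialgebra.comul_mul]
        rfl
    have h2 (y : H ⊗[R] H) : TensorProduct.lift (homEndo (H →ₗ[R] X) (psiL R H)
          (homPost (homEndo X (psiL R H)) g) a) y =
        L ((Coalgebra.comul (R := R)).lTensor H (Coalgebra.comul (R := R) a) *
          TensorProduct.assoc R H H H (y ⊗ₜ 1)) := by
      induction y with
      | zero => simp
      | add p q hp hq => simp only [TensorProduct.add_tmul, map_add, mul_add, hp, hq]
      | tmul r s =>
        rw [TensorProduct.lift.tmul, homEndo_apply, psiL_tmul, TensorProduct.assoc_tmul]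
        induction Coalgebra.comul (R := R) a with
        | zero => simp
        | add p q hp hq => simp only [map_add, LinearMap.add_apply, add_mul, hp, hq]
        | tmul p q =>
          rw [Algebra.TensorProduct.tmul_mul_tmul, LinearMap.lTensor_tmul,
            Algebra.TensorProduct.tmul_mul_tmul, ← psiL_tmul, mul_one]
          rfl
    rw [homEndo_apply, psiL_tmul, h1, homMul_apply, h2, Coalgebra.coassoc_apply]
  one X := by
    refine ModuleCat.hom_ext (LinearMap.ext fun (g : H →ₗ[R] X) ↦ LinearMap.ext₂ fun a b ↦ ?_)
    change homEndo X (psiL R H) (homUnit R H (H →ₗ[R] X) g) a b = homUnit R H X (g a) b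
    have h (z : H ⊗[R] H) : TensorProduct.lift (homUnit R H (H →ₗ[R] X) g) (z * (b ⊗ₜ 1)) =
        Coalgebra.counit (R := R) b •
          g (TensorProduct.lid R H ((Coalgebra.counit (R := R)).rTensor H z)) := by
      induction z with
      | zero => simp
      | add p q hp hq => simp only [map_add, add_mul, smul_add, hp, hq]
      | tmul p q => simp [homUnit_apply, smul_smul, mul_comm]
    rw [homEndo_apply, psiL_tmul, h, Coalgebra.rTensor_counit_comul, homUnit_apply]
    simp
  map_one X := by
    refine ModuleCat.hom_ext (LinearMap.ext fun (g : H →ₗ[R] X) ↦ LinearMap.ext₂ fun a b ↦ ?_)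
    change homEndo X (psiL R H) (homPost (homUnit R H X) g) a b = g (a * b)
    have h (z : H ⊗[R] H) : TensorProduct.lift (homPost (homUnit R H X) g) (z * (b ⊗ₜ 1)) =
        g (TensorProduct.rid R H ((Coalgebra.counit (R := R)).lTensor H z) * b) := by
      induction z with
      | zero => simp
      | add p q hp hq => simp only [map_add, add_mul, hp, hq]
      | tmul p q => simp [homUnit_apply]
    rw [homEndo_apply, psiL_tmul, h, Coalgebra.lTensor_counit_comul]
    simp
  comul X := by
    refine ModuleCat.hom_ext (LinearMap.ext fun (g : H →ₗ[R] H →ₗ[R] X) ↦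
      LinearMap.ext₂ fun a b ↦ LinearMap.ext fun c ↦ ?_)
    change homEndo X (psiL R H) g (a * b) c = homEndo X (psiL R H)
      (homEndo (H →ₗ[R] X) (psiL R H) (homPost (homComul R H X) g) a) b c
    have h (w : H ⊗[R] H) : TensorProduct.lift (homEndo (H →ₗ[R] X) (psiL R H)
        (homPost (homComul R H X) g) a) w =
        TensorProduct.lift g (Coalgebra.comul (R := R) a * w) := by
      induction w with
      | zero => simp
      | add p q hp hq => simp only [map_add, mul_add, hp, hq]
      | tmul p q =>
        rw [TensorProduct.lift.tmul, homEndo_apply, psiL_tmul, lift_homPost_homComul, mul_assoc,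
          Algebra.TensorProduct.tmul_mul_tmul, mul_one, _root_.one_mul]
    rw [homEndo_apply, psiL_tmul, homEndo_apply, psiL_tmul, h, Bialgebra.comul_mul, mul_assoc]

end MixedLaw

end Bialgebra

/-! ### Unit isomorphisms of relative tensor products -/

namespace RelTensor

variable {R A M N : Type*} [CommRing R] [Ring A] [Algebra R A]
  [AddCommGroup M] [Module R M] [Module Aᵐᵒᵖ M] [IsScalarTower R Aᵐᵒᵖ M]
  [AddCommGroup N] [Module R N] [Module A N] [IsScalarTower R A N]

lemma mk_one_lid (x : RelTensor R A A N) : mk R A 1 (lid R A N x) = x := by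
  induction x using induction with
  | zero => simp
  | tmul a n => rw [lid_mk, ← mk_smul, op_smul_eq_mul, one_mul]
  | add x y hx hy => rw [map_add, map_add, hx, hy]

lemma lid_bijective : Function.Bijective (lid R A N) :=
  Function.bijective_iff_has_inverse.2
    ⟨mk R A 1, mk_one_lid, fun n ↦ by rw [lid_mk, one_smul]⟩

lemma mk_rid_one (x : RelTensor R A M A) : mk R A (rid R A M x) 1 = x := by
  induction x using induction with
  | zero => simp
  | tmul m a => rw [rid_mk, mk_smul, smul_eq_mul, mul_one]
  | add x y hx hy => rw [map_add, map_add, LinearMap.add_apply, hx, hy]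

lemma rid_bijective : Function.Bijective (rid R A M) :=
  Function.bijective_iff_has_inverse.2
    ⟨fun m ↦ mk R A m 1, mk_rid_one, fun m ↦ by rw [rid_mk, op_one, one_smul]⟩

end RelTensor

/-- This applies when T = R: the relations of ⊗_T already hold in ⊗_R. -/
lemma balancedSubmodule_eq_bot {R M N ι : Type*} [CommRing R] [AddCommGroup M] [Module R M]
    [AddCommGroup N] [Module R N] {l : ι → M → M} {r : ι → N → N}
    (h : ∀ i, ∃ c : R, (∀ m, l i m = c • m) ∧ ∀ n, r i n = c • n) :
    balancedSubmodule (R := R) l r = ⊥ := by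
  refine Submodule.span_eq_bot.2 ?_
  rintro _ ⟨i, m, n, rfl⟩
  obtain ⟨c, h1, h2⟩ := h i
  rw [h1, h2, TensorProduct.smul_tmul, sub_self]

/-! ### The map a ⊗ b ↦ a g b and Galois comodules given by a grouplike -/

section Grouplike

variable {R A C : Type u} [CommRing R] [Ring A] [Algebra R A] [AddCommGroup C] [Module R C]
  [Module A C] [Module Aᵐᵒᵖ C] [SMulCommClass A Aᵐᵒᵖ C] [IsScalarTower R A C]
  [IsScalarTower R Aᵐᵒᵖ C]

variable (R A) in
/-- The bilinear map `a ⊗ b ↦ a g b` for an element `g` of a bimodule. -/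
def bimoduleSpan (g : C) : A ⊗[R] A →ₗ[R] C :=
  TensorProduct.lift (LinearMap.mk₂ R (fun a b ↦ op b • a • g)
    (fun a a' b ↦ by rw [add_smul, smul_add])
    (fun r a b ↦ by rw [smul_assoc, smul_comm (op b) r])
    (fun a b b' ↦ by rw [MulOpposite.op_add, add_smul])
    (fun r a b ↦ by rw [op_smul, smul_assoc]))

variable {g : C}

omit [SMulCommClass A Aᵐᵒᵖ C] in
lemma bimoduleSpan_tmul (a b : A) : bimoduleSpan R A g (a ⊗ₜ b) = op b • a • g := rfl

lemma bimoduleSpan_mul_left (a : A) (z : A ⊗[R] A) :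
    bimoduleSpan R A g ((a ⊗ₜ 1) * z) = a • bimoduleSpan R A g z := by
  induction z with
  | zero => simp
  | add p q hp hq => simp only [map_add, mul_add, smul_add, hp, hq]
  | tmul p q =>
    rw [Algebra.TensorProduct.tmul_mul_tmul, one_mul, bimoduleSpan_tmul, bimoduleSpan_tmul,
      mul_smul, ← smul_comm a (op q)]

omit [SMulCommClass A Aᵐᵒᵖ C] in
lemma bimoduleSpan_mul_right (b : A) (z : A ⊗[R] A) :
    bimoduleSpan R A g (z * (1 ⊗ₜ b)) = op b • bimoduleSpan R A g z := by
  induction z with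
  | zero => simp
  | add p q hp hq => simp only [map_add, add_mul, smul_add, hp, hq]
  | tmul p q =>
    rw [Algebra.TensorProduct.tmul_mul_tmul, mul_one, bimoduleSpan_tmul, bimoduleSpan_tmul,
      op_mul, mul_smul]

variable (R A) in
/-- `A ⊗ A` as a bimodule with `a (b ⊗ c) d = a b ⊗ c d`. -/
abbrev OuterBimodule : Type u :=
  AlgBimodule (Algebra.TensorProduct.includeLeft : A →ₐ[R] A ⊗[R] A)
    (Algebra.TensorProduct.includeRight : A →ₐ[R] A ⊗[R] A)

namespace OuterBimodule

lemma smul_of_tmul (a b c : A) : a • (AlgBimodule.of _ _ (b ⊗ₜ c) : OuterBimodule R A) =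
    AlgBimodule.of _ _ ((a * b) ⊗ₜ c) := by
  rw [AlgBimodule.smul_of, Algebra.TensorProduct.includeLeft_apply,
    Algebra.TensorProduct.tmul_mul_tmul, one_mul]

lemma op_smul_of_tmul (a b c : A) : op a • (AlgBimodule.of _ _ (b ⊗ₜ c) : OuterBimodule R A) =
    AlgBimodule.of _ _ (b ⊗ₜ (c * a)) := by
  rw [AlgBimodule.op_smul_of, Algebra.TensorProduct.includeRight_apply,
    Algebra.TensorProduct.tmul_mul_tmul, mul_one, unop_op]

variable (g)

/-- `a ⊗ b ↦ a g b` as a left linear map. -/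
def spanL : OuterBimodule R A →ₗ[A] C where
  toFun z := bimoduleSpan R A g ((AlgBimodule.of _ _).symm z)
  map_add' x y := by rw [map_add, map_add]
  map_smul' a x := bimoduleSpan_mul_left a _

/-- `a ⊗ b ↦ a g b` as a right linear map. -/
def spanR : OuterBimodule R A →ₗ[Aᵐᵒᵖ] C where
  toFun z := bimoduleSpan R A g ((AlgBimodule.of _ _).symm z)
  map_add' x y := by rw [map_add, map_add]
  map_smul' a x := bimoduleSpan_mul_right (unop a) _

end OuterBimodule

/-! ### Galois right comodules -/

section Right

variable (g) (X : Type u) [AddCommGroup X] [Module R X] [Module Aᵐᵒᵖ X] [IsScalarTower R Aᵐᵒᵖ X]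

variable (R A) in
/-- Right linear maps `A → X` correspond to elements of `X`. -/
def rightHomEquiv : X ≃ₗ[R] (A →ₗ[Aᵐᵒᵖ] X) where
  toFun x :=
    { toFun := fun a ↦ op a • x
      map_add' := fun a b ↦ by rw [MulOpposite.op_add, add_smul]
      map_smul' := fun a b ↦ by
        rw [MulOpposite.smul_eq_mul_unop, op_mul, op_unop, mul_smul, RingHom.id_apply] }
  map_add' x y := LinearMap.ext fun a ↦ smul_add _ x y
  map_smul' r x := LinearMap.ext fun a ↦ smul_comm _ r x
  invFun f := f 1
  left_inv x := one_smul _ x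
  right_inv f := LinearMap.ext fun a ↦ by
    change op a • f 1 = f a
    rw [← map_smul, op_smul_eq_mul, one_mul]

/-- The map `x ⊗ a ↦ x ⊗ g a` to `X ⊗_A C`. -/
def rightCan : X ⊗[R] A →ₗ[R] RelTensor R A X C :=
  TensorProduct.lift ((RelTensor.mk R A).compl₂
    (bimoduleSpan R A g ∘ₗ TensorProduct.mk R A A 1))

variable {g X}

omit [SMulCommClass A Aᵐᵒᵖ C] [IsScalarTower R Aᵐᵒᵖ X] in
lemma rightCan_tmul (x : X) (a : A) :
    rightCan g X (x ⊗ₜ[R] a) = RelTensor.mk R A x (op a • g) := by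
  change RelTensor.mk R A x (op a • (1 : A) • g) = _
  rw [one_smul]

lemma lid_rightCan (z : A ⊗[R] A) :
    RelTensor.lid R A C (rightCan g A z) = bimoduleSpan R A g z := by
  induction z with
  | zero => simp
  | add p q hp hq => simp only [map_add, hp, hq]
  | tmul p q => rw [rightCan_tmul, RelTensor.lid_mk, bimoduleSpan_tmul, smul_comm p (op q)]

/-- A bijection a ⊗ b ↦ a g b identifies C with A ⊗ A as a bimodule, so X ⊗_A C is X ⊗ A. The
inverse sends x ⊗ p g q to x p ⊗ q; this is `F`, and `hF'` is its A-balancedness. -/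
lemma bijective_rightCan (h : Function.Bijective (bimoduleSpan R A g)) :
    Function.Bijective (rightCan (R := R) (A := A) g X) := by
  let e := LinearEquiv.ofBijective _ h
  have he (z : A ⊗[R] A) : e.symm (bimoduleSpan R A g z) = z := e.symm_apply_apply z
  let F : X →ₗ[R] A ⊗[R] A →ₗ[R] X ⊗[R] A :=
    LinearMap.rTensorHom A ∘ₗ
      { toFun := fun x ↦ (rightHomEquiv R A X x).restrictScalars R
        map_add' := fun x y ↦ by rw [map_add]; rfl
        map_smul' := fun r x ↦ by rw [map_smul]; rfl }
  have hF (x : X) (p q : A) : F x (p ⊗ₜ q) = (op p • x) ⊗ₜ q := rfl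
  have hF' (a : A) (x : X) (z : A ⊗[R] A) : F (op a • x) z = F x ((a ⊗ₜ 1) * z) := by
    induction z with
    | zero => simp
    | add p q hp hq => simp only [map_add, mul_add, hp, hq]
    | tmul p q =>
      rw [Algebra.TensorProduct.tmul_mul_tmul, hF, hF, one_mul, op_mul, mul_smul]
  let inv : RelTensor R A X C →ₗ[R] X ⊗[R] A :=
    RelTensor.lift (F.compl₂ e.symm.toLinearMap) fun a x c ↦ by
      obtain ⟨z, rfl⟩ := h.2 c
      change F (op a • x) (e.symm _) = F x (e.symm _)
      rw [← bimoduleSpan_mul_left, he, he, hF']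
  have hinv (x : X) (c : C) : inv (RelTensor.mk R A x c) = F x (e.symm c) := rfl
  refine Function.bijective_iff_has_inverse.2 ⟨inv, fun y ↦ ?_, fun y ↦ ?_⟩
  · induction y with
    | zero => simp
    | add p q hp hq => simp only [map_add, hp, hq]
    | tmul x a =>
      have : op a • g = bimoduleSpan R A g (1 ⊗ₜ a) := by rw [bimoduleSpan_tmul, one_smul]
      rw [rightCan_tmul, hinv, this, he, hF, op_one, one_smul]
  · induction y using RelTensor.induction with
    | zero => simp
    | add p q hp hq => simp only [map_add, hp, hq]
    | tmul x c =>
      obtain ⟨z, rfl⟩ := h.2 c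
      rw [hinv, he]
      induction z with
      | zero => simp
      | add p q hp hq => simp only [map_add, hp, hq]
      | tmul p q => rw [hF, rightCan_tmul, RelTensor.mk_smul, bimoduleSpan_tmul, smul_comm p (op q)]

variable [Coring R A C] {hg : Coring.IsGrouplike R A g}
  (hR : ∀ x : A, x • g = op x • g → ∃ r : R, x = algebraMap R A r)

include hR

/-- A right linear t is left multiplication by t(1), and colinearity at 1 reads t(1) g = g t(1). By
`hR` this leaves only scalars from R. -/
lemma RightComodule.exists_eq_smul_of_mem_endos {t : A →ₗ[Aᵐᵒᵖ] A}
    (ht : t ∈ (RightComodule.ofGrouplike hg).endos) : ∃ r : R, t = r • LinearMap.id := by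
  have h (n : A) : RelTensor.mk R A (1 : A) (op (t n) • g) =
      RelTensor.mk R A (t 1) (op n • g) := ht n
  have h1 := congrArg (RelTensor.lid R A C) (h 1)
  rw [RelTensor.lid_mk, RelTensor.lid_mk, op_one, one_smul, one_smul] at h1
  obtain ⟨r, hr⟩ := hR _ h1.symm
  refine ⟨r, LinearMap.ext fun a ↦ ?_⟩
  rw [LinearMap.smul_apply, LinearMap.id_apply, Algebra.smul_def, ← hr, ← op_smul_eq_mul,
    ← map_smul, op_smul_eq_mul, one_mul]

/-- With Hom_A(A, X) = X and T acting by scalars, the source of the canonical map is X ⊗_R A. -/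
lemma RightComodule.bijective_can_iff :
    Function.Bijective ((RightComodule.ofGrouplike hg).can X) ↔
      Function.Bijective (rightCan (R := R) (A := A) g X) := by
  have h : balancedSubmodule (R := R)
      (fun (t : (RightComodule.ofGrouplike hg).endos) (f : A →ₗ[Aᵐᵒᵖ] X) ↦ f ∘ₗ t.1)
      (fun (t : (RightComodule.ofGrouplike hg).endos) (n : A) ↦ t.1 n) = ⊥ := by
    refine balancedSubmodule_eq_bot fun t ↦ ?_
    obtain ⟨r, hr⟩ := RightComodule.exists_eq_smul_of_mem_endos hR t.2
    exact ⟨r, fun f ↦ by rw [hr]; ext; simp [LinearMap.map_smul_of_tower],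
      fun n ↦ by rw [hr]; rfl⟩
  let e : X ⊗[R] A ≃ₗ[R] (RightComodule.ofGrouplike hg).homTensor X :=
    ((rightHomEquiv R A X).rTensor A).trans (Submodule.quotEquivOfEqBot _ h).symm
  have he : (RightComodule.ofGrouplike hg).can X ∘ₗ e.toLinearMap = rightCan g X := by
    refine TensorProduct.ext' fun x a ↦ ?_
    rw [rightCan_tmul]
    change RelTensor.mk R A (op (1 : A) • x) (op a • g) = _
    rw [op_one, one_smul]
  rw [← he]
  exact (Function.Bijective.of_comp_iff _ e.bijective).symm

/-- The component at X = A, followed by A ⊗_A C ≅ C, is already a ⊗ b ↦ a g b; the other components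
follow from this one. -/
theorem RightComodule.isGalois_ofGrouplike_iff :
    (RightComodule.ofGrouplike hg).IsGalois ↔ Function.Bijective (bimoduleSpan R A g) := by
  refine ⟨fun h ↦ ?_, fun h X _ _ _ _ ↦ (RightComodule.bijective_can_iff hR).2
    (bijective_rightCan h)⟩
  have := RelTensor.lid_bijective.comp ((RightComodule.bijective_can_iff hR).1 (h A))
  rwa [show RelTensor.lid R A C ∘ rightCan (R := R) (A := A) g A = bimoduleSpan R A g from
    funext lid_rightCan] at this

end Right

/-! ### Galois left comodules -/

section Left

variable (g) (X : Type u) [AddCommGroup X] [Module R X] [Module A X] [IsScalarTower R A X]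

variable (R A) in
/-- Left linear maps `A → X` correspond to elements of `X`. -/
def leftHomEquiv : X ≃ₗ[R] (A →ₗ[A] X) where
  toFun x := LinearMap.toSpanSingleton A X x
  map_add' x y := LinearMap.ext fun a ↦ smul_add a x y
  map_smul' r x := LinearMap.ext fun a ↦ smul_comm a r x
  invFun f := f 1
  left_inv x := one_smul _ x
  right_inv f := LinearMap.ext fun a ↦ by
    change a • f 1 = f a
    rw [← map_smul, smul_eq_mul, mul_one]

/-- The map `a ⊗ x ↦ a g ⊗ x` to `C ⊗_A X`. -/
def leftCan : A ⊗[R] X →ₗ[R] RelTensor R A C X :=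
  TensorProduct.lift (RelTensor.mk R A ∘ₗ bimoduleSpan R A g ∘ₗ (TensorProduct.mk R A A).flip 1)

variable {g X}

omit [SMulCommClass A Aᵐᵒᵖ C] [IsScalarTower R A X] in
lemma leftCan_tmul (a : A) (x : X) :
    leftCan g X (a ⊗ₜ[R] x) = RelTensor.mk R A (a • g) x := by
  change RelTensor.mk R A (op (1 : A) • a • g) x = _
  rw [op_one, one_smul]

omit [SMulCommClass A Aᵐᵒᵖ C] in
lemma rid_leftCan (z : A ⊗[R] A) :
    RelTensor.rid R A C (leftCan g A z) = bimoduleSpan R A g z := by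
  induction z with
  | zero => simp
  | add p q hp hq => simp only [map_add, hp, hq]
  | tmul p q => rw [leftCan_tmul, RelTensor.rid_mk, bimoduleSpan_tmul]

omit [SMulCommClass A Aᵐᵒᵖ C] in
-- The inverse sends p g q ⊗ x to p ⊗ q x.
lemma bijective_leftCan (h : Function.Bijective (bimoduleSpan R A g)) :
    Function.Bijective (leftCan (R := R) (A := A) g X) := by
  let e := LinearEquiv.ofBijective _ h
  have he (z : A ⊗[R] A) : e.symm (bimoduleSpan R A g z) = z := e.symm_apply_apply z
  let F : X →ₗ[R] A ⊗[R] A →ₗ[R] A ⊗[R] X :=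
    LinearMap.lTensorHom A ∘ₗ
      { toFun := fun x ↦ (leftHomEquiv R A X x).restrictScalars R
        map_add' := fun x y ↦ by rw [map_add]; rfl
        map_smul' := fun r x ↦ by rw [map_smul]; rfl }
  have hF (x : X) (p q : A) : F x (p ⊗ₜ q) = p ⊗ₜ (q • x) := rfl
  have hF' (a : A) (x : X) (z : A ⊗[R] A) : F (a • x) z = F x (z * (1 ⊗ₜ a)) := by
    induction z with
    | zero => simp
    | add p q hp hq => simp only [map_add, add_mul, hp, hq]
    | tmul p q =>
      rw [Algebra.TensorProduct.tmul_mul_tmul, hF, hF, mul_one, mul_smul]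
  let inv : RelTensor R A C X →ₗ[R] A ⊗[R] X :=
    RelTensor.lift (F.flip ∘ₗ e.symm.toLinearMap) fun a c x ↦ by
      obtain ⟨z, rfl⟩ := h.2 c
      change F x (e.symm _) = F (a • x) (e.symm _)
      rw [← bimoduleSpan_mul_right, he, he, hF']
  have hinv (x : X) (c : C) : inv (RelTensor.mk R A c x) = F x (e.symm c) := rfl
  refine Function.bijective_iff_has_inverse.2 ⟨inv, fun y ↦ ?_, fun y ↦ ?_⟩
  · induction y with
    | zero => simp
    | add p q hp hq => simp only [map_add, hp, hq]
    | tmul a x =>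
      have : a • g = bimoduleSpan R A g (a ⊗ₜ 1) := by rw [bimoduleSpan_tmul, op_one, one_smul]
      rw [leftCan_tmul, hinv, this, he, hF, one_smul]
  · induction y using RelTensor.induction with
    | zero => simp
    | add p q hp hq => simp only [map_add, hp, hq]
    | tmul c x =>
      obtain ⟨z, rfl⟩ := h.2 c
      rw [hinv, he]
      induction z with
      | zero => simp
      | add p q hp hq => simp only [map_add, LinearMap.add_apply, hp, hq]
      | tmul p q => rw [hF, leftCan_tmul, ← RelTensor.mk_smul, bimoduleSpan_tmul]

variable [Coring R A C] {hg : Coring.IsGrouplike R A g}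
  (hR : ∀ x : A, x • g = op x • g → ∃ r : R, x = algebraMap R A r)

include hR

/-- Here t is right multiplication by t(1), and colinearity at 1 again makes t(1) commute with g. -/
lemma LeftComodule.exists_eq_smul_of_mem_endos {t : A →ₗ[A] A}
    (ht : t ∈ (LeftComodule.ofGrouplike hg).endos) : ∃ r : R, t = r • LinearMap.id := by
  have h (n : A) : RelTensor.mk R A (t n • g) (1 : A) =
      RelTensor.mk R A (n • g) (t 1) := ht n
  have h1 := congrArg (RelTensor.rid R A C) (h 1)
  rw [RelTensor.rid_mk, RelTensor.rid_mk, op_one, one_smul, one_smul] at h1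
  obtain ⟨r, hr⟩ := hR _ h1
  refine ⟨r, LinearMap.ext fun a ↦ ?_⟩
  rw [LinearMap.smul_apply, LinearMap.id_apply, Algebra.smul_def, Algebra.commutes, ← hr,
    ← smul_eq_mul, ← map_smul, smul_eq_mul, mul_one]

lemma LeftComodule.bijective_can_iff :
    Function.Bijective ((LeftComodule.ofGrouplike hg).can X) ↔
      Function.Bijective (leftCan (R := R) (A := A) g X) := by
  have h : balancedSubmodule (R := R)
      (fun (t : (LeftComodule.ofGrouplike hg).endos) (n : A) ↦ t.1 n)
      (fun (t : (LeftComodule.ofGrouplike hg).endos) (f : A →ₗ[A] X) ↦ f ∘ₗ t.1) = ⊥ := by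
    refine balancedSubmodule_eq_bot fun t ↦ ?_
    obtain ⟨r, hr⟩ := LeftComodule.exists_eq_smul_of_mem_endos hR t.2
    exact ⟨r, fun n ↦ by rw [hr]; rfl,
      fun f ↦ by rw [hr]; ext; simp [LinearMap.map_smul_of_tower]⟩
  let e : A ⊗[R] X ≃ₗ[R] (LeftComodule.ofGrouplike hg).homTensor X :=
    ((leftHomEquiv R A X).lTensor A).trans (Submodule.quotEquivOfEqBot _ h).symm
  have he : (LeftComodule.ofGrouplike hg).can X ∘ₗ e.toLinearMap = leftCan g X := by
    refine TensorProduct.ext' fun a x ↦ ?_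
    rw [leftCan_tmul]
    change RelTensor.mk R A (a • g) ((1 : A) • x) = _
    rw [one_smul]
  rw [← he]
  exact (Function.Bijective.of_comp_iff _ e.bijective).symm

theorem LeftComodule.isGalois_ofGrouplike_iff :
    (LeftComodule.ofGrouplike hg).IsGalois ↔ Function.Bijective (bimoduleSpan R A g) := by
  refine ⟨fun h ↦ ?_, fun h X _ _ _ _ ↦ (LeftComodule.bijective_can_iff hR).2
    (bijective_leftCan h)⟩
  have := RelTensor.rid_bijective.comp ((LeftComodule.bijective_can_iff hR).1 (h A))
  rwa [show RelTensor.rid R A C ∘ leftCan (R := R) (A := A) g A = bimoduleSpan R A g from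
    funext rid_leftCan] at this

end Left

/-! ### Hom-Galois comodules -/

section HomGalois

open OuterBimodule

/-- Evaluation of a right linear map at the elements `a g`. -/
def rightEval (g : C) (Q : Type u) [AddCommGroup Q] [Module R Q] [Module Aᵐᵒᵖ Q]
    [IsScalarTower R Aᵐᵒᵖ Q] (f : C →ₗ[Aᵐᵒᵖ] Q) : A →ₗ[R] Q :=
  f.restrictScalars R ∘ₗ bimoduleSpan R A g ∘ₗ (TensorProduct.mk R A A).flip 1

/-- Evaluation of a left linear map at the elements `g a`. -/
def leftEval (g : C) (Q : Type u) [AddCommGroup Q] [Module R Q] [Module A Q]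
    [IsScalarTower R A Q] (f : C →ₗ[A] Q) : A →ₗ[R] Q :=
  f.restrictScalars R ∘ₗ bimoduleSpan R A g ∘ₗ TensorProduct.mk R A A 1

omit [SMulCommClass A Aᵐᵒᵖ C] in
lemma rightEval_apply {Q : Type u} [AddCommGroup Q] [Module R Q] [Module Aᵐᵒᵖ Q]
    [IsScalarTower R Aᵐᵒᵖ Q] (f : C →ₗ[Aᵐᵒᵖ] Q) (a : A) :
    rightEval (R := R) g Q f a = f (a • g) := by
  change f (op (1 : A) • a • g) = _
  rw [op_one, one_smul]

omit [SMulCommClass A Aᵐᵒᵖ C] in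
lemma leftEval_apply {Q : Type u} [AddCommGroup Q] [Module R Q] [Module A Q]
    [IsScalarTower R A Q] (f : C →ₗ[A] Q) (a : A) :
    leftEval (R := R) g Q f a = f (op a • g) := by
  change f (op a • (1 : A) • g) = _
  rw [one_smul]

omit [SMulCommClass A Aᵐᵒᵖ C] in
-- R-linear maps A → Q are right A-linear maps A ⊗ A → Q. Under this identification evaluation at
-- the elements a g is precomposition with a ⊗ b ↦ a g b, so Yoneda for right A-modules applies.
theorem bijective_rightEval_iff :
    (∀ (Q : Type u) [AddCommGroup Q] [Module R Q] [Module Aᵐᵒᵖ Q] [IsScalarTower R Aᵐᵒᵖ Q],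
      Function.Bijective (rightEval (R := R) (A := A) g Q)) ↔
      Function.Bijective (bimoduleSpan R A g) := by
  constructor
  · intro h
    -- Surjectivity at Q = A ⊗ A, applied to a ↦ a ⊗ 1, gives a left inverse of a ⊗ b ↦ a g b;
    -- injectivity at Q = C then makes it two-sided.
    obtain ⟨f, hf⟩ := (h (OuterBimodule R A)).2
      ((AlgBimodule.of _ _).toLinearMap ∘ₗ (TensorProduct.mk R A A).flip 1)
    have hf' (a : A) : f (a • g) = AlgBimodule.of _ _ (a ⊗ₜ 1) := by
      rw [← rightEval_apply (R := R), hf]; rfl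
    have h1 (z : A ⊗[R] A) : f (bimoduleSpan R A g z) = AlgBimodule.of _ _ z := by
      induction z with
      | zero => simp
      | add p q hp hq => simp only [map_add, hp, hq]
      | tmul p q => rw [bimoduleSpan_tmul, map_smul, hf', op_smul_of_tmul, one_mul]
    have h2 : spanR g ∘ₗ f = LinearMap.id := by
      refine (h C).1 (LinearMap.ext fun a ↦ ?_)
      rw [rightEval_apply, rightEval_apply, LinearMap.comp_apply, hf']
      change op (1 : A) • a • g = a • g
      rw [op_one, one_smul]
    exact ⟨fun x y hxy ↦ (AlgBimodule.of _ _).injective ((h1 x).symm.trans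
      ((congrArg f hxy).trans (h1 y))), fun c ↦ ⟨_, LinearMap.congr_fun h2 c⟩⟩
  · intro h Q _ _ _ _
    let e := LinearEquiv.ofBijective _ h
    have he (z : A ⊗[R] A) : e.symm (bimoduleSpan R A g z) = z := e.symm_apply_apply z
    refine ⟨fun f f' hf ↦ LinearMap.ext fun c ↦ ?_, fun φ ↦ ?_⟩
    · obtain ⟨z, rfl⟩ := h.2 c
      induction z with
      | zero => simp
      | add p q hp hq => simp only [map_add, hp, hq]
      | tmul p q =>
        rw [bimoduleSpan_tmul, f.map_smul, f'.map_smul, ← rightEval_apply (R := R), hf,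
          rightEval_apply]
    -- The right linear extension a ⊗ b ↦ φ(a) b, to be transported to C along the inverse
    -- bijection.
    · let F : A ⊗[R] A →ₗ[R] Q := TensorProduct.lift (LinearMap.mk₂ R (fun a b ↦ op b • φ a)
        (fun a a' b ↦ by rw [map_add, smul_add])
        (fun r a b ↦ by rw [map_smul, smul_comm (op b) r])
        (fun a b b' ↦ by rw [MulOpposite.op_add, add_smul])
        (fun r a b ↦ by rw [op_smul, smul_assoc]))
      have hF (a b : A) : F (a ⊗ₜ b) = op b • φ a := rfl
      have hF' (b : A) (z : A ⊗[R] A) : F (z * (1 ⊗ₜ b)) = op b • F z := by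
        induction z with
        | zero => simp
        | add p q hp hq => simp only [map_add, add_mul, smul_add, hp, hq]
        | tmul p q =>
          rw [Algebra.TensorProduct.tmul_mul_tmul, hF, hF, mul_one, op_mul, mul_smul]
      refine ⟨⟨⟨fun c ↦ F (e.symm c), fun c c' ↦ by rw [map_add, map_add]⟩, fun b c ↦ ?_⟩,
        LinearMap.ext fun a ↦ ?_⟩
      · obtain ⟨z, rfl⟩ := h.2 c
        change F (e.symm (op (unop b) • _)) = b • F (e.symm _)
        rw [← bimoduleSpan_mul_right, he, he, hF', op_unop]
      · change F (e.symm (bimoduleSpan R A g (a ⊗ₜ 1))) = φ a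
        rw [he, hF, op_one, one_smul]

/-- The mirror image: left linear maps out of A ⊗ A are determined by their values on 1 ⊗ a. -/
theorem bijective_leftEval_iff :
    (∀ (Q : Type u) [AddCommGroup Q] [Module R Q] [Module A Q] [IsScalarTower R A Q],
      Function.Bijective (leftEval (R := R) (A := A) g Q)) ↔
      Function.Bijective (bimoduleSpan R A g) := by
  constructor
  · intro h
    obtain ⟨f, hf⟩ := (h (OuterBimodule R A)).2
      ((AlgBimodule.of _ _).toLinearMap ∘ₗ TensorProduct.mk R A A 1)
    have hf' (a : A) : f (op a • g) = AlgBimodule.of _ _ (1 ⊗ₜ a) := by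
      rw [← leftEval_apply (R := R), hf]; rfl
    have h1 (z : A ⊗[R] A) : f (bimoduleSpan R A g z) = AlgBimodule.of _ _ z := by
      induction z with
      | zero => simp
      | add p q hp hq => simp only [map_add, hp, hq]
      | tmul p q =>
        rw [bimoduleSpan_tmul, ← smul_comm p (op q), map_smul, hf', smul_of_tmul, mul_one]
    have h2 : spanL g ∘ₗ f = LinearMap.id := by
      refine (h C).1 (LinearMap.ext fun a ↦ ?_)
      rw [leftEval_apply, leftEval_apply, LinearMap.comp_apply, hf']
      change op a • (1 : A) • g = op a • g
      rw [one_smul]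
    exact ⟨fun x y hxy ↦ (AlgBimodule.of _ _).injective ((h1 x).symm.trans
      ((congrArg f hxy).trans (h1 y))), fun c ↦ ⟨_, LinearMap.congr_fun h2 c⟩⟩
  · intro h Q _ _ _ _
    let e := LinearEquiv.ofBijective _ h
    have he (z : A ⊗[R] A) : e.symm (bimoduleSpan R A g z) = z := e.symm_apply_apply z
    refine ⟨fun f f' hf ↦ LinearMap.ext fun c ↦ ?_, fun φ ↦ ?_⟩
    · obtain ⟨z, rfl⟩ := h.2 c
      induction z with
      | zero => simp
      | add p q hp hq => simp only [map_add, hp, hq]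
      | tmul p q =>
        rw [bimoduleSpan_tmul, ← smul_comm p (op q), f.map_smul, f'.map_smul,
          ← leftEval_apply (R := R), hf, leftEval_apply]
    · let F : A ⊗[R] A →ₗ[R] Q := TensorProduct.lift (LinearMap.mk₂ R (fun a b ↦ a • φ b)
        (fun a a' b ↦ by rw [add_smul])
        (fun r a b ↦ by rw [smul_assoc])
        (fun a b b' ↦ by rw [map_add, smul_add])
        (fun r a b ↦ by rw [map_smul, smul_comm a r]))
      have hF (a b : A) : F (a ⊗ₜ b) = a • φ b := rfl
      have hF' (a : A) (z : A ⊗[R] A) : F ((a ⊗ₜ 1) * z) = a • F z := by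
        induction z with
        | zero => simp
        | add p q hp hq => simp only [map_add, mul_add, smul_add, hp, hq]
        | tmul p q =>
          rw [Algebra.TensorProduct.tmul_mul_tmul, hF, hF, one_mul, mul_smul]
      refine ⟨⟨⟨fun c ↦ F (e.symm c), fun c c' ↦ by rw [map_add, map_add]⟩, fun a c ↦ ?_⟩,
        LinearMap.ext fun a ↦ ?_⟩
      · obtain ⟨z, rfl⟩ := h.2 c
        change F (e.symm (a • _)) = a • F (e.symm _)
        rw [← bimoduleSpan_mul_left, he, he, hF']
      · change F (e.symm (bimoduleSpan R A g (1 ⊗ₜ a))) = φ a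
        rw [he, hF, one_smul]

variable [Coring R A C] {hg : Coring.IsGrouplike R A g}
  (hR : ∀ x : A, x • g = op x • g → ∃ r : R, x = algebraMap R A r)

include hR

/-- Since T consists of scalars, Hom_T is Hom_R, and Q ⊗_A A ≅ Q turns the canonical map into
evaluation at the elements a g. -/
theorem LeftComodule.isHomGalois_ofGrouplike_iff :
    (LeftComodule.ofGrouplike hg).IsHomGalois ↔ Function.Bijective (bimoduleSpan R A g) := by
  rw [← bijective_rightEval_iff]
  refine forall_congr' fun Q ↦ forall_congr' fun _ ↦ forall_congr' fun _ ↦ forall_congr' fun _ ↦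
    forall_congr' fun _ ↦ ?_
  -- Compatibility with a scalar endomorphism is R-linearity.
  have htop : (LeftComodule.ofGrouplike hg).tensorHom Q = ⊤ := by
    refine eq_top_iff.2 fun φ _ t ht n ↦ ?_
    obtain ⟨r, rfl⟩ := LeftComodule.exists_eq_smul_of_mem_endos hR ht
    rw [RelTensor.map_smul_right, LinearMap.smul_apply, LinearMap.id_apply, map_smul]
    generalize φ n = x
    induction x using RelTensor.induction with
    | zero => simp
    | tmul m n => rfl
    | add x y hx hy => simp only [map_add, smul_add, hx, hy]
  let e : (LeftComodule.ofGrouplike hg).tensorHom Q ≃ₗ[R] (A →ₗ[R] Q) :=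
    (LinearEquiv.ofTop _ htop).trans
      (LinearEquiv.congrRight (LinearEquiv.ofBijective _ RelTensor.rid_bijective))
  have he : e ∘ (LeftComodule.ofGrouplike hg).homCan Q = rightEval (R := R) (A := A) g Q := by
    funext f
    refine LinearMap.ext fun a ↦ ?_
    rw [rightEval_apply]
    change op (1 : A) • f (a • g) = _
    rw [op_one, one_smul]
  rw [← he]
  exact (Function.Bijective.of_comp_iff' e.bijective _).symm

theorem RightComodule.isHomGalois_ofGrouplike_iff :
    (RightComodule.ofGrouplike hg).IsHomGalois ↔ Function.Bijective (bimoduleSpan R A g) := by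
  rw [← bijective_leftEval_iff]
  refine forall_congr' fun Q ↦ forall_congr' fun _ ↦ forall_congr' fun _ ↦ forall_congr' fun _ ↦
    forall_congr' fun _ ↦ ?_
  have htop : (RightComodule.ofGrouplike hg).tensorHom Q = ⊤ := by
    refine eq_top_iff.2 fun φ _ t ht n ↦ ?_
    obtain ⟨r, rfl⟩ := RightComodule.exists_eq_smul_of_mem_endos hR ht
    rw [RelTensor.map_smul_left, LinearMap.smul_apply, LinearMap.id_apply, map_smul]
    generalize φ n = x
    induction x using RelTensor.induction with
    | zero => simp
    | tmul m n => rfl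
    | add x y hx hy => simp only [map_add, smul_add, hx, hy]
  let e : (RightComodule.ofGrouplike hg).tensorHom Q ≃ₗ[R] (A →ₗ[R] Q) :=
    (LinearEquiv.ofTop _ htop).trans
      (LinearEquiv.congrRight (LinearEquiv.ofBijective _ RelTensor.lid_bijective))
  have he : e ∘ (RightComodule.ofGrouplike hg).homCan Q = leftEval (R := R) (A := A) g Q := by
    funext f
    refine LinearMap.ext fun a ↦ ?_
    rw [leftEval_apply]
    change (1 : A) • f (op a • g) = _
    rw [one_smul]
  rw [← he]
  exact (Function.Bijective.of_comp_iff' e.bijective _).symm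

end HomGalois

end Grouplike

/-! ### The grouplike 1 ⊗ 1 in the two corings on H ⊗ H -/

section HopfCorings

variable {R H : Type u} [CommRing R] [Ring H] [Bialgebra R H]

/-- Commuting with 1 ⊗ 1 means x ⊗ 1 = Δ(x); applying ε to the first factor gives x = ε(x) 1. -/
lemma HopfR.eq_algebraMap_of_smul_eq (x : H)
    (hx : x • (HopfR.tmul 1 1 : HopfR R H) = op x • HopfR.tmul 1 1) :
    ∃ r : R, x = algebraMap R H r := by
  have h : x ⊗ₜ[R] (1 : H) = Coalgebra.comul x := by
    have h1 : (x ⊗ₜ[R] (1 : H)) * (1 ⊗ₜ 1) = (1 ⊗ₜ 1) * Coalgebra.comul x := hx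
    rwa [← Algebra.TensorProduct.one_def, mul_one, one_mul] at h1
  refine ⟨Coalgebra.counit x, ?_⟩
  have h2 := Coalgebra.rTensor_counit_comul (R := R) x
  rw [← h, LinearMap.rTensor_tmul] at h2
  have h3 := congrArg (TensorProduct.lid R H) h2
  rw [TensorProduct.lid_tmul, TensorProduct.lid_tmul, one_smul] at h3
  rw [Algebra.algebraMap_eq_smul_one, h3]

/-- Now the condition is Δ(x) = 1 ⊗ x, and ε is applied to the second factor. -/
lemma HopfL.eq_algebraMap_of_smul_eq (x : H)
    (hx : x • (HopfL.tmul 1 1 : HopfL R H) = op x • HopfL.tmul 1 1) :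
    ∃ r : R, x = algebraMap R H r := by
  have h : (1 : H) ⊗ₜ[R] x = Coalgebra.comul x := by
    have h1 : Coalgebra.comul x * (1 ⊗ₜ 1) = (1 ⊗ₜ[R] 1) * ((1 : H) ⊗ₜ[R] x) := hx
    rw [← Algebra.TensorProduct.one_def, mul_one, one_mul] at h1
    exact h1.symm
  refine ⟨Coalgebra.counit x, ?_⟩
  have h2 := Coalgebra.lTensor_counit_comul (R := R) x
  rw [← h, LinearMap.lTensor_tmul] at h2
  have h3 := congrArg (TensorProduct.rid R H) h2
  rw [TensorProduct.rid_tmul, TensorProduct.rid_tmul, one_smul] at h3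
  rw [Algebra.algebraMap_eq_smul_one, h3]

/-- In H ⊗ʳ H one has a (1 ⊗ 1) b = a b₁ ⊗ b₂, whereas in H ⊗ˡ H it is a₁ ⊗ a₂ b. This is why the
two corings lead to different canonical maps. -/
lemma HopfR.bijective_bimoduleSpan_iff :
    Function.Bijective (bimoduleSpan R H (HopfR.tmul 1 1 : HopfR R H)) ↔
      Function.Bijective (cogaloisMap R H) := by
  have h : bimoduleSpan R H (HopfR.tmul 1 1 : HopfR R H) =
      (AlgBimodule.of _ _).toLinearMap ∘ₗ cogaloisMap R H := by
    refine TensorProduct.ext' fun a b ↦ ?_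
    rw [LinearMap.comp_apply, cogaloisMap_tmul]
    change (a ⊗ₜ[R] (1 : H)) * (1 ⊗ₜ 1) * Coalgebra.comul b = (a ⊗ₜ 1) * Coalgebra.comul b
    rw [← Algebra.TensorProduct.one_def, mul_one]
  rw [h]
  exact Function.Bijective.of_comp_iff' (AlgBimodule.of
    (Algebra.TensorProduct.includeLeft : H →ₐ[R] H ⊗[R] H) (Bialgebra.comulAlgHom R H)).bijective _

lemma HopfL.bijective_bimoduleSpan_iff :
    Function.Bijective (bimoduleSpan R H (HopfL.tmul 1 1 : HopfL R H)) ↔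
      Function.Bijective (galoisMap R H) := by
  have h : bimoduleSpan R H (HopfL.tmul 1 1 : HopfL R H) =
      (AlgBimodule.of _ _).toLinearMap ∘ₗ galoisMap R H := by
    refine TensorProduct.ext' fun a b ↦ ?_
    rw [LinearMap.comp_apply, galoisMap_tmul]
    change Coalgebra.comul a * ((1 : H) ⊗ₜ[R] (1 : H)) * (1 ⊗ₜ b) = Coalgebra.comul a * (1 ⊗ₜ b)
    rw [← Algebra.TensorProduct.one_def, mul_one]
  rw [h]
  exact Function.Bijective.of_comp_iff' (AlgBimodule.of (Bialgebra.comulAlgHom R H)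
    (Algebra.TensorProduct.includeRight : H →ₐ[R] H ⊗[R] H)).bijective _

end HopfCorings

/-! ### The equivalences -/

theorem mainTheorem1 (R H : Type u) [CommRing R] [Ring H] [Bialgebra R H] :
    List.TFAE [
      ∃ S : H →ₗ[R] H,
        LinearMap.mul' R H ∘ₗ S.lTensor H ∘ₗ Coalgebra.comul =
          Algebra.linearMap R H ∘ₗ Coalgebra.counit ∧
        LinearMap.mul' R H ∘ₗ S.rTensor H ∘ₗ Coalgebra.comul =
          Algebra.linearMap R H ∘ₗ Coalgebra.counit,
      Function.Bijective (galoisMap R H),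
      (RightComodule.ofGrouplike (HopfR.isGrouplike_one R H)).IsGalois,
      (LeftComodule.ofGrouplike (HopfR.isGrouplike_one R H)).IsGalois,
      (RightComodule.ofGrouplike (HopfL.isGrouplike_one R H)).IsGalois,
      (LeftComodule.ofGrouplike (HopfL.isGrouplike_one R H)).IsGalois,
      (tensorBimonad R H).IsHopf,
      IsIso (homBimonad R H).fusion,
      (homBimonad R H).IsHopf,
      (tensorHopfFunctor R H).IsEquivalence,
      (homHopfFunctor R H).IsEquivalence,
      (LeftComodule.ofGrouplike (HopfR.isGrouplike_one R H)).IsHomGalois,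
      (RightComodule.ofGrouplike (HopfR.isGrouplike_one R H)).IsHomGalois,
      (LeftComodule.ofGrouplike (HopfL.isGrouplike_one R H)).IsHomGalois,
      (RightComodule.ofGrouplike (HopfL.isGrouplike_one R H)).IsHomGalois] := by
  have hγ := tensorBimonad_isHopf_iff_galoisMap R H
  -- The bijectivity of β and that of γ are linked through the antipode of `- ⊗ H`; this brings the
  -- conditions on H ⊗ʳ H back to γ.
  have hβ := (tensorBimonad_isHopf_iff_cogaloisMap R H).symm.trans hγ
  have hr := HopfR.bijective_bimoduleSpan_iff.trans hβ
  have hl := HopfL.bijective_bimoduleSpan_iff (R := R) (H := H)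
  have iR := HopfR.eq_algebraMap_of_smul_eq (R := R) (H := H)
  have iL := HopfL.eq_algebraMap_of_smul_eq (R := R) (H := H)
  have hh := homBimonad_isHopf_iff_galoisMap R H
  tfae_have 1 ↔ 2 := (tensorBimonad_isHopf_iff_antipode R H).symm.trans hγ
  tfae_have 3 ↔ 2 := (RightComodule.isGalois_ofGrouplike_iff iR).trans hr
  tfae_have 4 ↔ 2 := (LeftComodule.isGalois_ofGrouplike_iff iR).trans hr
  tfae_have 5 ↔ 2 := (RightComodule.isGalois_ofGrouplike_iff iL).trans hl
  tfae_have 6 ↔ 2 := (LeftComodule.isGalois_ofGrouplike_iff iL).trans hl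
  tfae_have 7 ↔ 2 := hγ
  tfae_have 8 ↔ 2 :=
    TauBimonad.isIso_fusion_iff.trans (TauBimonad.isHopf_iff_isIso_fus.symm.trans hh)
  tfae_have 9 ↔ 2 := hh
  tfae_have 10 ↔ 2 :=
    (TauBimonad.toMixed_isEquivalence_iff tensorPsi_isMixedLaw).trans hγ
  tfae_have 11 ↔ 2 := (TauBimonad.toMixed_isEquivalence_iff homPsi_isMixedLaw).trans hh
  tfae_have 12 ↔ 2 := (LeftComodule.isHomGalois_ofGrouplike_iff iR).trans hr
  tfae_have 13 ↔ 2 := (RightComodule.isHomGalois_ofGrouplike_iff iR).trans hr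
  tfae_have 14 ↔ 2 := (LeftComodule.isHomGalois_ofGrouplike_iff iL).trans hl
  tfae_have 15 ↔ 2 := (RightComodule.isHomGalois_ofGrouplike_iff iL).trans hl
  tfae_finish
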